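/- Let $\mathbf k\subseteq\mathbb R$ be a field and $q\in\mathbf k$ with $q>0$. For $k\in\mathbb Z$ let $[k]_q=(1-q^k)/(1-q)$ (and $[k]_q=k$ if $q=1$), and $[k]!_q=[1]_q\cdots[k]_q$ for $k\ge 0$. **Hecke algebra and shuffles.** Let $\mathcal H_n$ be the unital $\mathbf k$-algebra generated by $T_1,\dots,T_{n-1}$ with relations $T_i^2=(q-1)T_i+q$, $T_iT_j=T_jT_i$ for $|i-j|>1$, and $T_iT_{i+1}T_i=T_{i+1}T_iT_{i+1}$. Put $\mathcal B_m=\sum_{i=1}^m T_{m-1}T_{m-2}\cdots T_i$ and $\mathcal B^*_m=\sum_{i=1}^m T_iT_{i+1}\cdots T_{m-1}$ (both $0$ for $m\le 0$), and for $k\ge 0$ $$\mathcal B_{n,k}=\mathcal B_{n-k+1}\cdots\mathcal B_{n-1}\mathcal B_n,\qquad \mathcal B^*_{n,k}=\mathcal B^*_n\mathcal B^*_{n-1}\cdots\mathcal B^*_{n-k+1},\qquad \mathcal R_{n,k}=\frac1{[k]!_q}\mathcal B^*_{n,k}\mathcal B_{n,k}.$$ **Specht modules.** $\mathcal H_n$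 acts from the right on formal linear combinations of words $w=w_1\cdots w_n$ of positive integers: with $w'$ denoting $w$ with its $i$-th and $(i+1)$-st letters exchanged, $wT_i=qw$ if $w_i=w_{i+1}$, $wT_i=w'$ if $w_i<w_{i+1}$, and $wT_i=qw'+(q-1)w$ if $w_i>w_{i+1}$. The cell in row $i$ and column $j$ of a Young diagram has content $j-i$. Let $J_m=\sum_{i=1}^{m-1}q^{i-m}\,T_{m-1}\cdots T_{i+1}T_iT_{i+1}\cdots T_{m-1}$. For a standard tableau $\mathfrak t$ with $n$ cells in which the entry $m$ has content $c_{\mathfrak t}(m)$, the Young seminormal idempotent is $$p_{\mathfrak t}=\prod_{m=1}^n\ \prod_{\substack{-n<c<n\\ c\ne c_{\mathfrak t}(m)}}\frac{J_m-[c]_q}{[c_{\mathfrak t}(m)]_q-[c]_q}\in\mathcal H_n .$$ For $\lambda\vdash n$, the isotypic projector is $p_\lambda=\sum_{\mathfrak t}p_{\mathfrak t}$, summed over the standard tableaux $\mathfrak t$ of shape $\lambda$, and the Specht module $S^\lambda$ is the span of the vectors $\mathrm{word}(\mathfrak t)\,p_{\mathfrak t}$ for these $\mathfrak t$, where the $m$-th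 letter of $\mathrm{word}(\mathfrak t)$ is the number of the row of $\mathfrak t$ containing $m$. **Skew shapes.** For $\mu\subseteq\lambda$ with $\mu\vdash j$ and $\lambda\vdash n$, list the cells of $\lambda/\mu$ row by row from top to bottom, each row from left to right, and number them $j+1,\dots,n$ in this order. Let $c_\ell$ be the content of the cell numbered $\ell$. The linear map $\Phi_{\lambda/\mu}$ (written on the right) appends to each word of length $j$ the row numbers of the cells of $\lambda/\mu$, in this order. Call $\lambda/\mu$ a horizontal strip if no two of its cells lie in the same column. For $k\ge0$ set $$\mathcal E_{\lambda/\mu}(k)=q^{nk-\binom k2}\sum_{j<\ell_1<\ell_2<\cdots<\ell_k\le n}\ \prod_{m=1}^k q^{-\ell_m}\,[\ell_m+1-m+c_{\ell_m}]_q .$$ **Theorem.** (1) Let $n\ge 0$ and $\lambda\vdash n$. For each partition $\mu\subseteq\lambda$ fix a basis $\kappa_\mu$ of $\{v\in S^\mu: v\,\mathcal R_{|\mu|,1}=0\}$. Then the vectors $$y^\lambda_{\mu(u)}=u\,\Phi_{\lambda/\mu}\,\mathcal B_{n,n-|\mu|}\,p_\lambda ,$$ where $\mu\subseteq\lambda$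 ranges over the partitions such that $\lambda/\mu$ is a horizontal strip and $u$ over $\kappa_\mu$, form a basis of $S^\lambda$ (in particular, they are distinct), and for all $k\ge 0$ $$y^\lambda_{\mu(u)}\,\mathcal R_{n,k}=\mathcal E_{\lambda/\mu}(k)\,y^\lambda_{\mu(u)} .$$ (2) For every $n\ge 0$, there is a basis of $\mathcal H_n$ each of whose elements is an eigenvector of right multiplication by $\mathcal R_{n,k}$ for all $k\ge 0$. -/

import Mathlib

namespace HeckeShuffle

/-! ## `q`-integers -/

section QIntegers

variable {K : Type*} [Field K]

/-- The `q`-integer `[k]_q` for `k : ℤ`: it is `1 + q + ⋯ + q ^ (k - 1)` for `k ≥ 0` and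
`-q⁻¹ - q⁻² - ⋯ - q ^ k` for `k < 0`, so `(1 - q ^ k) / (1 - q)` whenever `q ≠ 0, 1`. -/
def qInt (q : K) : ℤ → K
  | Int.ofNat k => ∑ i ∈ Finset.range k, q ^ i
  | Int.negSucc k => -∑ i ∈ Finset.range (k + 1), q⁻¹ ^ (i + 1)

/-- The `q`-factorial `[k]!_q = [1]_q [2]_q ⋯ [k]_q`. -/
def qFactorial (q : K) (k : ℕ) : K :=
  ∏ i ∈ Finset.range k, qInt q ((i : ℤ) + 1)

end QIntegers

/-! ## The Hecke algebra -/

/-- Indices `1, 2, …, n - 1` of the generators of the Hecke algebra. -/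
abbrev Gen (n : ℕ) : Type := {i : ℕ // 1 ≤ i ∧ i < n}

/-- The defining relations of the Hecke algebra. -/
inductive HeckeRel {K : Type*} [Field K] (q : K) (n : ℕ) :
    FreeAlgebra K (Gen n) → FreeAlgebra K (Gen n) → Prop
  | quad (i : Gen n) :
      HeckeRel q n (FreeAlgebra.ι K i * FreeAlgebra.ι K i)
        ((q - 1) • FreeAlgebra.ι K i + q • 1)
  | comm (i j : Gen n) (h : i.1 + 1 < j.1 ∨ j.1 + 1 < i.1) :
      HeckeRel q n (FreeAlgebra.ι K i * FreeAlgebra.ι K j)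
        (FreeAlgebra.ι K j * FreeAlgebra.ι K i)
  | braid (i j : Gen n) (h : j.1 = i.1 + 1) :
      HeckeRel q n (FreeAlgebra.ι K i * FreeAlgebra.ι K j * FreeAlgebra.ι K i)
        (FreeAlgebra.ι K j * FreeAlgebra.ι K i * FreeAlgebra.ι K j)

/-- The Hecke algebra `H_n` of the symmetric group `S_n` with parameter `q`. -/
abbrev Hecke {K : Type*} [Field K] (q : K) (n : ℕ) : Type _ := RingQuot (HeckeRel q n)

section Elements

variable {K : Type*} [Field K] (q : K) (n : ℕ)

/-- The generator `T_i` of `H_n`, for `1 ≤ i ≤ n - 1` (and `0` for all other `i`). -/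
noncomputable def T (i : ℕ) : Hecke q n :=
  if h : 1 ≤ i ∧ i < n then
    RingQuot.mkAlgHom K (HeckeRel q n) (FreeAlgebra.ι K ⟨i, h⟩)
  else 0

/-- The element `B_m = ∑_{i=1}^m T_{m-1} T_{m-2} ⋯ T_i`, regarded in `H_n` (for `m ≤ n`). -/
noncomputable def B (m : ℕ) : Hecke q n :=
  ∑ i ∈ Finset.Icc 1 m, ((List.range' i (m - i)).reverse.map (T q n)).prod

/-- The element `B*_m = ∑_{i=1}^m T_i T_{i+1} ⋯ T_{m-1}`, regarded in `H_n` (for `m ≤ n`). -/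
noncomputable def BStar (m : ℕ) : Hecke q n :=
  ∑ i ∈ Finset.Icc 1 m, ((List.range' i (m - i)).map (T q n)).prod

/-- The `k`-bottom-to-random shuffle `B_{n,k} = B_{n-(k-1)} ⋯ B_{n-1} B_n`;
it is `0` for `k > n`, because `B_0 = 0`. -/
noncomputable def Bk (k : ℕ) : Hecke q n :=
  ((List.range k).reverse.map fun a => B q n (n - a)).prod

/-- The `k`-random-to-bottom shuffle `B*_{n,k} = B*_n B*_{n-1} ⋯ B*_{n-(k-1)}`;
it is `0` for `k > n`, because `B*_0 = 0`. -/
noncomputable def BkStar (k : ℕ) : Hecke q n :=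
  ((List.range k).map fun a => BStar q n (n - a)).prod

/-- The `k`-random-to-random shuffle `R_{n,k} = ([k]!_q)⁻¹ B*_{n,k} B_{n,k}`
(used only when `[k]!_q ≠ 0`). -/
noncomputable def R (k : ℕ) : Hecke q n :=
  (qFactorial q k)⁻¹ • (BkStar q n k * Bk q n k)

/-- The basis element `T_{(i,k)}` of `H_n` attached to the transposition of `i < k`, through the
reduced expression `s_{k-1} ⋯ s_{i+1} s_i s_{i+1} ⋯ s_{k-1}`. -/
noncomputable def Ttransp (i k : ℕ) : Hecke q n :=
  (((List.range' i (k - i)).reverse ++ List.range' (i + 1) (k - 1 - i)).map (T q n)).prod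

/-- The Young--Jucys--Murphy element `J_k = ∑_{i=1}^{k-1} q ^ (i - k) T_{(i,k)}`. -/
noncomputable def J (k : ℕ) : Hecke q n :=
  ∑ i ∈ Finset.Ico 1 k, q ^ ((i : ℤ) - (k : ℤ)) • Ttransp q n i k

end Elements

/-! ## Words and the right action of the Hecke algebra on them -/

/-- The vector space of all formal linear combinations of words of length `n` with letters in `ℕ`.
The word module `W^λ` is the subspace spanned by the words of content `λ`. -/
abbrev Words (K : Type*) [Field K] (n : ℕ) : Type _ := (Fin n → ℕ) →₀ K

section Action

variable {K : Type*} [Field K] (q : K) {n : ℕ}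

/-- The operator that compares the letters at the positions `a` and `b`: a word `w` is sent to
`q w` if `w_a = w_b`, to `w'` if `w_a < w_b`, and to `q w' + (q - 1) w` if `w_a > w_b`, where `w'`
is `w` with these two letters exchanged. -/
noncomputable def swapOp (a b : Fin n) : Words K n →ₗ[K] Words K n :=
  Finsupp.linearCombination K fun w =>
    if w a = w b then q • Finsupp.single w 1
    else if w a < w b then Finsupp.single (w ∘ Equiv.swap a b) 1
    else q • Finsupp.single (w ∘ Equiv.swap a b) 1 + (q - 1) • Finsupp.single w 1

/-- The action of `T_i` on words: `swapOp` at the `i`-th and `(i+1)`-st positions. -/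
noncomputable def genOp (i : Gen n) : Words K n →ₗ[K] Words K n :=
  swapOp q ⟨i.1 - 1, by have := i.2; omega⟩ ⟨i.1, i.2.2⟩

lemma swapOp_single (a b : Fin n) (w : Fin n → ℕ) :
    swapOp q a b (Finsupp.single w (1 : K)) =
    if w a = w b then q • Finsupp.single w 1
    else if w a < w b then Finsupp.single (w ∘ Equiv.swap a b) 1
    else q • Finsupp.single (w ∘ Equiv.swap a b) 1 + (q - 1) • Finsupp.single w 1 := by
  simp [swapOp, Finsupp.linearCombination_single]

lemma swapOp_quad (a b : Fin n) :
    swapOp q a b * swapOp q a b = (q - 1) • swapOp q a b + q • (1 : Module.End K (Words K n)) := by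
  refine Finsupp.lhom_ext' fun w => LinearMap.ext_ring ?_
  have hs : (w ∘ Equiv.swap a b) ∘ Equiv.swap a b = w := by
    funext p; simp
  simp only [LinearMap.comp_apply, Finsupp.lsingle_apply, Module.End.mul_apply,
    LinearMap.add_apply, LinearMap.smul_apply, Module.End.one_apply, swapOp_single]
  rcases lt_trichotomy (w a) (w b) with h | h | h
  · simp [h, h.ne, h.ne', h.not_gt, swapOp_single, hs, add_comm]
  · simp only [h, if_true, map_smul, swapOp_single]
    module
  · simp only [h.ne', h.not_gt, if_false, map_smul, map_add, swapOp_single, hs,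
      Function.comp_apply, Equiv.swap_apply_left, Equiv.swap_apply_right, h.ne, h, if_true]
    module

lemma swapOp_comm (a b c d : Fin n) (hac : a ≠ c) (had : a ≠ d) (hbc : b ≠ c) (hbd : b ≠ d) :
    swapOp q a b * swapOp q c d = swapOp q c d * swapOp (K := K) q a b := by
  refine Finsupp.lhom_ext' fun w => LinearMap.ext_ring ?_
  have hs : (w ∘ Equiv.swap a b) ∘ Equiv.swap c d = (w ∘ Equiv.swap c d) ∘ Equiv.swap a b := by
    funext p
    have : Equiv.swap a b * Equiv.swap c d = Equiv.swap c d * Equiv.swap a b := by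
      apply Equiv.Perm.Disjoint.commute
      intro x
      by_cases h1 : x = a
      · right; subst h1; exact Equiv.swap_apply_of_ne_of_ne hac had
      by_cases h2 : x = b
      · right; subst h2; exact Equiv.swap_apply_of_ne_of_ne hbc hbd
      left; exact Equiv.swap_apply_of_ne_of_ne h1 h2
    have := congrArg (fun e : Equiv.Perm (Fin n) => w (e p)) this
    simpa using this
  have h1 : Equiv.swap a b c = c := Equiv.swap_apply_of_ne_of_ne hac.symm hbc.symm
  have h2 : Equiv.swap a b d = d := Equiv.swap_apply_of_ne_of_ne had.symm hbd.symm
  have h3 : Equiv.swap c d a = a := Equiv.swap_apply_of_ne_of_ne hac had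
  have h4 : Equiv.swap c d b = b := Equiv.swap_apply_of_ne_of_ne hbc hbd
  simp only [LinearMap.comp_apply, Finsupp.lsingle_apply, Module.End.mul_apply, swapOp_single]
  split_ifs <;>
    simp only [map_smul, map_add, swapOp_single, Function.comp_apply, *,
      if_true, if_false] <;> module

/-- The word `w` with the letters at `a`, `b`, `c` replaced by `x`, `y`, `z`. -/
def put (w : Fin n → ℕ) (a b c : Fin n) (x y z : ℕ) : Fin n → ℕ :=
  fun p => if p = a then x else if p = b then y else if p = c then z else w p

lemma swapOp_put_left (w : Fin n → ℕ) {a b c : Fin n} (hab : a ≠ b) (hac : a ≠ c) (hbc : b ≠ c)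
    (x y z : ℕ) :
    swapOp q a b (Finsupp.single (put w a b c x y z) (1 : K)) =
    if x = y then q • Finsupp.single (put w a b c x y z) 1
    else if x < y then Finsupp.single (put w a b c y x z) 1
    else q • Finsupp.single (put w a b c y x z) 1 +
      (q - 1) • Finsupp.single (put w a b c x y z) 1 := by
  have e : put w a b c x y z ∘ Equiv.swap a b = put w a b c y x z := by
    funext p
    simp only [Function.comp_apply, put, Equiv.swap_apply_def]
    split_ifs <;> simp_all
  rw [swapOp_single, e]
  simp [put, hab.symm]

lemma swapOp_put_right (w : Fin n → ℕ) {a b c : Fin n} (hab : a ≠ b) (hac : a ≠ c) (hbc : b ≠ c)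
    (x y z : ℕ) :
    swapOp q b c (Finsupp.single (put w a b c x y z) (1 : K)) =
    if y = z then q • Finsupp.single (put w a b c x y z) 1
    else if y < z then Finsupp.single (put w a b c x z y) 1
    else q • Finsupp.single (put w a b c x z y) 1 +
      (q - 1) • Finsupp.single (put w a b c x y z) 1 := by
  have e : put w a b c x y z ∘ Equiv.swap b c = put w a b c x z y := by
    funext p
    simp only [Function.comp_apply, put, Equiv.swap_apply_def]
    split_ifs <;> simp_all
  rw [swapOp_single, e]
  simp [put, hab.symm, hac.symm, hbc.symm]

lemma swapOp_braid (a b c : Fin n) (hab : a ≠ b) (hac : a ≠ c) (hbc : b ≠ c) :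
    swapOp q a b * swapOp q b c * swapOp q a b =
      swapOp q b c * swapOp q a b * swapOp (K := K) q b c := by
  refine Finsupp.lhom_ext' fun w => LinearMap.ext_ring ?_
  have hw : w = put w a b c (w a) (w b) (w c) := by
    funext p
    simp only [put]
    split_ifs <;> simp_all
  simp only [LinearMap.comp_apply, Finsupp.lsingle_apply, Module.End.mul_apply]
  rw [hw]
  generalize w a = x
  generalize w b = y
  generalize w c = z
  have tri (r s : ℕ) : (r < s ∧ ¬ s < r ∧ r ≠ s ∧ s ≠ r) ∨ (r = s) ∨
      (s < r ∧ ¬ r < s ∧ r ≠ s ∧ s ≠ r) := by omega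
  rcases tri x y with h1 | h1 | h1 <;> rcases tri y z with h2 | h2 | h2 <;>
  rcases tri x z with h3 | h3 | h3 <;> first
  | (exfalso; omega)
  | (clear tri hw
     try subst h1
     try subst h2
     try subst h3
     simp only [swapOp_put_left q w hab hac hbc, swapOp_put_right q w hab hac hbc,
      map_add, map_smul, *, if_true, if_false, lt_irrefl, smul_add]
     try module)

/-- The right action of `H_n` on words, as an algebra homomorphism to the opposite of the
endomorphism algebra. -/
noncomputable def wordRep : Hecke q n →ₐ[K] (Module.End K (Words K n))ᵐᵒᵖ :=
  RingQuot.liftAlgHom K ⟨FreeAlgebra.lift K fun i => MulOpposite.op (genOp q i), by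
    intro x y h
    induction h with
    | quad i =>
      simp only [map_mul, map_add, map_smul, map_one, FreeAlgebra.lift_ι_apply]
      rw [← MulOpposite.op_mul, genOp, swapOp_quad]
      rfl
    | comm i j h =>
      simp only [map_mul, FreeAlgebra.lift_ι_apply]
      rw [← MulOpposite.op_mul, ← MulOpposite.op_mul]
      have hi := i.2
      have hj := j.2
      congr 1
      refine swapOp_comm q _ _ _ _ ?_ ?_ ?_ ?_ <;> simp only [ne_eq, Fin.mk.injEq] <;> omega
    | braid i j h =>
      simp only [map_mul, FreeAlgebra.lift_ι_apply]
      rw [← MulOpposite.op_mul, ← MulOpposite.op_mul, ← MulOpposite.op_mul,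
        ← MulOpposite.op_mul]
      have hi := i.2
      have hj := j.2
      congr 1
      have e : (⟨j.1 - 1, by omega⟩ : Fin n) = ⟨i.1, i.2.2⟩ := by
        simp only [Fin.mk.injEq]; omega
      simp only [genOp, e, ← mul_assoc]
      refine swapOp_braid q _ _ _ ?_ ?_ ?_ <;> simp only [ne_eq, Fin.mk.injEq] <;> omega⟩

/-- The operator `v ↦ v h` on words, for `h ∈ H_n`. -/
noncomputable def rightAct (h : Hecke q n) : Words K n →ₗ[K] Words K n :=
  MulOpposite.unop (wordRep q h)

end Action

/-! ## Tableaux, skew tableaux and horizontal strips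

A partition is a `YoungDiagram`; its cells `(i, j)` are numbered from `0`, `i` being the row. -/

/-- The content `j - i` of a cell `(i, j)`. -/
def content (c : ℕ × ℕ) : ℤ := (c.2 : ℤ) - (c.1 : ℤ)

/-- A bijective filling of `lam` (the entries `1, …, n` being numbered `0, …, n - 1`) is a standard
tableau if it increases along rows and down columns. -/
def IsStandard {lam : YoungDiagram} (t : lam.cells ≃ Fin lam.card) : Prop :=
  (∀ c d : lam.cells, c.1.1 = d.1.1 → c.1.2 < d.1.2 → t c < t d) ∧
  (∀ c d : lam.cells, c.1.2 = d.1.2 → c.1.1 < d.1.1 → t c < t d)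

/-- `lam / mu` is a horizontal strip: `mu ⊆ lam` and no two cells of `lam / mu` lie in the same
column. -/
def IsHorizontalStrip (lam mu : YoungDiagram) : Prop :=
  mu ≤ lam ∧ ∀ c ∈ lam.cells \ mu.cells, ∀ d ∈ lam.cells \ mu.cells, c.2 = d.2 → c = d

/-- The cells of `lam / mu`, listed row by row from top to bottom and each row from left to
right. -/
def skewCells (lam mu : YoungDiagram) : List (ℕ × ℕ) :=
  (List.range (lam.colLen 0)).flatMap fun i =>
    (List.range' (mu.rowLen i) (lam.rowLen i - mu.rowLen i)).map fun j => (i, j)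

/-- The cell with entry `l` (where `|mu| < l ≤ |lam|`) in the skew tableau of shape `lam / mu` that
is filled with `|mu| + 1, …, |lam|` in the order of `skewCells`. -/
def skewCell (lam mu : YoungDiagram) (l : ℕ) : ℕ × ℕ :=
  (skewCells lam mu).getD (l - mu.card - 1) (0, 0)

/-! ## Seminormal idempotents, isotypic projectors, Specht modules -/

section Specht

variable {K : Type*} [Field K] (q : K)

/-- The Young seminormal idempotent `p_t ∈ H_n`, by Murphy's formula
`p_t = ∏_{m=1}^n ∏_c (J_m - [c]_q) / ([c_t(m)]_q - [c]_q)`, where `c_t(m)` is the content of the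
entry `m` of `t` and `c` ranges over the integers with `-n < c < n` and `c ≠ c_t(m)`. -/
noncomputable def youngIdempotent {lam : YoungDiagram} (t : lam.cells ≃ Fin lam.card) :
    Hecke q lam.card :=
  (List.ofFn fun m : Fin lam.card =>
    Polynomial.aeval (J q lam.card (m.1 + 1))
      (Lagrange.basis (Finset.Ioo (-(lam.card : ℤ)) (lam.card : ℤ)) (qInt q)
        (content (t.symm m).1))).prod

open Classical in
/-- The isotypic projector `p_λ ∈ H_n`: the sum of the idempotents `p_t` over all standard
tableaux `t` of shape `λ`. -/
noncomputable def isotypicProjector (lam : YoungDiagram) : Hecke q lam.card :=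
  ∑ t : lam.cells ≃ Fin lam.card with IsStandard t, youngIdempotent q t

/-- The word of a tableau: its `m`-th letter is the (`1`-based) number of the row that contains
the entry `m`. -/
def tableauWord {lam : YoungDiagram} (t : lam.cells ≃ Fin lam.card) : Fin lam.card → ℕ :=
  fun m => (t.symm m).1.1 + 1

/-- The Specht module `S^λ`: the span of the Young seminormal units `word(t) p_t`, where `t` ranges
over the standard tableaux of shape `λ`. -/
noncomputable def specht (lam : YoungDiagram) : Submodule K (Words K lam.card) :=
  Submodule.span K {v | ∃ t : lam.cells ≃ Fin lam.card, IsStandard t ∧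
    v = rightAct q (youngIdempotent q t) (Finsupp.single (tableauWord t) 1)}

/-- The kernel of `R_{|μ|,1}` acting on `S^μ`. -/
noncomputable def spechtKer (mu : YoungDiagram) : Submodule K (Words K mu.card) :=
  specht q mu ⊓ LinearMap.ker (rightAct q (R q mu.card 1))

/-- The word obtained from `w` by appending the (`1`-based) row numbers of the cells of
`lam / mu`. -/
def appendWord (lam mu : YoungDiagram) (w : Fin mu.card → ℕ) : Fin lam.card → ℕ :=
  fun m => if h : m.1 < mu.card then w ⟨m.1, h⟩ else (skewCell lam mu (m.1 + 1)).1 + 1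

/-- The linear map `Φ_{λ/μ}`, which appends the row numbers of the cells of `λ/μ` to each word. -/
noncomputable def Phi (lam mu : YoungDiagram) : Words K mu.card →ₗ[K] Words K lam.card :=
  Finsupp.lmapDomain K K (appendWord lam mu)

/-- The vector `u Φ_{λ/μ} B_{n,n-|μ|} p_λ`, where `n = |λ|`. -/
noncomputable def eigenvec (lam mu : YoungDiagram) (u : Words K mu.card) : Words K lam.card :=
  rightAct q (isotypicProjector q lam)
    (rightAct q (Bk q lam.card (lam.card - mu.card)) (Phi lam mu u))

/-- `[l + 1 - i + c(l)]_q`, where `c(l)` is the content of the entry `l` of the skew tableau. -/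
def dq (lam mu : YoungDiagram) (l i : ℕ) : K :=
  qInt q ((l : ℤ) + 1 - (i : ℤ) + content (skewCell lam mu l))

open Classical in
/-- `E_{λ/μ}(k) = q ^ (n k - k choose 2) ∑_{|μ| < l_1 < ⋯ < l_k ≤ n} ∏_{m=1}^k q ^ (-l_m) d_{l_m,m}`
with `n = |λ|`. -/
noncomputable def eigenvalue (lam mu : YoungDiagram) (k : ℕ) : K :=
  q ^ ((lam.card : ℤ) * (k : ℤ) - (k.choose 2 : ℤ)) *
    ∑ l ∈ Fintype.piFinset (fun _ : Fin k => Finset.Ioc mu.card lam.card) with StrictMono l,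
      ∏ m : Fin k, q ^ (-(l m : ℤ)) * dq q lam mu (l m) (m.1 + 1)

end Specht

end HeckeShuffle

/-!
The Hecke algebra acts on words of length `n`; this space carries a positive definite form
(`q > 0` in an ordered field, `form`) for which every `T_i` is self-adjoint, so that the
Jucys--Murphy elements `J_m` are self-adjoint, and the insertions `B_m` and the removals `B*_m`
are adjoint to each other.

*Eigenvectors.* With `B*_{m,k} = B*_m ⋯ B*_{m-k+1}` and `B_{m,k} = B_{m-k+1} ⋯ B_m`, moving
`B_{m+1}` past the removals gives the recursion `IsHecke.insSum_mul_remProd_mul_insProd`, which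
expresses `B_{m+1} B*_{m+1,k+1} B_{m+1,k+1}` as a scalar multiple of
`(X_{m+1} - [k]) B*_{m,k} B_{m,k} B_{m+1}` plus `q ^ (k + 1) B*_{m,k+1} B_{m,k+1} B_{m+1}`, where
`X_m = [m] + q ^ m J_m`. Hence, if a vector `x` is annihilated by `B*_j` and is a joint
eigenvector of `J_{j+1}, …, J_n`, then `x B_{j+1} ⋯ B_n` is an eigenvector of all the shuffles
(`act_insProd_act`), and its eigenvalue obeys the recursion of the sums `E_{λ/μ}(k)`.

*Joint spectrum.* The joint eigenvalues of the Jucys--Murphy elements are the `[c]`, where `c`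
runs over the contents of standard fillings. The commutation of `T_i` with `J_i` and `J_{i+1}`,
combined with positivity, forbids consecutive equal contents and makes `T_i` act by `q` or `-1` on
neighbouring ones; then the braid relation leaves only the contents of addable cells
(`NZ.exists_addable`). Two standard fillings of a skew shape are connected by exchanges of
incomparable cells (`Std.adm`). The seminormal units `word(𝔱) p_𝔱` are not zero: a word has no
component in an isotypic component whose shape does not dominate its content (`dominance`,
`unit_ne_zero`).

*Spanning.* A stable finite-dimensional space is the sum of the kernel of `B*_m` and the image of
`B_m`, so it is spanned by the vectors `x B_{j+1} ⋯ B_m` with `x B*_j = 0` (`mem_span_insProd`),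
and `x` may be taken in one isotypic component of the first `j` positions, with the contents of a
filling of a skew shape at the other positions (`level_induction`). Exchanging cells changes
`x B_{j+1} ⋯ B_n` only by a nonzero factor, so the cells may be read row by row, and then `x`
comes from the Specht module of the smaller shape through `Φ` and the isotypic projector
(`exists_lift_eq`). If two cells lie in one column, then they may be assumed to be consecutive; a
generator acts by `-1` on `x` and is absorbed with the factor `q` by the insertions, so that the
vector is zero (`eigenvec_eq_zero`).

*Independence.* The cells of a horizontal strip can be listed with increasing contents. Then the
symmetrization of `x` over the last `n - j` positions is not zero (`act_symm_ne_zero`), and on it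
the insertion of `n - j` letters followed by their removal acts by a nonzero product of
`q`-integers (`symm_act_insProd_act_remProd`). So the removal of `n - j` letters recovers the
isotypic component of the smaller shape, where the next removal gives `0`; this makes the
eigenvectors for different shapes independent (`eigenvec_independent`).

For the regular representation, the Hecke algebra acts faithfully on the word `0 1 ⋯ (n - 1)`,
whose orbit contains all `n!` rearrangements (`orbitMap_injective`). The spanning argument for
this orbit gives the eigenbasis of the Hecke algebra.
-/


namespace HeckeShuffle

/-! ### `q`-integers -/

section QIntegers

variable {K : Type*} [Field K] {q : K}

lemma qInt_zero (q : K) : qInt q 0 = 0 := by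
  change ∑ i ∈ Finset.range 0, q ^ i = 0
  simp

lemma qInt_natCast_succ (q : K) (k : ℕ) : qInt q ((k : ℤ) + 1) = q * qInt q (k : ℤ) + 1 := by
  change ∑ i ∈ Finset.range (k + 1), q ^ i = q * ∑ i ∈ Finset.range k, q ^ i + 1
  rw [Finset.sum_range_succ', Finset.mul_sum]
  simp [pow_succ']

lemma qInt_one (q : K) : qInt q 1 = 1 := by
  have := qInt_natCast_succ q 0
  simpa [qInt_zero] using this

lemma qInt_succ (hq : q ≠ 0) (k : ℤ) : qInt q (k + 1) = q * qInt q k + 1 := by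
  obtain k | k := k
  · exact qInt_natCast_succ q k
  · rcases k with _ | k
    · change qInt q 0 = q * -∑ i ∈ Finset.range 1, q⁻¹ ^ (i + 1) + 1
      simp [qInt_zero, hq]
    · have e : (Int.negSucc (k + 1) + 1 : ℤ) = Int.negSucc k := by omega
      rw [e]
      change -∑ i ∈ Finset.range (k + 1), q⁻¹ ^ (i + 1) =
        q * -∑ i ∈ Finset.range (k + 1 + 1), q⁻¹ ^ (i + 1) + 1
      rw [Finset.sum_range_succ' _ (k + 1), mul_neg, mul_add, Finset.mul_sum]
      have : ∀ i ∈ Finset.range (k + 1), q * q⁻¹ ^ (i + 1 + 1) = q⁻¹ ^ (i + 1) := by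
        intro i _
        rw [pow_succ' _ (i + 1), ← mul_assoc, mul_inv_cancel₀ hq, one_mul]
      rw [Finset.sum_congr rfl this]
      simp [hq]

lemma qInt_pred (hq : q ≠ 0) (k : ℤ) : q * qInt q (k - 1) = qInt q k - 1 := by
  have := qInt_succ hq (k - 1)
  rw [sub_add_cancel] at this
  rw [this]; ring

/-- The defining property `(q - 1) [k]_q = q ^ k - 1`, also valid for `q = 1`. -/
lemma qInt_mul (hq : q ≠ 0) (k : ℤ) : (q - 1) * qInt q k + 1 = q ^ k := by
  induction k using Int.induction_on with
  | zero => simp [qInt_zero]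
  | succ k ih =>
    rw [qInt_succ hq, zpow_add_one₀ hq, ← ih]; ring
  | pred k ih =>
    have h := qInt_pred hq (-k : ℤ)
    apply mul_left_cancel₀ hq
    rw [zpow_sub_one₀ hq, ← ih, mul_add]
    calc q * ((q - 1) * qInt q (-k - 1)) + q * 1
        = (q - 1) * (q * qInt q (-k - 1)) + q := by ring
      _ = _ := by rw [h]; field_simp; ring

lemma qInt_succ' (hq : q ≠ 0) (k : ℤ) : qInt q (k + 1) = qInt q k + q ^ k := by
  rw [qInt_succ hq, ← qInt_mul hq]; ring

lemma qInt_add (hq : q ≠ 0) (k l : ℤ) : qInt q (k + l) = qInt q k + q ^ k * qInt q l := by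
  induction l using Int.induction_on with
  | zero => simp [qInt_zero]
  | succ l ih =>
    rw [← add_assoc, qInt_succ' hq, ih, qInt_succ' hq (l : ℤ), zpow_add₀ hq]; ring
  | pred l ih =>
    have h1 := qInt_succ' hq (k + (-l - 1))
    have h2 := qInt_succ' hq (-l - 1 : ℤ)
    rw [show k + (-(l : ℤ) - 1) + 1 = k + -l by ring, ih, zpow_add₀ hq] at h1
    rw [sub_add_cancel] at h2
    rw [h2] at h1
    linear_combination -h1

lemma qInt_strictMono [LinearOrder K] [IsStrictOrderedRing K] (hq : 0 < q) :
    StrictMono (qInt q) := by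
  refine strictMono_int_of_lt_succ fun k => ?_
  rw [qInt_succ' hq.ne']
  have := zpow_pos hq k
  linarith

end QIntegers

/-! ### Identities in an algebra with generators satisfying the Hecke relations -/

section Abstract

variable {K : Type*} [Field K] {A : Type*} [Ring A] [Algebra K A]

/-- The elements `t 1, …, t (N - 1)` of an algebra satisfy the relations of the Hecke algebra, and
`t 0 = 0`. -/
structure IsHecke (q : K) (N : ℕ) (t : ℕ → A) : Prop where
  zero : t 0 = 0
  quad : ∀ i, 1 ≤ i → i < N → t i * t i = (q - 1) • t i + q • 1
  comm : ∀ i j, i + 1 < j → j < N → t i * t j = t j * t i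
  braid : ∀ i, i + 1 < N → t i * t (i + 1) * t i = t (i + 1) * t i * t (i + 1)

/-- The sum of `t (m - 1) t (m - 2) ⋯ t i` over `j < i ≤ m`. -/
def insSum (t : ℕ → A) (j : ℕ) : ℕ → A
  | 0 => 0
  | m + 1 => if j ≤ m then 1 + t m * insSum t j m else 0

/-- The sum of `t i t (i + 1) ⋯ t (m - 1)` over `1 ≤ i ≤ m`. -/
def remSum (t : ℕ → A) : ℕ → A
  | 0 => 0
  | m + 1 => 1 + remSum t m * t m

/-- The product of `insSum t 0 (m - k + 1), …, insSum t 0 m`; it is `0` for `k > m`. -/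
def insProd (t : ℕ → A) : ℕ → ℕ → A
  | _, 0 => 1
  | 0, _ + 1 => 0
  | m + 1, k + 1 => insProd t m k * insSum t 0 (m + 1)

/-- The product of `remSum t m, …, remSum t (m - k + 1)`; it is `0` for `k > m`. -/
def remProd (t : ℕ → A) : ℕ → ℕ → A
  | _, 0 => 1
  | 0, _ + 1 => 0
  | m + 1, k + 1 => remSum t (m + 1) * remProd t m k

/-- The Young--Jucys--Murphy elements, through their recursion. -/
def jm (q : K) (t : ℕ → A) : ℕ → A
  | 0 => 0
  | m + 1 => q⁻¹ • (t m * jm q t m * t m + t m)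

/-- The elements `[m]_q + q ^ m J_m`. -/
def xm (q : K) (t : ℕ → A) (m : ℕ) : A := qInt q (m : ℤ) • 1 + q ^ m • jm q t m

/-- The product of the `insSum t j i` over `j < i ≤ m`: the sum of all `t_w` for `w` in the
symmetric group on the positions `j + 1, …, m`. -/
def symm (t : ℕ → A) (j : ℕ) : ℕ → A
  | 0 => 1
  | m + 1 => if j ≤ m then symm t j m * insSum t j (m + 1) else 1

/-- The product `t (m - 1) t (m - 2) ⋯ t k`. -/
def desc (t : ℕ → A) (k : ℕ) : ℕ → A
  | 0 => 1
  | m + 1 => if k ≤ m then t m * desc t k m else 1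

variable {q : K} {N : ℕ} {t : ℕ → A}

lemma insSum_succ {j m : ℕ} (h : j ≤ m) : insSum t j (m + 1) = 1 + t m * insSum t j m := by
  simp [insSum, h]

lemma insSum_of_le {j m : ℕ} (h : m ≤ j) : insSum t j m = 0 := by
  cases m with
  | zero => rfl
  | succ m => simp [insSum, show ¬ j ≤ m by omega]

lemma remSum_succ (m : ℕ) : remSum t (m + 1) = 1 + remSum t m * t m := rfl

lemma insProd_zero (m : ℕ) : insProd t m 0 = 1 := by cases m <;> rfl

lemma remProd_zero (m : ℕ) : remProd t m 0 = 1 := by cases m <;> rfl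

lemma insProd_succ (m k : ℕ) :
    insProd t (m + 1) (k + 1) = insProd t m k * insSum t 0 (m + 1) := rfl

lemma remProd_succ (m k : ℕ) :
    remProd t (m + 1) (k + 1) = remSum t (m + 1) * remProd t m k := rfl

/-- The other way to split off a factor of `insProd`. -/
lemma insProd_succ' (m k : ℕ) (h : k ≤ m) :
    insProd t m (k + 1) = insSum t 0 (m - k) * insProd t m k := by
  induction k generalizing m with
  | zero =>
    cases m with
    | zero => simp [insProd, insSum]
    | succ m => simp [insProd, insProd_zero]
  | succ k ih =>
    obtain ⟨m, rfl⟩ : ∃ m', m = m' + 1 := ⟨m - 1, by omega⟩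
    rw [insProd_succ, ih m (by omega), insProd_succ, mul_assoc,
      show m + 1 - (k + 1) = m - k by omega]

lemma symm_succ {j m : ℕ} (h : j ≤ m) : symm t j (m + 1) = symm t j m * insSum t j (m + 1) := by
  simp [symm, h]

lemma symm_of_le {j m : ℕ} (h : m ≤ j) : symm t j m = 1 := by
  cases m with
  | zero => rfl
  | succ m => simp [symm, show ¬ j ≤ m by omega]

lemma desc_succ {k m : ℕ} (h : k ≤ m) : desc t k (m + 1) = t m * desc t k m := by
  simp [desc, h]

lemma desc_of_le {k m : ℕ} (h : m ≤ k) : desc t k m = 1 := by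
  cases m with
  | zero => rfl
  | succ m => simp [desc, show ¬ k ≤ m by omega]

lemma desc_mul_last {k m : ℕ} (h : k < m) : desc t k m = desc t (k + 1) m * t k := by
  induction m, h using Nat.le_induction with
  | base => rw [desc_succ le_rfl, desc_of_le le_rfl, desc_of_le le_rfl]; simp
  | succ m h ih =>
    rw [desc_succ (by omega), ih, desc_succ (by omega), mul_assoc]

lemma insSum_eq_sum (j m : ℕ) : insSum t j m = ∑ i ∈ Finset.Ioc j m, desc t i m := by
  induction m with
  | zero => simp [insSum]
  | succ m ih =>
    by_cases h : j ≤ m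
    · rw [insSum_succ h, ih, ← Finset.insert_Ioc_right_eq_Ioc_add_one h, Finset.sum_insert (by simp),
        desc_of_le le_rfl, Finset.mul_sum]
      congr 1
      refine Finset.sum_congr rfl fun i hi => ?_
      rw [desc_succ (Finset.mem_Ioc.1 hi).2]
    · rw [insSum_of_le (by omega), Finset.Ioc_eq_empty (by omega)]; simp

namespace IsHecke

variable (H : IsHecke q N t)
include H

lemma op : IsHecke q N (fun i => MulOpposite.op (t i)) where
  zero := by simp [H.zero]
  quad i h1 h2 := by
    rw [← MulOpposite.op_mul, H.quad i h1 h2]; rfl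
  comm i j h1 h2 := by
    rw [← MulOpposite.op_mul, ← MulOpposite.op_mul, H.comm i j h1 h2]
  braid i h := by
    simp only [← MulOpposite.op_mul, ← mul_assoc, H.braid i h]

end IsHecke

end Abstract

/-! ### Commutation relations and absorption of generators -/

section Abstract

variable {K : Type*} [Field K] {A : Type*} [Ring A] [Algebra K A]
variable {q : K} {N : ℕ} {t : ℕ → A}

lemma commute_insSum {a : A} {j m : ℕ} (h : ∀ i, j < i → i < m → Commute a (t i)) :
    Commute a (insSum t j m) := by
  induction m with
  | zero => exact Commute.zero_right a
  | succ m ih =>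
    rcases lt_trichotomy j m with hj | rfl | hj
    · rw [insSum_succ hj.le]
      exact (Commute.one_right a).add_right
        ((h m hj (by omega)).mul_right (ih fun i h1 h2 => h i h1 (by omega)))
    · rw [insSum_succ le_rfl, insSum_of_le le_rfl]; simp
    · rw [insSum_of_le (by omega)]; simp

lemma commute_remSum {a : A} {m : ℕ} (h : ∀ i, 1 ≤ i → i < m → Commute a (t i)) :
    Commute a (remSum t m) := by
  induction m with
  | zero => exact Commute.zero_right a
  | succ m ih =>
    rcases Nat.eq_zero_or_pos m with rfl | hm
    · simp [remSum]
    · exact (Commute.one_right a).add_right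
        ((ih fun i h1 h2 => h i h1 (by omega)).mul_right (h m hm (by omega)))

lemma commute_insProd {a : A} {m k : ℕ} (h : ∀ i, 1 ≤ i → i < m → Commute a (t i)) :
    Commute a (insProd t m k) := by
  induction m generalizing k with
  | zero => cases k <;> simp [insProd]
  | succ m ih =>
    cases k with
    | zero => simp [insProd]
    | succ k =>
      exact (ih fun i h1 h2 => h i h1 (by omega)).mul_right (commute_insSum fun i h1 h2 => h i h1 h2)

lemma commute_remProd {a : A} {m k : ℕ} (h : ∀ i, 1 ≤ i → i < m → Commute a (t i)) :
    Commute a (remProd t m k) := by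
  induction m generalizing k with
  | zero => cases k <;> simp [remProd]
  | succ m ih =>
    cases k with
    | zero => simp [remProd]
    | succ k =>
      exact (commute_remSum fun i h1 h2 => h i h1 h2).mul_right
        (ih fun i h1 h2 => h i h1 (by omega))

lemma commute_symm {a : A} {j m : ℕ} (h : ∀ i, j < i → i < m → Commute a (t i)) :
    Commute a (symm t j m) := by
  induction m with
  | zero => exact Commute.one_right a
  | succ m ih =>
    by_cases hj : j ≤ m
    · rw [symm_succ hj]
      exact (ih fun i h1 h2 => h i h1 (by omega)).mul_right (commute_insSum h)
    · rw [symm_of_le (by omega)]; simp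

namespace IsHecke

variable (H : IsHecke q N t)
include H

lemma commute {i j : ℕ} (h : i + 1 < j ∨ j + 1 < i) (hi : i < N) (hj : j < N) :
    Commute (t i) (t j) := by
  rcases h with h | h
  · exact H.comm i j h hj
  · exact (H.comm j i h hi).symm

lemma jm_one : jm q t 1 = 0 := by simp [jm, H.zero]

lemma commute_jm {a : A} {m : ℕ} (h : ∀ i, 1 ≤ i → i < m → Commute a (t i)) :
    Commute a (jm q t m) := by
  induction m with
  | zero => exact Commute.zero_right a
  | succ m ih =>
    rcases Nat.eq_zero_or_pos m with rfl | hm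
    · rw [H.jm_one]; exact Commute.zero_right a
    · have h1 := h m hm (by omega)
      exact ((((h1.mul_right (ih fun i h1 h2 => h i h1 (by omega))).mul_right h1).add_right
        h1)).smul_right _

lemma t_commute_jm_of_lt {i m : ℕ} (h : m < i) (hi : i < N) : Commute (t i) (jm q t m) :=
  H.commute_jm fun k _ h2 => H.commute (Or.inr (by omega)) hi (by omega)

lemma xm_succ (hq : q ≠ 0) (m : ℕ) (hm : m < N) :
    xm q t (m + 1) = t m * xm q t m * t m + t m + 1 := by
  rcases Nat.eq_zero_or_pos m with rfl | h
  · simp [xm, jm, H.zero, qInt_one]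
  · have e := H.quad m h hm
    simp only [xm, jm, mul_add, add_mul, mul_smul_comm, smul_mul_assoc, mul_one, e, smul_add,
      Nat.cast_add, Nat.cast_one, qInt_succ hq, pow_succ, smul_smul]
    have h1 := qInt_mul hq (m : ℤ)
    rw [zpow_natCast] at h1
    rw [show q ^ m * q * q⁻¹ = q ^ m by field_simp, ← h1]
    module

lemma t_commute_xm_of_lt {i m : ℕ} (h : m < i) (hi : i < N) : Commute (t i) (xm q t m) :=
  ((Commute.one_right _).smul_right _).add_right ((H.t_commute_jm_of_lt h hi).smul_right _)

lemma t_commute_jm_of_gt (hq : q ≠ 0) {i m : ℕ} (hi : 1 ≤ i) (h : i + 1 < m) (hm : m ≤ N) :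
    Commute (t i) (jm q t m) := by
  have key : ∀ m, i + 1 < m → m ≤ N → Commute (t i) (xm q t m) := by
    intro m h
    induction m, h using Nat.le_induction with
    | base =>
      intro hN
      have e1 := H.quad i hi (by omega)
      have e3 := H.braid i (by omega)
      have e4 := (H.t_commute_xm_of_lt (m := i) (i := i + 1) (by omega) (by omega)).eq
      rw [H.xm_succ hq (i + 1) (by omega), H.xm_succ hq i (by omega)]
      have e5 : t (i + 1) * (t i * xm q t i * t i + t i + 1) * t (i + 1) + t (i + 1) + 1 =
          t (i + 1) * t i * xm q t i * t i * t (i + 1) +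
          (t (i + 1) * t i * t (i + 1) + t (i + 1) * t (i + 1) + t (i + 1)) + 1 := by
        noncomm_ring
      rw [e5]
      refine Commute.add_right (Commute.add_right ?_ ?_) (Commute.one_right _)
      · calc t i * (t (i + 1) * t i * xm q t i * t i * t (i + 1))
            = t i * t (i + 1) * t i * xm q t i * t i * t (i + 1) := by noncomm_ring
          _ = t (i + 1) * t i * (t (i + 1) * xm q t i) * t i * t (i + 1) := by
              rw [e3]; noncomm_ring
          _ = t (i + 1) * t i * xm q t i * (t (i + 1) * t i * t (i + 1)) := by
              rw [e4]; noncomm_ring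
          _ = _ := by rw [← e3]; noncomm_ring
      · rw [H.quad (i + 1) (by omega) (by omega), ← e3]
        have : Commute (t i) (t i * t (i + 1) * t i + (q • t (i + 1) + q • 1)) := by
          have e6 : t i * (t i * t (i + 1) * t i) = (t i * t i) * t (i + 1) * t i := by
            noncomm_ring
          have e7 : t i * t (i + 1) * t i * t i = t i * t (i + 1) * (t i * t i) := by
            noncomm_ring
          change _ * _ = _ * _
          rw [mul_add, add_mul, e6, e7, e1]
          simp only [mul_add, add_mul, mul_smul_comm, smul_mul_assoc, mul_one, one_mul]
          module
        convert this using 1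
        module
    | succ m h ih =>
      intro hN
      rw [H.xm_succ hq m (by omega)]
      have h1 := H.commute (i := i) (j := m) (Or.inl (by omega)) (by omega) (by omega)
      exact (((h1.mul_right (ih (by omega))).mul_right h1).add_right h1).add_right
        (Commute.one_right _)
  have e : jm q t m = (q ^ m)⁻¹ • (xm q t m - qInt q (m : ℤ) • 1) := by
    rw [xm, add_sub_cancel_left, smul_smul, inv_mul_cancel₀ (pow_ne_zero _ hq), one_smul]
  rw [e]
  exact ((key m h hm).sub_right ((Commute.one_right _).smul_right _)).smul_right _

lemma jm_commute_jm (hq : q ≠ 0) {m k : ℕ} (hm : m ≤ N) (hk : k ≤ N) :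
    Commute (jm q t m) (jm q t k) := by
  rcases lt_trichotomy m k with h | rfl | h
  · exact (H.commute_jm fun i h1 h2 => (H.t_commute_jm_of_gt hq h1 (by omega) hk).symm).symm
  · exact Commute.refl _
  · exact H.commute_jm fun i h1 h2 => (H.t_commute_jm_of_gt hq h1 (by omega) hm).symm

lemma jm_succ_mul_t (hq : q ≠ 0) {m : ℕ} (h1 : 1 ≤ m) (h : m < N) :
    jm q t (m + 1) * t m = t m * jm q t m + (q - 1) • jm q t (m + 1) + 1 := by
  have e := H.quad m h1 h
  simp only [jm, smul_mul_assoc, add_mul, e, mul_assoc, mul_add, mul_smul_comm, mul_one]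
  match_scalars <;> field_simp

lemma t_mul_jm_succ (hq : q ≠ 0) {m : ℕ} (h1 : 1 ≤ m) (h : m < N) :
    t m * jm q t (m + 1) = jm q t m * t m + (q - 1) • jm q t (m + 1) + 1 := by
  have e := H.quad m h1 h
  have e2 : t m * (t m * (jm q t m * t m)) = (t m * t m) * (jm q t m * t m) := by noncomm_ring
  simp only [jm, mul_smul_comm, mul_add, e, mul_assoc, e2, add_mul, smul_mul_assoc, one_mul]
  match_scalars <;> field_simp

/-- A generator is absorbed by the product of two consecutive `insSum`s. -/
lemma t_mul_insSum_mul {j m : ℕ} (hj : j < m) (hm : m < N) :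
    t m * insSum t j m * insSum t j (m + 1) = q • (insSum t j m * insSum t j (m + 1)) := by
  induction m, hj using Nat.le_induction with
  | base =>
    have e := H.quad (j + 1) (by omega) hm
    rw [insSum_succ (Nat.le_succ j), insSum_succ le_rfl, insSum_of_le le_rfl]
    simp only [mul_zero, add_zero, mul_one, mul_add, e, one_mul]
    module
  | succ m hj ih =>
    have ih := ih (by omega)
    set b := insSum t j m
    have e1 : insSum t j (m + 1) = 1 + t m * b := insSum_succ (by omega)
    have e2 : insSum t j (m + 1 + 1) = 1 + t (m + 1) * insSum t j (m + 1) :=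
      insSum_succ (by omega)
    set b' := insSum t j (m + 1)
    have hc : t (m + 1) * b = b * t (m + 1) :=
      (commute_insSum fun i h1 h2 => H.commute (Or.inr (by omega)) hm (by omega)).eq
    have e := H.quad (m + 1) (by omega) hm
    have e3 := H.braid m hm
    have key : t (m + 1) * b' * t (m + 1) * b' = t (m + 1) * t (m + 1) * b' +
        q • ((b' - 1) * t (m + 1) * b') := by
      calc t (m + 1) * b' * t (m + 1) * b'
          = t (m + 1) * t (m + 1) * b' + t (m + 1) * t m * (b * t (m + 1)) * b' := by
            nth_rewrite 1 [e1]; noncomm_ring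
        _ = t (m + 1) * t (m + 1) * b' + t (m + 1) * t m * t (m + 1) * (b * b') := by
            rw [← hc]; noncomm_ring
        _ = t (m + 1) * t (m + 1) * b' + t m * t (m + 1) * (t m * b * b') := by
            rw [← e3]; noncomm_ring
        _ = t (m + 1) * t (m + 1) * b' + q • (t m * (t (m + 1) * b) * b') := by
            rw [ih, mul_smul_comm]; simp only [mul_assoc]
        _ = t (m + 1) * t (m + 1) * b' + q • ((b' - 1) * t (m + 1) * b') := by
            rw [hc, e1]; noncomm_ring
    rw [e2]
    calc t (m + 1) * b' * (1 + t (m + 1) * b')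
        = t (m + 1) * b' + t (m + 1) * b' * t (m + 1) * b' := by noncomm_ring
      _ = _ := by
        rw [key, e]
        simp only [mul_add, add_mul, sub_mul, mul_one, one_mul, smul_mul_assoc, mul_assoc]
        module

/-- A generator that exchanges two of the `k` inserted letters is absorbed, with the factor `q`. -/
lemma t_mul_insProd {m k i : ℕ} (hi : m < i + k) (him : i < m) (hm : m ≤ N) (hkm : k ≤ m) :
    t i * insProd t m k = q • insProd t m k := by
  induction m generalizing k with
  | zero => omega
  | succ m ih =>
    obtain ⟨k, rfl⟩ : ∃ k', k = k' + 1 := ⟨k - 1, by omega⟩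
    rcases Nat.lt_or_ge i m with h | h
    · rw [insProd_succ, ← mul_assoc, ih (by omega) h (by omega) (by omega), smul_mul_assoc]
    · obtain rfl : i = m := by omega
      obtain ⟨m, rfl⟩ : ∃ m', i = m' + 1 := ⟨i - 1, by omega⟩
      obtain ⟨k, rfl⟩ : ∃ k', k = k' + 1 := ⟨k - 1, by omega⟩
      rw [insProd_succ, insProd_succ]
      have hc : t (m + 1) * insProd t m k = insProd t m k * t (m + 1) :=
        (commute_insProd fun i h1 h2 => H.commute (Or.inr (by omega)) (by omega) (by omega)).eq
      calc _ = insProd t m k * (t (m + 1) * insSum t 0 (m + 1) * insSum t 0 (m + 1 + 1)) := by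
            rw [← mul_assoc, ← mul_assoc, hc]; simp only [mul_assoc]
        _ = _ := by
            rw [H.t_mul_insSum_mul (by omega) (by omega), mul_smul_comm, mul_assoc]

end IsHecke

end Abstract

/-! ### Inserting, then removing -/

section Abstract

variable {K : Type*} [Field K] {A : Type*} [Ring A] [Algebra K A]
variable {q : K} {N : ℕ} {t : ℕ → A}

/-- The sum of `t (m - 1) ⋯ t (m - i) X_{m-i}` over `i < k`, where `X_i = [i]_q + q ^ i J_i`: the
first coefficient when `B_m` is moved past `B*_m ⋯ B*_{m-k+1}`, see `insSum_mul_remProd`. -/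
def crossSum (q : K) (t : ℕ → A) : ℕ → ℕ → A
  | _, 0 => 0
  | 0, _ + 1 => 0
  | m + 1, k + 1 => xm q t (m + 1) + t m * crossSum q t m k

/-- The product `t (m - 1) ⋯ t (m - k) B_{m-k}`. -/
def crossTail (t : ℕ → A) : ℕ → ℕ → A
  | m, 0 => insSum t 0 m
  | 0, _ + 1 => 0
  | m + 1, k + 1 => t m * crossTail t m k

/-- The mirror image of `crossSum`. -/
def crossSum' (q : K) (t : ℕ → A) : ℕ → ℕ → A
  | _, 0 => 0
  | 0, _ + 1 => 0
  | m + 1, k + 1 => xm q t (m + 1) + crossSum' q t m k * t m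

/-- The mirror image of `crossTail`. -/
def crossTail' (t : ℕ → A) : ℕ → ℕ → A
  | m, 0 => remSum t m
  | 0, _ + 1 => 0
  | m + 1, k + 1 => crossTail' t m k * t m

/-- The polynomial in the Jucys--Murphy elements by which `insProd * remProd` acts on symmetric
vectors that are killed by `remSum`. -/
def jmProd (q : K) (t : ℕ → A) : ℕ → ℕ → A
  | _, 0 => 1
  | 0, _ + 1 => 0
  | m + 1, k + 1 => ((q ^ k)⁻¹ * qInt q ((k : ℤ) + 1)) •
      ((xm q t (m + 1) - qInt q (k : ℤ) • 1) * jmProd q t m k)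

lemma crossSum_zero (m : ℕ) : crossSum q t m 0 = 0 := by cases m <;> rfl
lemma crossTail_zero (m : ℕ) : crossTail t m 0 = insSum t 0 m := by cases m <;> rfl
lemma crossTail'_zero (m : ℕ) : crossTail' t m 0 = remSum t m := by cases m <;> rfl
lemma jmProd_zero (m : ℕ) : jmProd q t m 0 = 1 := by cases m <;> rfl

lemma insSum_op (m : ℕ) :
    insSum (fun i => MulOpposite.op (t i)) 0 m = MulOpposite.op (remSum t m) := by
  induction m with
  | zero => rfl
  | succ m ih => rw [insSum_succ (Nat.zero_le m), ih, remSum]; simp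

lemma remSum_op (m : ℕ) :
    remSum (fun i => MulOpposite.op (t i)) m = MulOpposite.op (insSum t 0 m) := by
  induction m with
  | zero => rfl
  | succ m ih => rw [remSum_succ, ih, insSum_succ (Nat.zero_le m)]; simp

lemma jm_op (m : ℕ) : jm q (fun i => MulOpposite.op (t i)) m = MulOpposite.op (jm q t m) := by
  induction m with
  | zero => rfl
  | succ m ih => simp [jm, ih, mul_assoc]

lemma xm_op (m : ℕ) : xm q (fun i => MulOpposite.op (t i)) m = MulOpposite.op (xm q t m) := by
  simp [xm, jm_op]

lemma remProd_op (m k : ℕ) :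
    remProd (fun i => MulOpposite.op (t i)) m k = MulOpposite.op (insProd t m k) := by
  induction m generalizing k with
  | zero => cases k <;> rfl
  | succ m ih =>
    cases k with
    | zero => rfl
    | succ k => rw [remProd_succ, ih k, remSum_op _, insProd_succ]; simp

lemma crossSum_op (m k : ℕ) :
    crossSum q (fun i => MulOpposite.op (t i)) m k = MulOpposite.op (crossSum' q t m k) := by
  induction m generalizing k with
  | zero => cases k <;> rfl
  | succ m ih =>
    cases k with
    | zero => rfl
    | succ k => simp [crossSum, crossSum', ih, xm_op]

lemma crossTail_op (m k : ℕ) :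
    crossTail (fun i => MulOpposite.op (t i)) m k = MulOpposite.op (crossTail' t m k) := by
  induction m generalizing k with
  | zero => cases k <;> rfl
  | succ m ih =>
    cases k with
    | zero => rw [crossTail_zero, crossTail'_zero, insSum_op _]
    | succ k => simp [crossTail, crossTail', ih k]

namespace IsHecke

variable (H : IsHecke q N t)
include H

/-- Inserting and then removing a letter, in terms of a Jucys--Murphy element. -/
lemma insSum_mul_remSum (hq : q ≠ 0) {m : ℕ} (hm : m < N) :
    insSum t 0 (m + 1) * remSum t (m + 1) =
      xm q t (m + 1) + remSum t m * t m * insSum t 0 m := by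
  induction m with
  | zero => simp [insSum, remSum, xm, jm, H.zero, qInt_one]
  | succ m ih =>
    have ih := ih (by omega)
    rw [insSum_succ (Nat.zero_le (m + 1)), remSum_succ (m + 1), H.xm_succ hq (m + 1) hm]
    have e1 : insSum t 0 (m + 1) = 1 + t m * insSum t 0 m := insSum_succ (Nat.zero_le m)
    have e2 : remSum t (m + 1) = 1 + remSum t m * t m := rfl
    have hc1 : t (m + 1) * remSum t m = remSum t m * t (m + 1) :=
      (commute_remSum fun i h1 h2 => H.commute (Or.inr (by omega)) hm (by omega)).eq
    have hc2 : t (m + 1) * insSum t 0 m = insSum t 0 m * t (m + 1) :=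
      (commute_insSum fun i h1 h2 => H.commute (Or.inr (by omega)) hm (by omega)).eq
    have e3 := H.braid m hm
    have key : t (m + 1) * (remSum t m * t m * insSum t 0 m) * t (m + 1) =
        (remSum t (m + 1) - 1) * t (m + 1) * (insSum t 0 (m + 1) - 1) := by
      calc t (m + 1) * (remSum t m * t m * insSum t 0 m) * t (m + 1)
          = (t (m + 1) * remSum t m) * t m * (insSum t 0 m * t (m + 1)) := by noncomm_ring
        _ = remSum t m * (t (m + 1) * t m * t (m + 1)) * insSum t 0 m := by
            rw [hc1, ← hc2]; noncomm_ring
        _ = _ := by rw [← e3, e1, e2]; noncomm_ring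
    calc (1 + t (m + 1) * insSum t 0 (m + 1)) * (1 + remSum t (m + 1) * t (m + 1))
        = 1 + t (m + 1) * insSum t 0 (m + 1) + remSum t (m + 1) * t (m + 1) +
          t (m + 1) * (insSum t 0 (m + 1) * remSum t (m + 1)) * t (m + 1) := by noncomm_ring
      _ = 1 + t (m + 1) * insSum t 0 (m + 1) + remSum t (m + 1) * t (m + 1) +
          (t (m + 1) * xm q t (m + 1) * t (m + 1) +
          t (m + 1) * (remSum t m * t m * insSum t 0 m) * t (m + 1)) := by
            rw [ih]; noncomm_ring
      _ = _ := by rw [key]; noncomm_ring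

/-- `B_m B*_{m,k+1}` equals `B*_{m-1,k}` times `crossSum` plus `B*_{m-1,k+1}` times `crossTail`: the
relation `insSum_mul_remSum` applied to each of the factors of `B*_{m,k+1}` in turn. -/
lemma insSum_mul_remProd (hq : q ≠ 0) {m k : ℕ} (hm : m < N) :
    insSum t 0 (m + 1) * remProd t (m + 1) (k + 1) =
      remProd t m k * crossSum q t (m + 1) (k + 1) +
        remProd t m (k + 1) * crossTail t (m + 1) (k + 1) := by
  induction m generalizing k with
  | zero =>
    rw [remProd_succ, ← mul_assoc, H.insSum_mul_remSum hq hm]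
    cases k <;> simp [remProd, crossSum, crossTail, H.zero, insSum]
  | succ m ih =>
    rw [remProd_succ, ← mul_assoc, H.insSum_mul_remSum hq hm, add_mul]
    have hx : Commute (xm q t (m + 1 + 1)) (remProd t (m + 1) k) :=
      commute_remProd fun i h1 h2 =>
        (((Commute.one_right _).smul_right _).add_right
          ((H.t_commute_jm_of_gt hq h1 (by omega) hm).smul_right _)).symm
    have hcs : ∀ k, t (m + 1) * remProd t m k = remProd t m k * t (m + 1) := fun k =>
      (commute_remProd fun i h1 h2 => H.commute (Or.inr (by omega)) hm (by omega)).eq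
    rw [hx.eq]
    cases k with
    | zero =>
      simp [remProd, crossSum, crossTail, mul_assoc]
    | succ k =>
      rw [mul_assoc (remSum t (m + 1) * t (m + 1)), ih (by omega)]
      have e1 : crossSum q t (m + 1 + 1) (k + 1 + 1) =
        xm q t (m + 1 + 1) + t (m + 1) * crossSum q t (m + 1) (k + 1) := rfl
      have e2 : crossTail t (m + 1 + 1) (k + 1 + 1) =
        t (m + 1) * crossTail t (m + 1) (k + 1) := rfl
      rw [e1, e2, remProd_succ, remProd_succ]
      have h1 := hcs k
      have h2 := hcs (k + 1)
      calc _ = remSum t (m + 1) * remProd t m k * xm q t (m + 1 + 1) +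
            (remSum t (m + 1) * (t (m + 1) * remProd t m k) * crossSum q t (m + 1) (k + 1) +
            remSum t (m + 1) * (t (m + 1) * remProd t m (k + 1)) *
              crossTail t (m + 1) (k + 1)) := by noncomm_ring
        _ = _ := by rw [h1, h2]; noncomm_ring

/-- On an element that absorbs the generators at the last `k + 1` positions, `crossSum` reduces to a
linear polynomial in a single Jucys--Murphy element. -/
lemma crossSum_mul (hq : q ≠ 0) {m k : ℕ} (hm : m < N) (hk : k ≤ m) {z : A}
    (hz : ∀ i, m < i + k → i ≤ m → t i * z = q • z) :
    crossSum q t (m + 1) (k + 1) * z = ((q ^ k)⁻¹ * qInt q ((k : ℤ) + 1)) •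
      ((xm q t (m + 1) - qInt q (k : ℤ) • 1) * z) := by
  induction k generalizing m with
  | zero =>
    simp [crossSum, crossSum_zero, qInt_zero, qInt_one]
  | succ k ih =>
    obtain ⟨m, rfl⟩ : ∃ m', m = m' + 1 := ⟨m - 1, by omega⟩
    have e1 : crossSum q t (m + 1 + 1) (k + 1 + 1) =
        xm q t (m + 1 + 1) + t (m + 1) * crossSum q t (m + 1) (k + 1) := rfl
    have e2 : t (m + 1) * z = q • z := hz (m + 1) (by omega) le_rfl
    have e3 : t (m + 1) * (xm q t (m + 1) * z) =
        q⁻¹ • (xm q t (m + 1 + 1) * z) - (q⁻¹ * (q + 1)) • z := by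
      rw [H.xm_succ hq (m + 1) hm]
      simp only [add_mul, mul_assoc, e2, mul_smul_comm, one_mul]
      match_scalars <;> field_simp
      ring
    rw [e1, add_mul, mul_assoc, ih (by omega) (by omega) fun i h1 h2 => hz i (by omega) (by omega)]
    simp only [sub_mul, mul_smul_comm, smul_mul_assoc, one_mul, mul_sub, e2, e3]
    have h1 := qInt_succ hq (k : ℤ)
    have h2 := qInt_succ hq ((k : ℤ) + 1)
    push_cast
    rw [h2, h1]
    have h3 := qInt_mul hq (k : ℤ)
    rw [zpow_natCast] at h3
    match_scalars <;> field_simp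
    · linear_combination -(q ^ 2 * q ^ k) * h3
    · ring

/-- All generators of `crossTail` are absorbed by the insertions, so that only one more insertion
remains. -/
lemma crossTail_mul {m k : ℕ} (hm : m < N) (hk : k ≤ m) :
    crossTail t (m + 1) (k + 1) * insProd t (m + 1) (k + 1) =
      q ^ (k + 1) • (insProd t m (k + 1) * insSum t 0 (m + 1)) := by
  have key : ∀ m' k' : ℕ, k' ≤ m' → m' ≤ m + 1 → m' + (k + 1) = (m + 1) + k' →
      crossTail t m' k' * insProd t (m + 1) (k + 1) = q ^ k' • insProd t (m + 1) (k + 2) := by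
    intro m' k' h1 h2 h3
    induction k' generalizing m' with
    | zero =>
      rw [crossTail_zero, insProd_succ' (m + 1) (k + 1) (by omega), pow_zero, one_smul]
      congr 2
      omega
    | succ k' ih =>
      obtain ⟨m', rfl⟩ : ∃ a, m' = a + 1 := ⟨m' - 1, by omega⟩
      have e2 : crossTail t (m' + 1) (k' + 1) = t m' * crossTail t m' k' := rfl
      rw [e2, mul_assoc, ih m' (by omega) (by omega) (by omega), mul_smul_comm]
      rcases Nat.lt_or_ge (m + 1) (k + 2) with h | h
      · -- the product is `0`, since it has too many factors
        have : insProd t (m + 1) (k + 2) = 0 := by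
          obtain rfl : k = m := by omega
          rw [insProd_succ' (k + 1) (k + 1) le_rfl]
          simp [insSum]
        simp [this]
      · rw [H.t_mul_insProd (by omega) (by omega) (by omega) (by omega), smul_smul, pow_succ]
  exact key (m + 1) (k + 1) (by omega) le_rfl rfl

/-- The recursion for the random-to-random shuffles (before division by the `q`-factorials). -/
lemma insSum_mul_remProd_mul_insProd (hq : q ≠ 0) {m k : ℕ} (hm : m < N) (hk : k ≤ m) :
    insSum t 0 (m + 1) * (remProd t (m + 1) (k + 1) * insProd t (m + 1) (k + 1)) =
      ((q ^ k)⁻¹ * qInt q ((k : ℤ) + 1)) • ((xm q t (m + 1) - qInt q (k : ℤ) • 1) *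
        (remProd t m k * insProd t m k) * insSum t 0 (m + 1)) +
      q ^ (k + 1) • (remProd t m (k + 1) * insProd t m (k + 1) * insSum t 0 (m + 1)) := by
  rw [← mul_assoc, H.insSum_mul_remProd hq hm, add_mul, mul_assoc, mul_assoc,
    H.crossTail_mul hm hk, H.crossSum_mul hq hm hk fun i h1 h2 =>
      H.t_mul_insProd (by omega) (by omega) (by omega) (by omega)]
  have hx : Commute (xm q t (m + 1) - qInt q (k : ℤ) • 1) (remProd t m k) :=
    commute_remProd fun i h1 h2 =>
      ((((Commute.one_right _).smul_right _).add_right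
        ((H.t_commute_jm_of_gt hq h1 (by omega) hm).smul_right _)).sub_right
        ((Commute.one_right _).smul_right _)).symm
  rw [mul_smul_comm, mul_smul_comm, insProd_succ, ← mul_assoc, ← hx.eq]
  simp only [mul_assoc]

lemma insProd_mul_remSum (hq : q ≠ 0) {m k : ℕ} (hm : m < N) :
    insProd t (m + 1) (k + 1) * remSum t (m + 1) =
      crossSum' q t (m + 1) (k + 1) * insProd t m k +
        crossTail' t (m + 1) (k + 1) * insProd t m (k + 1) := by
  have := H.op.insSum_mul_remProd hq (k := k) hm
  rw [insSum_op, remProd_op, remProd_op, remProd_op,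
    crossSum_op, crossTail_op] at this
  apply MulOpposite.op_injective
  simpa using this

lemma mul_crossSum' (hq : q ≠ 0) {m k : ℕ} (hm : m < N) (hk : k ≤ m) {z : A}
    (hz : ∀ i, m < i + k → i ≤ m → z * t i = q • z) :
    z * crossSum' q t (m + 1) (k + 1) = ((q ^ k)⁻¹ * qInt q ((k : ℤ) + 1)) •
      (z * (xm q t (m + 1) - qInt q (k : ℤ) • 1)) := by
  have := H.op.crossSum_mul hq hm hk (z := MulOpposite.op z) fun i h1 h2 => by
    rw [← MulOpposite.op_mul, hz i h1 h2]; rfl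
  rw [crossSum_op, xm_op] at this
  apply MulOpposite.op_injective
  simpa using this

lemma desc_mul_t_of_gt {m k i : ℕ} (hm : m ≤ N) (hk : i + 1 < k) :
    desc t k m * t i = t i * desc t k m := by
  induction m with
  | zero => simp [desc]
  | succ m ih =>
    by_cases h : k ≤ m
    · rw [desc_succ h, mul_assoc, ih (by omega), ← mul_assoc, ← mul_assoc,
        H.comm i m (by omega) (by omega)]
    · rw [desc_of_le (by omega)]; simp

lemma desc_mul_t_of_eq {m i : ℕ} (hi : 1 ≤ i) (him : i < m) (hm : m ≤ N) :
    desc t i m * t i = (q - 1) • desc t i m + q • desc t (i + 1) m := by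
  rw [desc_mul_last him, mul_assoc, H.quad i hi (by omega), mul_add, mul_smul_comm, mul_smul_comm,
    mul_one]

lemma desc_mul_t_of_lt {m k i : ℕ} (hk : k < i) (him : i < m) (hm : m ≤ N) :
    desc t k m * t i = t (i - 1) * desc t k m := by
  obtain ⟨i, rfl⟩ : ∃ a, i = a + 1 := ⟨i - 1, by omega⟩
  rw [Nat.add_sub_cancel]
  induction m, him using Nat.le_induction with
  | base =>
    have h1 : desc t k i * t (i + 1) = t (i + 1) * desc t k i := by
      have : ∀ m ≤ i, desc t k m * t (i + 1) = t (i + 1) * desc t k m := by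
        intro m hm
        induction m with
        | zero => simp [desc]
        | succ m ih =>
          by_cases h : k ≤ m
          · rw [desc_succ h, mul_assoc, ih (by omega), ← mul_assoc, ← mul_assoc,
              H.comm m (i + 1) (by omega) (by omega)]
          · rw [desc_of_le (by omega)]; simp
      exact this i le_rfl
    rw [desc_succ (by omega), desc_succ (by omega)]
    have e := H.braid i (by omega)
    calc _ = t (i + 1) * t i * (desc t k i * t (i + 1)) := by noncomm_ring
      _ = t (i + 1) * t i * t (i + 1) * desc t k i := by rw [h1]; noncomm_ring
      _ = _ := by rw [← e]; noncomm_ring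
  | succ m h ih =>
    rw [desc_succ (by omega), mul_assoc, ih (by omega), ← mul_assoc, ← mul_assoc,
      H.comm i m (by omega) (by omega)]

/-- The symmetrizer absorbs generators on its right. -/
lemma symm_mul_t {j m i : ℕ} (hj : j < i) (him : i < m) (hm : m ≤ N) :
    symm t j m * t i = q • symm t j m := by
  induction m generalizing i with
  | zero => omega
  | succ m ih =>
    rw [symm_succ (by omega), insSum_eq_sum]
    have hd : ∀ k ∈ Finset.Ioc j (m + 1), k ≠ i → k ≠ i + 1 →
        symm t j m * (desc t k (m + 1) * t i) = q • (symm t j m * desc t k (m + 1)) := by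
      intro k hk h1 h2
      rw [Finset.mem_Ioc] at hk
      rcases lt_or_gt_of_ne h1 with h | h
      · rw [H.desc_mul_t_of_lt h him hm, ← mul_assoc, ih (by omega) (by omega) (by omega),
          smul_mul_assoc]
      · rw [H.desc_mul_t_of_gt hm (by omega), ← mul_assoc, ih (by omega) (by omega) (by omega),
          smul_mul_assoc]
    have h1 : i ∈ Finset.Ioc j (m + 1) := by simp; omega
    have h2 : i + 1 ∈ (Finset.Ioc j (m + 1)).erase i := by simp; omega
    rw [mul_assoc, Finset.sum_mul, Finset.mul_sum, Finset.mul_sum, Finset.smul_sum,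
      ← Finset.add_sum_erase _ _ h1, ← Finset.add_sum_erase _ _ h2,
      ← Finset.add_sum_erase _ (fun k => q • (symm t j m * desc t k (m + 1))) h1,
      ← Finset.add_sum_erase _ (fun k => q • (symm t j m * desc t k (m + 1))) h2,
      ← add_assoc, ← add_assoc]
    congr 1
    · rw [H.desc_mul_t_of_eq (by omega) him hm, ← desc_mul_last him, mul_add, mul_smul_comm,
        mul_smul_comm]
      module
    · refine Finset.sum_congr rfl fun k hk => ?_
      simp only [Finset.mem_erase] at hk
      exact hd k hk.2.2 hk.2.1 hk.1

lemma insSum_mul_insProd {j m n : ℕ} (hjm : j ≤ m) (hmn : m ≤ n) (hn : n ≤ N) :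
    insSum t j m * insProd t n (n - j) = qInt q ((m - j : ℕ) : ℤ) • insProd t n (n - j) := by
  induction m, hjm using Nat.le_induction with
  | base => rw [insSum_of_le le_rfl]; simp [qInt_zero]
  | succ m h ih =>
    rw [insSum_succ h, add_mul, one_mul, mul_assoc, ih (by omega), mul_smul_comm]
    rcases Nat.eq_or_lt_of_le h with rfl | h'
    · simp [qInt_zero, qInt_one]
    · rw [H.t_mul_insProd (by omega) (by omega) hn (by omega), show m + 1 - j = (m - j) + 1 by omega,
        Nat.cast_add, Nat.cast_one, qInt_natCast_succ]
      module

lemma symm_mul_insProd {j m n : ℕ} (hjm : j ≤ m) (hmn : m ≤ n) (hn : n ≤ N) :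
    symm t j m * insProd t n (n - j) = qFactorial q (m - j) • insProd t n (n - j) := by
  induction m, hjm using Nat.le_induction with
  | base => rw [symm_of_le le_rfl]; simp [qFactorial]
  | succ m h ih =>
    rw [symm_succ h, mul_assoc, H.insSum_mul_insProd (by omega) hmn hn, mul_smul_comm,
      ih (by omega), smul_smul, show m + 1 - j = (m - j) + 1 by omega, qFactorial, qFactorial,
      Finset.prod_range_succ, mul_comm]
    push_cast
    rfl

end IsHecke

end Abstract

section Abstract

variable {K : Type*} [Field K] {A : Type*} [Ring A] [Algebra K A]
variable {q : K} {N : ℕ} {t : ℕ → A}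

lemma crossTail'_eq (m k : ℕ) (h : k ≤ m) : ∃ c, crossTail' t m k = remSum t (m - k) * c := by
  induction m generalizing k with
  | zero =>
    obtain rfl : k = 0 := by omega
    exact ⟨1, by simp [crossTail'_zero]⟩
  | succ m ih =>
    cases k with
    | zero => exact ⟨1, by simp [crossTail'_zero]⟩
    | succ k =>
      obtain ⟨c, hc⟩ := ih k (by omega)
      refine ⟨c * t m, ?_⟩
      rw [crossTail', hc, Nat.add_sub_add_right, mul_assoc]

/-- Inserting and then removing `k` letters acts on symmetric vectors by a polynomial in the
Jucys--Murphy elements, up to a term that vanishes on the kernel of `remSum t j`. -/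
lemma IsHecke.mul_insProd_mul_remProd (H : IsHecke q N t) (hq : q ≠ 0) {j k m : ℕ}
    (hm : m = j + k) (hN : m ≤ N) {z : A} (hz : Commute z (remSum t j))
    (hzt : ∀ i, j < i → i < m → z * t i = q • z) :
    ∃ r, z * (insProd t m k * remProd t m k) = z * jmProd q t m k + remSum t j * r := by
  induction k generalizing m z with
  | zero => exact ⟨0, by simp [insProd_zero, remProd_zero, jmProd_zero]⟩
  | succ k ih =>
    obtain ⟨m, rfl⟩ : ∃ a, m = a + 1 := ⟨m - 1, by omega⟩
    have hcomm : ∀ i, 1 ≤ i → i < m →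
        Commute (t i) (xm q t (m + 1) - qInt q (k : ℤ) • (1 : A)) := fun i h1 h2 =>
      (((Commute.one_right _).smul_right _).add_right
        ((H.t_commute_jm_of_gt hq h1 (by omega) hN).smul_right _)).sub_right
        ((Commute.one_right _).smul_right _)
    obtain ⟨r, hr⟩ := ih (m := m) (z := z * (xm q t (m + 1) - qInt q (k : ℤ) • 1)) (by omega)
      (by omega) (hz.mul_left (commute_remSum fun i h1 h2 => (hcomm i h1 (by omega)).symm))
      fun i h1 h2 => by
        rw [mul_assoc, ← (hcomm i (by omega) h2).eq, ← mul_assoc, hzt i h1 (by omega),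
          smul_mul_assoc]
    obtain ⟨c, hc⟩ := crossTail'_eq (t := t) (m + 1) (k + 1) (by omega)
    rw [show m + 1 - (k + 1) = j by omega] at hc
    refine ⟨((q ^ k)⁻¹ * qInt q ((k : ℤ) + 1)) • r +
      z * c * insProd t m (k + 1) * remProd t m k, ?_⟩
    have e1 : z * crossTail' t (m + 1) (k + 1) = remSum t j * (z * c) := by
      rw [hc, ← mul_assoc, hz.eq, mul_assoc]
    have e2 := H.mul_crossSum' hq (m := m) (k := k) (by omega) (by omega) (z := z)
      fun i h1 h2 => hzt i (by omega) (by omega)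
    calc z * (insProd t (m + 1) (k + 1) * remProd t (m + 1) (k + 1))
        = z * (insProd t (m + 1) (k + 1) * remSum t (m + 1)) * remProd t m k := by
          rw [remProd_succ]; noncomm_ring
      _ = z * crossSum' q t (m + 1) (k + 1) * (insProd t m k * remProd t m k) +
          z * crossTail' t (m + 1) (k + 1) * (insProd t m (k + 1) * remProd t m k) := by
          rw [H.insProd_mul_remSum hq (by omega)]; noncomm_ring
      _ = _ := by
          rw [e2, e1, smul_mul_assoc, hr, jmProd]
          simp only [mul_add, smul_add, mul_smul_comm, mul_assoc, add_assoc]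

end Abstract

/-! ### The elements of the Hecke algebra as recursive sequences -/

section Hecke

variable {K : Type*} [Field K] (q : K) (n : ℕ)

lemma T_of_lt {i : ℕ} (h : 1 ≤ i ∧ i < n) :
    T q n i = RingQuot.mkAlgHom K (HeckeRel q n) (FreeAlgebra.ι K ⟨i, h⟩) := by
  simp [T, h]

lemma T_zero : T q n 0 = 0 := by simp [T]

lemma isHecke : IsHecke q n (T q n) where
  zero := T_zero q n
  quad i h1 h2 := by
    rw [T_of_lt q n ⟨h1, h2⟩, ← map_mul,
      RingQuot.mkAlgHom_rel K (HeckeRel.quad (q := q) (n := n) ⟨i, h1, h2⟩)]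
    simp
  comm i j h1 h2 := by
    rcases Nat.eq_zero_or_pos i with rfl | hi
    · simp [T_zero]
    · rw [T_of_lt q n ⟨hi, by omega⟩, T_of_lt q n ⟨by omega, h2⟩, ← map_mul, ← map_mul,
        RingQuot.mkAlgHom_rel K (HeckeRel.comm (q := q) (n := n) ⟨i, hi, by omega⟩
          ⟨j, by omega, h2⟩ (Or.inl h1))]
  braid i h := by
    rcases Nat.eq_zero_or_pos i with rfl | hi
    · simp [T_zero]
    · rw [T_of_lt q n ⟨hi, by omega⟩, T_of_lt q n ⟨by omega, h⟩, ← map_mul, ← map_mul, ← map_mul,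
        ← map_mul, RingQuot.mkAlgHom_rel K (HeckeRel.braid (q := q) (n := n) ⟨i, hi, by omega⟩
          ⟨i + 1, by omega, h⟩ rfl)]

lemma B_eq (m : ℕ) : B q n m = insSum (T q n) 0 m := by
  induction m with
  | zero => simp [B, insSum]
  | succ m ih =>
    rw [insSum_succ (Nat.zero_le m), ← ih, B, B, ← Finset.insert_Icc_right_eq_Icc_add_one (by omega),
      Finset.sum_insert (by simp), Finset.mul_sum]
    congr 1
    · simp
    · refine Finset.sum_congr rfl fun i hi => ?_
      rw [Finset.mem_Icc] at hi
      rw [show m + 1 - i = (m - i) + 1 by omega, List.range'_concat, List.reverse_append]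
      simp [show i + (m - i) = m by omega]

lemma BStar_eq (m : ℕ) : BStar q n m = remSum (T q n) m := by
  induction m with
  | zero => simp [BStar, remSum]
  | succ m ih =>
    rw [remSum_succ, ← ih, BStar, BStar, ← Finset.insert_Icc_right_eq_Icc_add_one (by omega),
      Finset.sum_insert (by simp), Finset.sum_mul]
    congr 1
    · simp
    · refine Finset.sum_congr rfl fun i hi => ?_
      rw [Finset.mem_Icc] at hi
      rw [show m + 1 - i = (m - i) + 1 by omega, List.range'_concat]
      simp [show i + (m - i) = m by omega]

lemma insProd_eq_prod (m k : ℕ) : ((List.range k).reverse.map fun a => B q n (m - a)).prod =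
    insProd (T q n) m k := by
  induction k generalizing m with
  | zero => simp [insProd_zero]
  | succ k ih =>
    cases m with
    | zero => simp [List.range_succ_eq_map, insProd, B]
    | succ m =>
      rw [insProd_succ, ← ih m, List.range_succ_eq_map, List.reverse_cons, List.map_append,
        List.prod_append]
      simp [← List.map_reverse, Function.comp_def, B_eq]

lemma Bk_eq (k : ℕ) : Bk q n k = insProd (T q n) n k := insProd_eq_prod q n n k

lemma remProd_eq_prod (m k : ℕ) : ((List.range k).map fun a => BStar q n (m - a)).prod =
    remProd (T q n) m k := by
  induction k generalizing m with
  | zero => simp [remProd_zero]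
  | succ k ih =>
    cases m with
    | zero => simp [List.range_succ_eq_map, remProd, BStar]
    | succ m =>
      rw [remProd_succ, ← ih m, List.range_succ_eq_map]
      simp [Function.comp_def, BStar_eq]

lemma BkStar_eq (k : ℕ) : BkStar q n k = remProd (T q n) n k := remProd_eq_prod q n n k

lemma Ttransp_succ {i k : ℕ} (h : i < k) :
    Ttransp q n i (k + 1) = T q n k * Ttransp q n i k * T q n k := by
  rw [Ttransp, Ttransp, show k + 1 - i = (k - i) + 1 by omega,
    show k + 1 - 1 - i = (k - 1 - i) + 1 by omega, List.range'_concat, List.range'_concat]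
  simp [show i + (k - i) = k by omega, show i + 1 + (k - 1 - i) = k by omega, mul_assoc]

lemma J_eq (hq : q ≠ 0) (m : ℕ) : J q n m = jm q (T q n) m := by
  induction m with
  | zero => simp [J, jm]
  | succ m ih =>
    rcases Nat.eq_zero_or_pos m with rfl | hm
    · simp [J, jm, T_zero]
    · rw [jm, ← ih, J, J, ← Finset.insert_Ico_right_eq_Ico_add_one hm, Finset.sum_insert (by simp),
        Finset.mul_sum, Finset.sum_mul, smul_add, Finset.smul_sum, add_comm]
      congr 1
      · refine Finset.sum_congr rfl fun i hi => ?_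
        rw [Ttransp_succ q n (Finset.mem_Ico.1 hi).2, mul_smul_comm, smul_mul_assoc, smul_smul]
        congr 1
        rw [← zpow_neg_one, ← zpow_add₀ hq]
        push_cast
        ring_nf
      · simp [Ttransp]

end Hecke

/-! ### The action on words and an invariant form -/

section Form

variable {K : Type*} [Field K] {q : K} {n : ℕ}

/-- The right action `v h` of an element of the Hecke algebra on a combination of words. -/
noncomputable def act (v : Words K n) (h : Hecke q n) : Words K n := rightAct q h v

/-- The right action of the Hecke algebra on words. -/
infixl:75 " ◃ " => act

section ActLemmas

variable (v u : Words K n) (g h : Hecke q n) (c : K)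

lemma act_def : v ◃ h = rightAct q h v := rfl
@[simp] lemma act_mul : v ◃ (g * h) = (v ◃ g) ◃ h := by simp [act, rightAct]
@[simp] lemma act_one : v ◃ (1 : Hecke q n) = v := by simp [act, rightAct]
@[simp] lemma act_zero : v ◃ (0 : Hecke q n) = 0 := by simp [act, rightAct]
@[simp] lemma act_add : v ◃ (g + h) = v ◃ g + v ◃ h := by simp [act, rightAct]
@[simp] lemma act_sub : v ◃ (g - h) = v ◃ g - v ◃ h := by simp [act, rightAct]
@[simp] lemma act_smul : v ◃ (c • h) = c • v ◃ h := by simp [act, rightAct]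
lemma act_sum {ι : Type*} (s : Finset ι) (f : ι → Hecke q n) :
    v ◃ (∑ i ∈ s, f i) = ∑ i ∈ s, v ◃ f i := by
  simp [act, rightAct, LinearMap.sum_apply]
@[simp] lemma zero_act : (0 : Words K n) ◃ h = 0 := map_zero _
@[simp] lemma add_act : (v + u) ◃ h = v ◃ h + u ◃ h := map_add _ _ _
@[simp] lemma sub_act : (v - u) ◃ h = v ◃ h - u ◃ h := map_sub _ _ _
@[simp] lemma smul_act : (c • v) ◃ h = c • v ◃ h := map_smul _ _ _
lemma sum_act {ι : Type*} (s : Finset ι) (f : ι → Words K n) :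
    (∑ i ∈ s, f i) ◃ h = ∑ i ∈ s, f i ◃ h := map_sum _ _ _

lemma act_comm {g h : Hecke q n} (v : Words K n) (hc : Commute g h) : v ◃ g ◃ h = v ◃ h ◃ g := by
  rw [← act_mul, hc.eq, act_mul]

lemma act_T (v : Words K n) {i : ℕ} (hi : 1 ≤ i ∧ i < n) : v ◃ T q n i = genOp q ⟨i, hi⟩ v := by
  rw [act, rightAct, wordRep, T_of_lt q n hi, RingQuot.liftAlgHom_mkAlgHom_apply,
    FreeAlgebra.lift_ι_apply]
  rfl

end ActLemmas

/-- The number of inversions of a word. -/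
def inv (w : Fin n → ℕ) : ℕ := (Finset.univ.filter fun p : Fin n × Fin n =>
  p.1 < p.2 ∧ w p.2 < w p.1).card

lemma inv_swap {w : Fin n → ℕ} {a b : Fin n} (hab : b.1 = a.1 + 1) (hw : w a < w b) :
    inv (w ∘ Equiv.swap a b) = inv w + 1 := by
  classical
  have hne : a ≠ b := by intro h; rw [h] at hab; omega
  set σ := Equiv.swap a b with hσdef
  have hσa : σ a = b := Equiv.swap_apply_left a b
  have hσb : σ b = a := Equiv.swap_apply_right a b
  have hss : ∀ x, σ (σ x) = x := fun x => by simp [σ]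
  have hlt : ∀ x y : Fin n, x < y → ¬ (x = a ∧ y = b) → σ x < σ y := by
    intro x y hxy hne
    simp only [hσdef, Equiv.swap_apply_def]
    rw [Fin.lt_def] at hxy
    simp only [Fin.ext_iff] at hne ⊢
    split_ifs <;> rw [Fin.lt_def] <;> omega
  have hσne : ∀ x y : Fin n, x < y → ¬ (σ x = a ∧ σ y = b) := by
    rintro x y hxy ⟨h1, h2⟩
    have h1' := hss x
    have h2' := hss y
    rw [h1, hσa] at h1'
    rw [h2, hσb] at h2'
    subst h1' h2'
    rw [Fin.lt_def] at hxy
    omega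
  have hmem : (a, b) ∈ Finset.univ.filter fun p : Fin n × Fin n =>
      p.1 < p.2 ∧ (w ∘ σ) p.2 < (w ∘ σ) p.1 := by
    simp only [Finset.mem_filter, Finset.mem_univ, true_and, Function.comp_apply, hσa, hσb]
    exact ⟨by rw [Fin.lt_def]; omega, hw⟩
  rw [inv, inv, ← Finset.card_erase_add_one hmem]
  congr 1
  refine Finset.card_bij' (fun p _ => (σ p.1, σ p.2)) (fun p _ => (σ p.1, σ p.2)) ?_ ?_ ?_ ?_
  · intro p hp
    simp only [Finset.mem_erase, Finset.mem_filter, Finset.mem_univ, true_and,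
      Function.comp_apply, ne_eq, Prod.ext_iff] at hp ⊢
    exact ⟨hlt _ _ hp.2.1 hp.1, hp.2.2⟩
  · intro p hp
    simp only [Finset.mem_erase, Finset.mem_filter, Finset.mem_univ, true_and,
      Function.comp_apply, ne_eq, Prod.ext_iff] at hp ⊢
    rw [hss, hss]
    refine ⟨hσne _ _ hp.1, hlt _ _ hp.1 ?_, hp.2⟩
    rintro ⟨h1, h2⟩
    rw [h1, h2] at hp
    exact absurd hp.2 hw.not_gt
  · intro p _; simp [σ]
  · intro p _; simp [σ]

variable (q) in
/-- The bilinear form on words for which the words are orthogonal and a word `w` has norm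
`q ^ inv w`. The generators of the Hecke algebra are self-adjoint with respect to it. -/
noncomputable def form : Words K n →ₗ[K] Words K n →ₗ[K] K :=
  Finsupp.linearCombination K fun w => q ^ inv w • Finsupp.lapply w

lemma form_apply (v u : Words K n) : form q v u = v.sum fun w c => c * (q ^ inv w * u w) := by
  simp [form, Finsupp.linearCombination_apply, Finsupp.sum, LinearMap.sum_apply]

lemma form_single (w : Fin n → ℕ) (c : K) (u : Words K n) :
    form q (Finsupp.single w c) u = c * (q ^ inv w * u w) := by
  simp [form]

lemma form_comm (v u : Words K n) : form q v u = form q u v := by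
  have : form q (n := n) = (form q).flip := by
    refine Finsupp.lhom_ext' fun w => LinearMap.ext_ring ?_
    refine Finsupp.lhom_ext' fun w' => LinearMap.ext_ring ?_
    simp only [LinearMap.comp_apply, Finsupp.lsingle_apply, LinearMap.flip_apply, form_single,
      Finsupp.single_apply]
    by_cases h : w = w'
    · subst h; simp
    · simp [h, Ne.symm h]
  conv_lhs => rw [this]
  rfl

lemma form_swapOp {a b : Fin n} (hab : b.1 = a.1 + 1) (v u : Words K n) :
    form q (swapOp q a b v) u = form q v (swapOp q a b u) := by
  have : (form q (n := n)).comp (swapOp q a b) = (form q).compl₂ (swapOp q a b) := by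
    refine Finsupp.lhom_ext' fun w => LinearMap.ext_ring ?_
    refine Finsupp.lhom_ext' fun w' => LinearMap.ext_ring ?_
    have hs : ∀ x : Fin n → ℕ, (x ∘ Equiv.swap a b) ∘ Equiv.swap a b = x := by
      intro x; funext p; simp
    have heq : ∀ x : Fin n → ℕ, x a = x b → x ∘ Equiv.swap a b = x := by
      intro x hx; funext p
      simp only [Function.comp_apply, Equiv.swap_apply_def]
      split_ifs <;> simp_all
    simp only [LinearMap.comp_apply, Finsupp.lsingle_apply, LinearMap.compl₂_apply, swapOp_single]
    by_cases hww : w' = w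
    · subst hww
      rw [form_comm]
    by_cases hww2 : w' = w ∘ Equiv.swap a b
    · subst hww2
      simp only [Function.comp_apply, Equiv.swap_apply_left, Equiv.swap_apply_right, hs]
      rcases lt_trichotomy (w a) (w b) with h | h | h
      · have := inv_swap hab h
        simp [h, h.ne, h.ne', h.not_gt, form_single, this, hww, pow_succ]
      · exact absurd (heq w h) hww
      · have := inv_swap (w := w ∘ Equiv.swap a b) hab (by simpa using h)
        rw [hs] at this
        simp [h, h.ne, h.ne', h.not_gt, form_single, this, hww, pow_succ]
        ring
    · have h1 : w ≠ w' := Ne.symm hww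
      have h2 : w ≠ w' ∘ Equiv.swap a b := fun h => hww2 (by rw [h, hs])
      have h3 : w ∘ Equiv.swap a b ≠ w' := Ne.symm hww2
      have h4 : w' ∘ Equiv.swap a b ≠ w := Ne.symm h2
      split_ifs <;> simp [form_single, h1, h3, h4]
  have := congrArg (fun f => f v u) this
  simpa using this

/-- `h` is the adjoint of `g` for the invariant form. -/
def IsAdj (g h : Hecke q n) : Prop := ∀ v u : Words K n, form q (v ◃ g) u = form q v (u ◃ h)

namespace IsAdj

lemma T (i : ℕ) : IsAdj (T q n i) (T q n i) := by
  intro v u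
  by_cases hi : 1 ≤ i ∧ i < n
  · rw [act_T v hi, act_T u hi]
    exact form_swapOp (by simp; omega) v u
  · simp [HeckeShuffle.T, hi]

lemma one : IsAdj (1 : Hecke q n) 1 := fun v u => by simp
lemma zero : IsAdj (0 : Hecke q n) 0 := fun v u => by simp

variable {g h g' h' : Hecke q n}

lemma mul (h1 : IsAdj g g') (h2 : IsAdj h h') : IsAdj (g * h) (h' * g') := fun v u => by
  rw [act_mul, act_mul, h2, h1]

lemma add (h1 : IsAdj g g') (h2 : IsAdj h h') : IsAdj (g + h) (g' + h') := fun v u => by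
  simp [h1 v u, h2 v u]

lemma sub (h1 : IsAdj g g') (h2 : IsAdj h h') : IsAdj (g - h) (g' - h') := fun v u => by
  simp [h1 v u, h2 v u]

lemma smul (c : K) (h1 : IsAdj g g') : IsAdj (c • g) (c • g') := fun v u => by
  simp [h1 v u]

lemma symm (h1 : IsAdj g g') : IsAdj g' g := fun v u => by
  rw [form_comm, ← h1, form_comm]

lemma insSum (m : ℕ) : IsAdj (insSum (HeckeShuffle.T q n) 0 m) (remSum (HeckeShuffle.T q n) m) := by
  induction m with
  | zero => exact zero
  | succ m ih =>
    rw [insSum_succ (Nat.zero_le m), remSum_succ]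
    exact one.add ((T m).mul ih)

lemma jm (m : ℕ) : IsAdj (jm q (HeckeShuffle.T q n) m) (jm q (HeckeShuffle.T q n) m) := by
  induction m with
  | zero => exact zero
  | succ m ih =>
    have := (((((T m).mul ih)).mul (T m)).add (T m)).smul q⁻¹
    rwa [← mul_assoc] at this

lemma aeval (hg : IsAdj g g) (p : Polynomial K) :
    IsAdj (Polynomial.aeval g p) (Polynomial.aeval g p) := by
  have hpow : ∀ k : ℕ, IsAdj (g ^ k) (g ^ k) := by
    intro k
    induction k with
    | zero => simpa using one
    | succ k ih =>
      have := ih.mul hg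
      rwa [← pow_succ, ← pow_succ'] at this
  induction p using Polynomial.induction_on' with
  | add p r hp hr => rw [map_add]; exact hp.add hr
  | monomial k a =>
    rw [Polynomial.aeval_monomial, ← Algebra.smul_def]
    exact (hpow k).smul a

end IsAdj

variable [LinearOrder K] [IsStrictOrderedRing K]

lemma form_self_nonneg (hq : 0 < q) (v : Words K n) : 0 ≤ form q v v := by
  rw [form_apply]
  refine Finset.sum_nonneg fun w _ => ?_
  have := mul_nonneg (mul_self_nonneg (v w)) (pow_pos hq (inv w)).le
  nlinarith [this]

lemma form_self_eq_zero (hq : 0 < q) {v : Words K n} : form q v v = 0 ↔ v = 0 := by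
  refine ⟨fun h => ?_, fun h => by simp [h]⟩
  rw [form_apply, Finsupp.sum, Finset.sum_eq_zero_iff_of_nonneg] at h
  · ext w
    by_contra hw
    have := h w (Finsupp.mem_support_iff.2 hw)
    simp [(pow_pos hq _).ne'] at this
    exact hw (by simpa using this)
  · intro w _
    have := mul_nonneg (mul_self_nonneg (v w)) (pow_pos hq (inv w)).le
    nlinarith [this]

lemma form_self_pos (hq : 0 < q) {v : Words K n} (hv : v ≠ 0) : 0 < form q v v :=
  lt_of_le_of_ne (form_self_nonneg hq v) fun h => hv ((form_self_eq_zero hq).1 h.symm)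

end Form

/-! ### Jucys--Murphy elements acting on words -/

section Spectrum

set_option linter.unusedSectionVars false

variable {K : Type*} [Field K] {q : K} {n : ℕ}

variable (q n) in
/-- The Jucys--Murphy element `J_m` of `H_n`. -/
noncomputable abbrev Jm (m : ℕ) : Hecke q n := jm q (T q n) m

/-- The diagonal coefficient of a generator `T_i` on a joint eigenvector of `J_i` and `J_{i+1}`
with the eigenvalues `[a]` and `[b]`. -/
noncomputable def diagCoef (q : K) (a b : ℤ) : K := q ^ b / (qInt q b - qInt q a)

/-- The joint eigenvector obtained from `v` by exchanging the eigenvalues `[a]` of `J_i` and `[b]`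
of `J_{i+1}`. -/
noncomputable def swapVec (q : K) (i : ℕ) (a b : ℤ) (v : Words K n) : Words K n :=
  v ◃ T q n i - diagCoef q a b • v

variable [LinearOrder K] [IsStrictOrderedRing K]

lemma form_eq_zero_of_ne {h : Hecke q n} (hh : IsAdj h h) {a b : K} (hab : a ≠ b)
    {v u : Words K n} (hv : v ◃ h = a • v) (hu : u ◃ h = b • u) : form q v u = 0 := by
  have := hh v u
  rw [hv, hu, map_smul, map_smul, LinearMap.smul_apply, smul_eq_mul, smul_eq_mul] at this
  have h2 : (a - b) * form q v u = 0 := by rw [sub_mul, this, sub_self]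
  exact (mul_eq_zero.1 h2).resolve_left (sub_ne_zero.2 hab)

lemma act_eq_zero_of_act_act (hq : 0 < q) {h : Hecke q n} (hh : IsAdj h h) {v : Words K n}
    (hv : v ◃ h ◃ h = 0) : v ◃ h = 0 := by
  rw [← form_self_eq_zero hq, hh, form_comm, hv]; simp

section Swap

variable (hq : 0 < q) {i : ℕ} (hi : 1 ≤ i) (hin : i < n) {a b : ℤ} {v : Words K n}
  (ha : v ◃ Jm q n i = qInt q a • v) (hb : v ◃ Jm q n (i + 1) = qInt q b • v)
include hq hi hin ha hb

lemma act_T_act_Jm : v ◃ T q n i ◃ Jm q n i = qInt q b • v ◃ T q n i - q ^ b • v := by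
  have e := (isHecke q n).jm_succ_mul_t hq.ne' hi hin
  have : T q n i * Jm q n i = Jm q n (i + 1) * T q n i - (q - 1) • Jm q n (i + 1) - 1 := by
    rw [e]; abel
  rw [← act_mul, this, ← qInt_mul hq.ne']
  simp only [act_sub, act_mul, act_smul, act_one, hb, smul_act]
  module

lemma act_T_act_Jm_succ :
    v ◃ T q n i ◃ Jm q n (i + 1) = qInt q a • v ◃ T q n i + q ^ b • v := by
  have e := (isHecke q n).t_mul_jm_succ hq.ne' hi hin
  rw [← act_mul, e, ← qInt_mul hq.ne']
  simp only [act_add, act_mul, act_smul, act_one, ha, hb, smul_act]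
  module

/-- Consecutive equal contents are impossible. -/
lemma eq_zero_of_content_eq (hab : a = b) : v = 0 := by
  subst hab
  have h1 := act_T_act_Jm hq hi hin ha hb
  have h2 : v ◃ T q n i ◃ (Jm q n i - qInt q a • 1) = -(q ^ a • v) := by
    rw [act_sub, h1, act_smul, act_one]; abel
  have h3 := act_eq_zero_of_act_act hq ((IsAdj.jm i).sub (IsAdj.one.smul (qInt q a)))
    (v := v ◃ T q n i) (by
      rw [h2, ← neg_smul, smul_act, act_sub, ha, act_smul, act_one, sub_self, smul_zero])
  rw [h2, neg_eq_zero] at h3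
  exact (smul_eq_zero.1 h3).resolve_left (zpow_pos hq a).ne'

lemma swapVec_act_Jm (hab : a ≠ b) :
    swapVec q i a b v ◃ Jm q n i = qInt q b • swapVec q i a b v := by
  have hne : qInt q b - qInt q a ≠ 0 := sub_ne_zero.2 ((qInt_strictMono hq).injective.ne hab.symm)
  rw [swapVec, sub_act, smul_act, act_T_act_Jm hq hi hin ha hb, ha, diagCoef]
  match_scalars
  · ring
  · field_simp; ring

lemma swapVec_act_Jm_succ (hab : a ≠ b) :
    swapVec q i a b v ◃ Jm q n (i + 1) = qInt q a • swapVec q i a b v := by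
  have hne : qInt q b - qInt q a ≠ 0 := sub_ne_zero.2 ((qInt_strictMono hq).injective.ne hab.symm)
  rw [swapVec, sub_act, smul_act, act_T_act_Jm_succ hq hi hin ha hb, hb, diagCoef]
  match_scalars
  · ring
  · field_simp; ring

omit [LinearOrder K] [IsStrictOrderedRing K] hq ha hb in
lemma swapVec_act_T : swapVec q i a b v ◃ T q n i = (q - 1 - diagCoef q a b) • swapVec q i a b v +
    ((q - diagCoef q a b) * (1 + diagCoef q a b)) • v := by
  have e := (isHecke q n).quad i hi hin
  rw [swapVec, sub_act, smul_act, ← act_mul, e]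
  simp only [act_add, act_smul, act_one]
  module

/-- The invariant form of `swapVec` with itself is a multiple of `(q - d) (1 + d)`, where `d` is the
diagonal coefficient, because `swapVec` is orthogonal to `v`; hence positivity makes `swapVec` vanish
together with this product. -/
lemma swapVec_eq_zero (hab : a ≠ b)
    (hd : (q - diagCoef q a b) * (1 + diagCoef q a b) = 0) : swapVec q i a b v = 0 := by
  have e := swapVec_act_T (q := q) hi hin (a := a) (b := b) (v := v)
  rw [hd, zero_smul, add_zero] at e
  have horth : form q v (swapVec q i a b v) = 0 :=
    form_eq_zero_of_ne (IsAdj.jm i) ((qInt_strictMono hq).injective.ne hab) ha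
      (swapVec_act_Jm hq hi hin ha hb hab)
  have h5 : form q (swapVec q i a b v) (swapVec q i a b v) =
      form q (v ◃ T q n i) (swapVec q i a b v) -
        diagCoef q a b • form q v (swapVec q i a b v) := by
    rw [← LinearMap.smul_apply, ← map_smul, ← LinearMap.sub_apply, ← map_sub]
    rfl
  rw [← form_self_eq_zero hq, h5, horth, IsAdj.T, e, map_smul, horth]
  simp

lemma act_T_of_content_succ (hab : b = a + 1) : v ◃ T q n i = q • v := by
  have h1 : diagCoef q a b = q := by
    have := zpow_pos hq a
    rw [diagCoef, hab, qInt_succ' hq.ne', add_sub_cancel_left, zpow_add_one₀ hq.ne']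
    field_simp
  have := swapVec_eq_zero hq hi hin ha hb (by omega) (by rw [h1]; ring)
  rwa [swapVec, h1, sub_eq_zero] at this

lemma act_T_of_content_pred (hab : a = b + 1) : v ◃ T q n i = -v := by
  have h1 : diagCoef q a b = -1 := by
    have := zpow_pos hq b
    rw [diagCoef, hab, qInt_succ' hq.ne', sub_add_cancel_left]
    field_simp
  have := swapVec_eq_zero hq hi hin ha hb (by omega) (by rw [h1]; ring)
  rwa [swapVec, h1, sub_eq_zero, neg_one_smul] at this

end Swap

/-- The diagonal coefficient is `q` or `-1` only for neighbouring contents. -/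
lemma diagCoef_ne (hq : 0 < q) {a b : ℤ} (hab : 2 ≤ |a - b|) :
    q - diagCoef q a b ≠ 0 ∧ 1 + diagCoef q a b ≠ 0 := by
  have hne : a ≠ b := by rintro rfl; simp at hab
  have hne' : qInt q b - qInt q a ≠ 0 :=
    sub_ne_zero.2 ((qInt_strictMono hq).injective.ne hne.symm)
  rw [diagCoef, ← qInt_mul hq.ne']
  constructor
  · intro h
    field_simp at h
    have : qInt q b = qInt q (a + 1) := by
      rw [qInt_succ hq.ne']
      linear_combination h
    have := (qInt_strictMono hq).injective this
    rw [this] at hab; simp at hab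
  · intro h
    field_simp at h
    have : qInt q a = qInt q (b + 1) := by
      rw [qInt_succ hq.ne']
      linear_combination -h
    have := (qInt_strictMono hq).injective this
    rw [this] at hab; simp at hab

lemma diagCoef_pos (hq : 0 < q) {a b : ℤ} (hab : a < b) : 0 < diagCoef q a b :=
  div_pos (zpow_pos hq b) (sub_pos.2 (qInt_strictMono hq hab))

variable (q) in
/-- The polynomial with the roots `[c]` for `-m < c < m`. -/
noncomputable def specPoly (m : ℕ) : Polynomial K :=
  Lagrange.nodal (Finset.Ioo (-(m : ℤ)) m) (qInt q)

variable (q) in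
/-- The Lagrange polynomial that is `1` at `[c]` and `0` at all other `[c']` with `|c'| < m`. -/
noncomputable def lagr (m : ℕ) (c : ℤ) : Polynomial K :=
  Lagrange.basis (Finset.Ioo (-(m : ℤ)) m) (qInt q) c

lemma specPoly_dvd {m N : ℕ} (h : m ≤ N) : specPoly q m ∣ specPoly q N := by
  rw [specPoly, specPoly, Lagrange.nodal, Lagrange.nodal]
  apply Finset.prod_dvd_prod_of_subset
  intro c hc
  rw [Finset.mem_Ioo] at hc ⊢
  omega

lemma linear_dvd_specPoly {c : ℤ} {m : ℕ} (h : |c| < m) :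
    Polynomial.X - Polynomial.C (qInt q c) ∣ specPoly q m := by
  rw [specPoly, Lagrange.nodal]
  apply Finset.dvd_prod_of_mem (fun c => Polynomial.X - Polynomial.C (qInt q c))
  rw [Finset.mem_Ioo]
  rw [abs_lt] at h
  exact h

lemma specPoly_dvd_lagr (m : ℕ) (c : ℤ) (hc : |c| < m) :
    specPoly q m ∣ lagr q m c * (Polynomial.X - Polynomial.C (qInt q c)) := by
  have hmem : c ∈ Finset.Ioo (-(m : ℤ)) m := by rw [Finset.mem_Ioo]; rwa [abs_lt] at hc
  rw [specPoly, Lagrange.nodal_eq_mul_nodal_erase hmem, lagr, Lagrange.basis, mul_comm]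
  apply mul_dvd_mul_right
  simp only [Lagrange.basisDivisor, Finset.prod_mul_distrib, Lagrange.nodal]
  exact dvd_mul_left _ _

lemma sum_lagr (hq : 0 < q) {m : ℕ} (hm : 0 < m) :
    ∑ c ∈ Finset.Ioo (-(m : ℤ)) m, lagr q m c = 1 :=
  Lagrange.sum_basis (qInt_strictMono hq).injective.injOn
    ⟨0, by simp [hm]⟩

lemma act_aeval_of_eigen {h : Hecke q n} {v : Words K n} {a : K} (hv : v ◃ h = a • v)
    (p : Polynomial K) : v ◃ Polynomial.aeval h p = p.eval a • v := by
  have hpow : ∀ k : ℕ, v ◃ h ^ k = a ^ k • v := by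
    intro k
    induction k with
    | zero => simp
    | succ k ih => rw [pow_succ, act_mul, ih, smul_act, hv, smul_smul, pow_succ]
  induction p using Polynomial.induction_on' with
  | add p r hp hr => rw [map_add, act_add, hp, hr, Polynomial.eval_add, add_smul]
  | monomial k c =>
    rw [Polynomial.aeval_monomial, ← Algebra.smul_def, act_smul, hpow, Polynomial.eval_monomial,
      smul_smul]

lemma act_aeval_eq_zero_of_dvd {h : Hecke q n} {v : Words K n} {p r : Polynomial K} (hpr : p ∣ r)
    (hv : v ◃ Polynomial.aeval h p = 0) : v ◃ Polynomial.aeval h r = 0 := by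
  obtain ⟨s, rfl⟩ := hpr
  rw [map_mul, act_mul, hv, zero_act]

/-- Given an eigenvector `v` of `J_m`, a polynomial annihilating `J_m` gives one annihilating `v`
under `J_{m+1}`. -/
lemma act_spec_step (hq : 0 < q) {m : ℕ} (hm : 1 ≤ m) (hmn : m < n) {g : Polynomial K}
    (hg : ∀ v : Words K n, v ◃ Polynomial.aeval (Jm q n m) g = 0) {a : ℤ} {v : Words K n}
    (hv : v ◃ Jm q n m = qInt q a • v) :
    v ◃ Polynomial.aeval (Jm q n (m + 1)) (g * ((Polynomial.X - Polynomial.C (qInt q (a + 1))) *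
      (Polynomial.X - Polynomial.C (qInt q (a - 1))))) = 0 := by
  set X := Jm q n m
  set Y := Jm q n (m + 1)
  set t := T q n m
  have H := isHecke q n
  have hXY : Commute X Y := H.jm_commute_jm hq.ne' hmn.le hmn
  have hYT : Y * t = t * X + (q - 1) • Y + 1 := H.jm_succ_mul_t hq.ne' hm hmn
  have htt : t * t = (q - 1) • t + q • 1 := H.quad m hm hmn
  set c := qInt q a with hc
  -- the intertwiner of the eigenvalues of `J_m` and `J_{m+1}`
  set Ψ : Hecke q n := (c • 1 - Y) * t + ((q - 1) • Y + 1) with hΨ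
  have hΨX : Ψ * X = Y * Ψ + (X - c • 1) * ((q - 1) • Y + 1) := by
    have htX : t * X = Y * t - (q - 1) • Y - 1 := by rw [hYT]; abel
    rw [hΨ, add_mul, mul_assoc, htX]
    simp only [mul_add, mul_sub, sub_mul, add_mul, smul_mul_assoc, mul_smul_comm, one_mul, mul_one,
      hXY.eq]
    module
  have hpoly : ∀ (p : Polynomial K) (u : Words K n), u ◃ X = c • u →
      u ◃ Polynomial.aeval Y p ◃ Ψ = u ◃ Ψ ◃ Polynomial.aeval X p := by
    have h1 : ∀ u : Words K n, u ◃ X = c • u → u ◃ Ψ ◃ X = u ◃ Y ◃ Ψ := by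
      intro u hu
      have h0 : u ◃ (X - c • 1) = 0 := by simp [hu]
      rw [← act_mul, hΨX, act_add, act_mul, act_mul, h0, zero_act, add_zero]
    have hpow : ∀ (k : ℕ) (u : Words K n), u ◃ X = c • u → u ◃ Y ^ k ◃ Ψ = u ◃ Ψ ◃ X ^ k := by
      intro k
      induction k with
      | zero => intro u _; simp
      | succ k ih =>
        intro u hu
        have hu' : u ◃ Y ◃ X = c • u ◃ Y := by rw [act_comm u hXY.symm, hu, smul_act]
        rw [pow_succ', act_mul, ih _ hu', ← h1 u hu, pow_succ', act_mul]
    intro p u hu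
    induction p using Polynomial.induction_on' with
    | add p r hp hr => simp only [map_add, act_add, add_act, hp, hr]
    | monomial k d =>
      simp only [Polynomial.aeval_monomial, ← Algebra.smul_def, act_smul, smul_act, hpow k u hu]
  have hzero : ∀ p : Polynomial K, v ◃ Polynomial.aeval Y g ◃ Polynomial.aeval Y p ◃ Ψ = 0 := by
    intro p
    rw [← act_mul v, ← map_mul, hpoly _ _ hv, map_mul, act_mul, hg, zero_act]
  set w := v ◃ Polynomial.aeval Y g with hw
  have e1 : w ◃ ((c • 1 - Y) * Ψ * t) = 0 := by
    have := hzero (Polynomial.C c - Polynomial.X)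
    rw [map_sub, Polynomial.aeval_C, Polynomial.aeval_X, Algebra.algebraMap_eq_smul_one] at this
    rw [act_mul, act_mul, this, zero_act]
  have e2 : w ◃ (((q - 1) • (c • 1 - Y) + ((q - 1) • Y + 1)) * Ψ) = 0 := by
    have := hzero ((q - 1) • (Polynomial.C c - Polynomial.X) + ((q - 1) • Polynomial.X + 1))
    rw [map_add, map_add, map_smul, map_smul, map_sub, Polynomial.aeval_C, Polynomial.aeval_X,
      map_one, Algebra.algebraMap_eq_smul_one] at this
    rw [act_mul, this]
  have e3 : (c • 1 - Y) * Ψ * t - ((q - 1) • (c • 1 - Y) + ((q - 1) • Y + 1)) * Ψ =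
      q • ((Y - (q * c + 1) • 1) * (Y - (q⁻¹ * (c - 1)) • 1)) := by
    have htt' : ∀ z : Hecke q n, t * (t * z) = ((q - 1) • t + q • 1) * z := by
      intro z; rw [← mul_assoc, htt]
    rw [hΨ]
    simp only [mul_add, add_mul, sub_mul, mul_sub, smul_mul_assoc, mul_smul_comm, one_mul, mul_one,
      mul_assoc, htt, smul_add, smul_sub]
    match_scalars <;> field_simp <;> ring
  have e4 : w ◃ ((Y - (q * c + 1) • 1) * (Y - (q⁻¹ * (c - 1)) • 1)) = 0 := by
    have h := congrArg (w ◃ ·) e3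
    simp only [act_sub _ ((c • 1 - Y) * Ψ * t), e1, e2, sub_zero] at h
    rw [act_smul] at h
    exact (smul_eq_zero.1 h.symm).resolve_left hq.ne'
  rw [map_mul, act_mul, ← hw]
  have h1 : qInt q (a + 1) = q * c + 1 := qInt_succ hq.ne' a
  have h2 : qInt q (a - 1) = q⁻¹ * (c - 1) := by
    rw [← qInt_pred hq.ne' a]
    field_simp [hq.ne']
  rw [h1, h2]
  rw [map_mul, map_sub, map_sub, Polynomial.aeval_X, Polynomial.aeval_C, Polynomial.aeval_C,
    Algebra.algebraMap_eq_smul_one, Algebra.algebraMap_eq_smul_one]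
  exact e4

lemma act_lagr_act {h : Hecke q n} {m : ℕ} {v : Words K n}
    (hv : v ◃ Polynomial.aeval h (specPoly q m) = 0) {c : ℤ} (hc : |c| < m) :
    v ◃ Polynomial.aeval h (lagr q m c) ◃ h = qInt q c • v ◃ Polynomial.aeval h (lagr q m c) := by
  have := act_aeval_eq_zero_of_dvd (specPoly_dvd_lagr m c hc) hv
  rw [map_mul, act_mul, map_sub, Polynomial.aeval_X, Polynomial.aeval_C,
    Algebra.algebraMap_eq_smul_one, act_sub, act_smul, act_one, sub_eq_zero] at this
  exact this

lemma sum_act_lagr (hq : 0 < q) {h : Hecke q n} {m : ℕ} (hm : 0 < m) (v : Words K n) :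
    ∑ c ∈ Finset.Ioo (-(m : ℤ)) m, v ◃ Polynomial.aeval h (lagr q m c) = v := by
  rw [← act_sum, ← map_sum, sum_lagr hq hm, map_one, act_one]

/-- The Jucys--Murphy element `J_m` is annihilated by a polynomial with simple roots in `K`. -/
theorem act_specPoly (hq : 0 < q) {m : ℕ} (hm : 1 ≤ m) (hmn : m ≤ n) (v : Words K n) :
    v ◃ Polynomial.aeval (Jm q n m) (specPoly q m) = 0 := by
  induction m, hm using Nat.le_induction generalizing v with
  | base =>
    have h0 : Jm q n 1 = 0 := (isHecke q n).jm_one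
    refine act_aeval_eq_zero_of_dvd (linear_dvd_specPoly (c := 0) (by simp)) ?_
    rw [h0]
    simp [qInt_zero]
  | succ m hm ih =>
    have ih := ih (by omega)
    have key : ∀ (a : ℤ) (u : Words K n), |a| < m → u ◃ Jm q n m = qInt q a • u →
        u ◃ Polynomial.aeval (Jm q n (m + 1)) (specPoly q (m + 1)) = 0 := by
      intro a u ha hu
      have h1 := act_spec_step hq hm hmn ih hu
      have h3 : u ◃ Polynomial.aeval (Jm q n (m + 1)) (specPoly q (m + 1) *
          (specPoly q (m + 1) * specPoly q (m + 1))) = 0 := by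
        refine act_aeval_eq_zero_of_dvd ?_ h1
        rw [abs_lt] at ha
        refine mul_dvd_mul (specPoly_dvd (by omega)) (mul_dvd_mul (linear_dvd_specPoly ?_)
          (linear_dvd_specPoly ?_)) <;> rw [abs_lt] <;> push_cast <;> constructor <;> omega
      -- `h3` has a polynomial with triple roots; self-adjoint operators need only simple ones
      have hadj := (IsAdj.jm (q := q) (n := n) (m + 1)).aeval (specPoly q (m + 1))
      rw [map_mul, map_mul, act_mul, act_mul] at h3
      exact act_eq_zero_of_act_act hq hadj (act_eq_zero_of_act_act hq hadj h3)
    rw [← sum_act_lagr hq (h := Jm q n m) hm v, sum_act]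
    refine Finset.sum_eq_zero fun c hc => ?_
    have hc' : |c| < m := by rw [abs_lt]; exact Finset.mem_Ioo.1 hc
    exact key c _ hc' (act_lagr_act (ih v) hc')

lemma act_specPoly_self (hq : 0 < q) {m : ℕ} (hm : 1 ≤ m) (hmn : m ≤ n) (v : Words K n) :
    v ◃ Polynomial.aeval (Jm q n m) (specPoly q n) = 0 :=
  act_aeval_eq_zero_of_dvd (specPoly_dvd hmn) (act_specPoly hq hm hmn v)

end Spectrum

/-! ### Standard fillings as lists of cells -/

section StdLists

/-- A standard filling of a Young diagram, as the list of its cells in the order in which they are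
added; the head of the list is the cell that is added last. -/
def Std (l : List (ℕ × ℕ)) : Prop :=
  l.Pairwise (fun x y => ¬ x ≤ y) ∧ ∀ x ∈ l, ∀ y ≤ x, y ∈ l

lemma std_nil : Std [] := by simp [Std]

lemma std_cons {b : ℕ × ℕ} {l : List (ℕ × ℕ)} :
    Std (b :: l) ↔ Std l ∧ b ∉ l ∧ ∀ y < b, y ∈ l := by
  constructor
  · rintro ⟨h1, h2⟩
    rw [List.pairwise_cons] at h1
    refine ⟨⟨h1.2, fun x hx y hy => ?_⟩, fun hb => h1.1 b hb le_rfl, fun y hy => ?_⟩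
    · rcases List.mem_cons.1 (h2 x (List.mem_cons_of_mem _ hx) y hy) with rfl | h
      · exact absurd hy (h1.1 x hx)
      · exact h
    · rcases List.mem_cons.1 (h2 b List.mem_cons_self y hy.le) with rfl | h
      · exact absurd rfl hy.ne
      · exact h
  · rintro ⟨⟨h1, h2⟩, h3, h4⟩
    refine ⟨List.pairwise_cons.2 ⟨fun x hx hbx => h3 (h2 x hx b hbx), h1⟩, fun x hx y hy => ?_⟩
    rcases List.mem_cons.1 hx with rfl | hx
    · rcases eq_or_lt_of_le hy with rfl | hy
      · exact List.mem_cons_self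
      · exact List.mem_cons_of_mem _ (h4 y hy)
    · exact List.mem_cons_of_mem _ (h2 x hx y hy)

lemma Std.tail {b : ℕ × ℕ} {l : List (ℕ × ℕ)} (h : Std (b :: l)) : Std l := (std_cons.1 h).1

lemma Std.of_append {s l : List (ℕ × ℕ)} (h : Std (s ++ l)) : Std l := by
  induction s with
  | nil => exact h
  | cons b s ih => exact ih (Std.tail h)

lemma Std.nodup {l : List (ℕ × ℕ)} (h : Std l) : l.Nodup :=
  h.1.imp fun h e => h e.le

lemma Std.card_toFinset {l : List (ℕ × ℕ)} (h : Std l) : l.toFinset.card = l.length :=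
  List.toFinset_card_of_nodup h.nodup

lemma two_le_abs_content_sub {x y : ℕ × ℕ} (h1 : ¬ x ≤ y) (h2 : ¬ y ≤ x) :
    2 ≤ |content x - content y| := by
  rw [Prod.le_def] at h1 h2
  simp only [content]
  rcases abs_cases ((x.2 : ℤ) - x.1 - (y.2 - y.1)) with h | h <;> omega

/-- Two consecutive comparable cells of a standard filling are neighbours. -/
lemma Std.adjacent {x y : ℕ × ℕ} {l : List (ℕ × ℕ)} (h : Std (x :: y :: l)) (hyx : y ≤ x) :
    x = (y.1 + 1, y.2) ∨ x = (y.1, y.2 + 1) := by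
  obtain ⟨h1, h2⟩ := h
  simp only [List.pairwise_cons, List.mem_cons] at h1
  have key : ∀ z, y ≤ z → z ≤ x → z = x ∨ z = y := by
    intro z h3 h4
    have := h2 x List.mem_cons_self z h4
    simp only [List.mem_cons] at this
    rcases this with h | h | h
    · exact Or.inl h
    · exact Or.inr h
    · exact absurd h3 (h1.2.1 z h)
  obtain ⟨a, b⟩ := x
  obtain ⟨c, d⟩ := y
  have hne : ¬ (a, b) ≤ (c, d) := h1.1 _ (Or.inl rfl)
  simp only [Prod.mk_le_mk] at hyx hne
  by_cases hc : c < a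
  · left
    have := key (c + 1, d) (by simp) (by simp; omega)
    simp only [Prod.mk.injEq] at this ⊢
    omega
  · right
    have := key (c, d + 1) (by simp) (by simp; omega)
    simp only [Prod.mk.injEq] at this ⊢
    omega

lemma Std.abs_content_lt {l : List (ℕ × ℕ)} (h : Std l) {x : ℕ × ℕ} (hx : x ∈ l) :
    |content x| < l.length := by
  have h1 : x.1 + 1 ≤ l.length := by
    rw [← h.card_toFinset, ← Finset.card_range (x.1 + 1),
      ← Finset.card_image_of_injective (f := fun i => (i, 0)) _ fun i j h => by simpa using h]
    refine Finset.card_le_card fun y hy => ?_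
    obtain ⟨i, hi, rfl⟩ := Finset.mem_image.1 hy
    rw [List.mem_toFinset]
    exact h.2 x hx _ (Prod.le_def.2 ⟨by simp at hi ⊢; omega, by simp⟩)
  have h2 : x.2 + 1 ≤ l.length := by
    rw [← h.card_toFinset, ← Finset.card_range (x.2 + 1),
      ← Finset.card_image_of_injective (f := fun i => (0, i)) _ fun i j h => by simpa using h]
    refine Finset.card_le_card fun y hy => ?_
    obtain ⟨i, hi, rfl⟩ := Finset.mem_image.1 hy
    rw [List.mem_toFinset]
    exact h.2 x hx _ (Prod.le_def.2 ⟨by simp, by simp at hi ⊢; omega⟩)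
  rw [content, abs_lt]
  omega

lemma le_or_le_of_content_eq {x y : ℕ × ℕ} (h : content x = content y) : x ≤ y ∨ y ≤ x := by
  simp only [content] at h
  rw [Prod.le_def, Prod.le_def]
  omega

lemma Std.cons_inj {b b' : ℕ × ℕ} {l : List (ℕ × ℕ)} (h : Std (b :: l)) (h' : Std (b' :: l))
    (hc : content b = content b') : b = b' := by
  rw [std_cons] at h h'
  rcases le_or_le_of_content_eq hc with hle | hle
  · rcases eq_or_lt_of_le hle with e | e
    · exact e
    · exact absurd (h'.2.2 b e) h.2.1
  · rcases eq_or_lt_of_le hle with e | e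
    · exact e.symm
    · exact absurd (h.2.2 b' e) h'.2.1

lemma Std.eq_of_content_eq {l l' : List (ℕ × ℕ)} (h : Std l) (h' : Std l')
    (hc : l.map content = l'.map content) : l = l' := by
  induction l generalizing l' with
  | nil =>
    cases l' with
    | nil => rfl
    | cons _ _ => simp at hc
  | cons b l ih =>
    cases l' with
    | nil => simp at hc
    | cons b' l' =>
      simp only [List.map_cons, List.cons.injEq] at hc
      obtain rfl := ih h.tail h'.tail hc.2
      rw [h.cons_inj h' hc.1]

/-- Incomparable consecutive cells of a standard filling may be exchanged. -/
lemma Std.swap {x y : ℕ × ℕ} {s l : List (ℕ × ℕ)} (h : Std (s ++ x :: y :: l))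
    (hyx : ¬ y ≤ x) : Std (s ++ y :: x :: l) := by
  have hp : (s ++ x :: y :: l).Perm (s ++ y :: x :: l) := (List.Perm.swap _ _ _).append_left s
  refine ⟨?_, fun a ha b hb => hp.mem_iff.1 (h.2 a (hp.mem_iff.2 ha) b hb)⟩
  have h1 := h.1
  simp only [List.pairwise_append, List.pairwise_cons, List.mem_cons] at h1 ⊢
  refine ⟨h1.1, ⟨?_, fun a ha => h1.2.1.1 a (Or.inr ha), h1.2.1.2.2⟩, ?_⟩
  · rintro a (rfl | ha)
    · exact hyx
    · exact h1.2.1.2.1 a ha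
  · rintro a ha b (rfl | rfl | hb)
    · exact h1.2.2 a ha b (Or.inr (Or.inl rfl))
    · exact h1.2.2 a ha b (Or.inl rfl)
    · exact h1.2.2 a ha b (Or.inr (Or.inr hb))

/-- Two lists of cells are related by exchanges of consecutive cells with contents that differ by
at least `2`. -/
inductive Adm : List (ℕ × ℕ) → List (ℕ × ℕ) → Prop
  | refl (l) : Adm l l
  | swap (s l x y) (h : 2 ≤ |content x - content y|) : Adm (s ++ x :: y :: l) (s ++ y :: x :: l)
  | trans {l₁ l₂ l₃} : Adm l₁ l₂ → Adm l₂ l₃ → Adm l₁ l₃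

lemma Adm.cons (b : ℕ × ℕ) {l l' : List (ℕ × ℕ)} (h : Adm l l') : Adm (b :: l) (b :: l') := by
  induction h with
  | refl l => exact .refl _
  | swap s l x y h => exact .swap (b :: s) l x y h
  | trans _ _ h1 h2 => exact h1.trans h2

lemma Adm.symm {l l' : List (ℕ × ℕ)} (h : Adm l l') : Adm l' l := by
  induction h with
  | refl l => exact .refl _
  | swap s l x y h => exact .swap s l y x (by rwa [abs_sub_comm])
  | trans _ _ h1 h2 => exact h2.trans h1

lemma Adm.perm {l l' : List (ℕ × ℕ)} (h : Adm l l') : l.Perm l' := by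
  induction h with
  | refl l => exact .refl _
  | swap s l x y h => exact (List.Perm.swap _ _ _).append_left s
  | trans _ _ h1 h2 => exact h1.trans h2

lemma Adm.append_right {l l' : List (ℕ × ℕ)} (h : Adm l l') (r : List (ℕ × ℕ)) :
    Adm (l ++ r) (l' ++ r) := by
  induction h with
  | refl l => exact .refl _
  | swap s l x y h => simpa using Adm.swap s (l ++ r) x y h
  | trans _ _ h1 h2 => exact h1.trans h2

/-- Any two standard fillings of the same skew shape are related by admissible exchanges. -/
theorem Std.adm {s s' l : List (ℕ × ℕ)} (h : Std (s ++ l)) (h' : Std (s' ++ l))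
    (hp : s.Perm s') : Adm s s' := by
  induction s generalizing s' with
  | nil => rw [hp.nil_eq]; exact .refl _
  | cons b s ih =>
    have hb : b ∈ s' := hp.subset List.mem_cons_self
    obtain ⟨u, v, rfl⟩ := List.append_of_mem hb
    have hb' : ∀ x ∈ s ++ l, ¬ b ≤ x := (List.pairwise_cons.1 h.1).1
    -- move the cell `b` to the end of the second filling
    have key : ∀ u, Std (u ++ (b :: (v ++ l))) → (∀ y ∈ u, ¬ b ≤ y) →
        Adm (u ++ b :: v) (b :: (u ++ v)) ∧ Std (b :: (u ++ (v ++ l))) := by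
      intro u
      induction u with
      | nil => intro h _; exact ⟨.refl _, h⟩
      | cons y u ihu =>
        intro h hu
        have h1 : Adm (u ++ b :: v) (b :: (u ++ v)) ∧ Std (b :: (u ++ (v ++ l))) :=
          ihu h.tail fun z hz => hu z (List.mem_cons_of_mem _ hz)
        have hyb : ¬ y ≤ b := (List.pairwise_cons.1 h.1).1 b (by simp)
        have hby : ¬ b ≤ y := hu y List.mem_cons_self
        have h2 : Std (y :: b :: (u ++ (v ++ l))) := by
          have hpm : (y :: (u ++ b :: (v ++ l))).Perm (y :: b :: (u ++ (v ++ l))) :=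
            List.Perm.cons _ List.perm_middle
          have h3 : Std (y :: (u ++ b :: (v ++ l))) := h
          rw [std_cons] at h3 ⊢
          refine ⟨h1.2, fun hy => h3.2.1 ?_, fun z hz => ?_⟩
          · exact List.perm_middle.mem_iff.2 hy
          · exact List.perm_middle.mem_iff.1 (h3.2.2 z hz)
        refine ⟨(h1.1.cons y).trans ?_, Std.swap (s := []) h2 hby⟩
        exact .swap [] _ y b (two_le_abs_content_sub hyb hby)
    have hp' : s.Perm (u ++ v) := (hp.trans List.perm_middle).cons_inv
    have hu : ∀ y ∈ u, ¬ b ≤ y := fun y hy =>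
      hb' y (List.mem_append_left _ (hp'.mem_iff.2 (List.mem_append_left _ hy)))
    obtain ⟨h1, h2⟩ := key u (by simpa using h') hu
    have h3 : Std (u ++ v ++ l) := by simpa using h2.tail
    exact ((ih h.tail h3 hp').cons b).trans h1.symm

/-- Two neighbouring cells of a segment of a standard filling can be made consecutive. -/
lemma Std.make_adjacent {s l : List (ℕ × ℕ)} {x x' : ℕ × ℕ} (hxx : x ⋖ x')
    (h : Std (x' :: (s ++ x :: l))) :
    ∃ A B : List (ℕ × ℕ), Std (B ++ x' :: x :: (A ++ l)) ∧
      (x' :: (s ++ [x])).Perm (B ++ x' :: x :: A) := by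
  classical
  set A := s.filter (· ≤ x') with hA
  set B := s.filter (fun y => ¬ y ≤ x') with hB
  have hs : s.Perm (B ++ A) := by
    have := List.filter_append_perm (· ≤ x') s
    refine (this.symm.trans List.perm_append_comm).trans ?_
    simp [hA, hB]
  have hperm : (x' :: (s ++ [x])).Perm (B ++ x' :: x :: A) := by
    refine List.Perm.trans ?_ List.perm_middle.symm
    refine List.Perm.cons _ ?_
    refine List.perm_append_comm.trans (List.Perm.trans ?_ List.perm_middle.symm)
    exact hs.cons x
  refine ⟨A, B, ⟨?_, ?_⟩, hperm⟩
  · have h1 := h.1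
    simp only [List.pairwise_append, List.pairwise_cons, List.mem_cons, List.mem_append] at h1 ⊢
    have memA : ∀ y, y ∈ A ↔ y ∈ s ∧ y ≤ x' := by intro y; simp [hA]
    have memB : ∀ y, y ∈ B ↔ y ∈ s ∧ ¬ y ≤ x' := by
      intro y; simp only [hB, List.mem_filter, decide_not, Bool.not_eq_true', decide_eq_false_iff_not]
    obtain ⟨h2, h3, ⟨h4, h5⟩, h6⟩ := h1
    have hx'x : ¬ x' ≤ x := hxx.lt.not_ge
    refine ⟨h3.sublist List.filter_sublist, ⟨?_, ?_, h3.sublist List.filter_sublist, h5, ?_⟩, ?_⟩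
    · rintro a (rfl | ha | ha)
      · exact hx'x
      · exact h2 a (Or.inl ((memA a).1 ha).1)
      · exact h2 a (Or.inr (Or.inr ha))
    · rintro a (ha | ha) hxa
      · obtain ⟨has, hax'⟩ := (memA a).1 ha
        rcases eq_or_lt_of_le hxa with rfl | h7
        · exact h6 _ has _ (Or.inl rfl) le_rfl
        · rcases eq_or_lt_of_le hax' with rfl | h8
          · exact h2 _ (Or.inl has) le_rfl
          · exact hxx.2 h7 h8
      · exact h4 a ha hxa
    · intro a ha b hb
      exact h6 a ((memA a).1 ha).1 b (Or.inr hb)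
    · rintro a ha b (rfl | rfl | hb | hb)
      · exact ((memB a).1 ha).2
      · exact h6 a ((memB a).1 ha).1 _ (Or.inl rfl)
      · exact fun hab => ((memB a).1 ha).2 (hab.trans ((memA b).1 hb).2)
      · exact h6 a ((memB a).1 ha).1 b (Or.inr hb)
  · have hp2 : (x' :: (s ++ x :: l)).Perm (B ++ x' :: x :: (A ++ l)) := by
      have := hperm.append_right l
      simpa using this
    exact fun a ha b hb => hp2.mem_iff.1 (h.2 a (hp2.mem_iff.2 ha) b hb)

end StdLists

/-! ### Joint eigenspaces of the Jucys--Murphy elements -/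

section Eigenspaces

set_option linter.unusedSectionVars false

variable {K : Type*} [Field K] {q : K} {n : ℕ}

variable (q n) in
/-- The joint eigenspace of the Jucys--Murphy elements `J_{j+1}, …, J_{j+k}` for the eigenvalues
`[c]`, where `c` runs over a list of length `k`; the head of the list belongs to `J_{j+k}`. -/
noncomputable def eig (j : ℕ) : List ℤ → Submodule K (Words K n)
  | [] => ⊤
  | c :: s => eig j s ⊓ Module.End.eigenspace (rightAct q (Jm q n (j + s.length + 1))) (qInt q c)

lemma mem_eig_cons {j : ℕ} {c : ℤ} {s : List ℤ} {v : Words K n} : v ∈ eig q n j (c :: s) ↔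
    v ∈ eig q n j s ∧ v ◃ Jm q n (j + s.length + 1) = qInt q c • v := by
  rw [eig, Submodule.mem_inf, Module.End.mem_eigenspace_iff, act]

@[simp] lemma eig_nil (j : ℕ) : eig q n j [] = ⊤ := rfl

lemma mem_eig_append {j : ℕ} {s r : List ℤ} {v : Words K n} : v ∈ eig q n j (s ++ r) ↔
    v ∈ eig q n j r ∧ v ∈ eig q n (j + r.length) s := by
  induction s with
  | nil => simp
  | cons c s ih =>
    rw [List.cons_append, mem_eig_cons, mem_eig_cons, ih, and_assoc, List.length_append,
      show j + (s.length + r.length) = j + r.length + s.length by ring]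

lemma act_mem_eig {j : ℕ} {s : List ℤ} {h : Hecke q n} {v : Words K n} (hv : v ∈ eig q n j s)
    (hc : ∀ k, j < k → k ≤ j + s.length → Commute h (Jm q n k)) : v ◃ h ∈ eig q n j s := by
  induction s with
  | nil => simp
  | cons c s ih =>
    rw [List.length_cons] at hc
    rw [mem_eig_cons] at hv ⊢
    refine ⟨ih hv.1 fun k h1 h2 => hc k h1 (by omega), ?_⟩
    rw [act_comm v (hc _ (by omega) (by omega)), hv.2, smul_act]

lemma T_commute_Jm (hq : q ≠ 0) {i m : ℕ} (hi : 1 ≤ i) (hin : i < n) (hm : m ≤ n)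
    (h : m < i ∨ i + 1 < m) : Commute (T q n i) (Jm q n m) := by
  rcases h with h | h
  · exact (isHecke q n).t_commute_jm_of_lt h hin
  · exact (isHecke q n).t_commute_jm_of_gt hq hi h hm

lemma act_T_mem_eig (hq : q ≠ 0) {i j : ℕ} {s : List ℤ} {v : Words K n} (hv : v ∈ eig q n j s)
    (hi : 1 ≤ i) (hin : i < n) (hj : j + s.length ≤ n) (h : i < j ∨ j + s.length < i) :
    v ◃ T q n i ∈ eig q n j s :=
  act_mem_eig hv fun k _ _ => T_commute_Jm hq hi hin (by omega) (by omega)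

variable [LinearOrder K] [IsStrictOrderedRing K]

lemma swapVec_mem_eig (hq : 0 < q) {j i : ℕ} {s r : List ℤ} {a b : ℤ} {v : Words K n}
    (hv : v ∈ eig q n j (s ++ b :: a :: r)) (hab : a ≠ b) (hn : j + (s.length + r.length + 2) ≤ n)
    (hi : i = j + r.length + 1) : swapVec q i a b v ∈ eig q n j (s ++ a :: b :: r) := by
  rw [mem_eig_append, mem_eig_cons, mem_eig_cons] at hv ⊢
  simp only [List.length_cons, ← add_assoc, ← hi] at hv ⊢
  obtain ⟨⟨⟨h1, h2⟩, h3⟩, h4⟩ := hv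
  refine ⟨⟨⟨?_, ?_⟩, ?_⟩, ?_⟩
  · exact Submodule.sub_mem _ (act_T_mem_eig hq.ne' h1 (by omega) (by omega) (by omega) (by omega))
      (Submodule.smul_mem _ _ h1)
  · exact swapVec_act_Jm hq (by omega) (by omega) h2 h3 hab
  · exact swapVec_act_Jm_succ hq (by omega) (by omega) h2 h3 hab
  · exact Submodule.sub_mem _ (act_T_mem_eig hq.ne' h4 (by omega) (by omega) (by omega) (by omega))
      (Submodule.smul_mem _ _ h4)

lemma eig_consecutive {j i : ℕ} {s r : List ℤ} {a b : ℤ} {v : Words K n}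
    (hv : v ∈ eig q n j (s ++ b :: a :: r)) (hi : i = j + r.length + 1) :
    v ◃ Jm q n i = qInt q a • v ∧ v ◃ Jm q n (i + 1) = qInt q b • v := by
  rw [mem_eig_append, mem_eig_cons, mem_eig_cons] at hv
  simp only [List.length_cons, ← add_assoc, ← hi] at hv
  exact ⟨hv.1.1.2, hv.1.2⟩

lemma eq_zero_of_swapVec_eq_zero (hq : 0 < q) {i : ℕ} (hi : 1 ≤ i) (hin : i < n) {a b : ℤ}
    (hab : 2 ≤ |a - b|) {v : Words K n} (h : swapVec q i a b v = 0) : v = 0 := by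
  have := swapVec_act_T (q := q) hi hin (a := a) (b := b) (v := v)
  rw [h, zero_act, smul_zero, zero_add] at this
  obtain ⟨h1, h2⟩ := diagCoef_ne hq hab
  exact (smul_eq_zero.1 this.symm).resolve_left (mul_ne_zero h1 h2)

variable (q n) in
/-- The joint eigenspace for a list of contents is nonzero. -/
def NZ (s : List ℤ) : Prop := ∃ v ∈ eig q n 0 s, v ≠ 0

/-- Two consecutive contents that are not neighbours can be exchanged. -/
lemma NZ.swap (hq : 0 < q) {s r : List ℤ} {a b : ℤ} (h : NZ q n (s ++ b :: a :: r))
    (hab : 2 ≤ |a - b|) (hn : s.length + r.length + 2 ≤ n) : NZ q n (s ++ a :: b :: r) := by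
  obtain ⟨v, hv, hv0⟩ := h
  have hne : a ≠ b := by rintro rfl; simp at hab
  exact ⟨_, swapVec_mem_eig hq hv hne (by omega) rfl, fun h0 =>
    hv0 (eq_zero_of_swapVec_eq_zero hq (by omega) (by omega) hab h0)⟩

lemma NZ.ne (hq : 0 < q) {s r : List ℤ} {a b : ℤ} (h : NZ q n (s ++ b :: a :: r))
    (hn : s.length + r.length + 2 ≤ n) : a ≠ b := by
  obtain ⟨v, hv, hv0⟩ := h
  obtain ⟨h1, h2⟩ := eig_consecutive hv rfl
  exact fun hab => hv0 (eq_zero_of_content_eq hq (by omega) (by omega) h1 h2 hab)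

/-- Contents `a, a ± 1, a` in a row are impossible: `T_i` and `T_{i+1}` would act by the scalars `q`
and `-1`, which violates the braid relation. -/
lemma NZ.not_braid (hq : 0 < q) {s r : List ℤ} {a b : ℤ} (h : NZ q n (s ++ a :: b :: a :: r))
    (hn : s.length + r.length + 3 ≤ n) (hab : a = b + 1 ∨ b = a + 1) : False := by
  obtain ⟨v, hv, hv0⟩ := h
  obtain ⟨h1, h2⟩ := eig_consecutive (s := s) (r := a :: r) hv rfl
  obtain ⟨h3, h4⟩ := eig_consecutive (s := s ++ [a]) (r := r) (by simpa using hv) rfl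
  simp only [List.length_cons, zero_add] at h1 h2 h3 h4
  have e := (isHecke q n).braid (r.length + 1) (by omega)
  have e' := congrArg (v ◃ ·) e
  simp only [act_mul] at e'
  have hq2 : q * q + q ≠ 0 := by positivity
  apply hv0
  rcases hab with hab | hab
  · have h5 := act_T_of_content_pred hq (by omega) (by omega) h3 h4 hab
    have h6 := act_T_of_content_succ hq (by omega) (by omega) h1 h2 hab
    rw [h5, ← neg_one_smul K v] at e'
    simp only [smul_act, h5, h6] at e'
    rw [← neg_one_smul K v] at e'
    simp only [smul_smul, smul_act, h6] at e'
    rw [← sub_eq_zero, ← sub_smul] at e'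
    refine (smul_eq_zero.1 e').resolve_left ?_
    ring_nf
    intro h; apply hq2; linear_combination h
  · have h5 := act_T_of_content_succ hq (by omega) (by omega) h3 h4 hab
    have h6 := act_T_of_content_pred hq (by omega) (by omega) h1 h2 hab
    rw [h5, h6, ← neg_one_smul K v] at e'
    simp only [smul_act, h5, h6] at e'
    rw [← neg_one_smul K v] at e'
    simp only [smul_smul, smul_act, h5] at e'
    rw [← sub_eq_zero, ← sub_smul] at e'
    refine (smul_eq_zero.1 e').resolve_left ?_
    ring_nf
    intro h; apply hq2; linear_combination -h

/-- The last content of a list belongs to `J_1 = 0`. -/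
lemma NZ.last (hq : 0 < q) {s : List ℤ} {c : ℤ} (h : NZ q n (s ++ [c])) : c = 0 := by
  obtain ⟨v, hv, hv0⟩ := h
  rw [mem_eig_append, mem_eig_cons] at hv
  have h1 := hv.1.2
  have h0 : Jm q n 1 = 0 := (isHecke q n).jm_one
  simp only [List.length_nil, zero_add, h0, act_zero] at h1
  have := (smul_eq_zero.1 h1.symm).resolve_right hv0
  rw [← qInt_zero q] at this
  exact (qInt_strictMono hq).injective this

/-- A content moves past contents that are neither equal to it nor its neighbours. -/
lemma NZ.move (hq : 0 < q) {s u r : List ℤ} {c : ℤ} (h : NZ q n (s ++ c :: (u ++ r)))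
    (hu : ∀ y ∈ u, 2 ≤ |y - c|) (hn : s.length + u.length + r.length + 1 ≤ n) :
    NZ q n (s ++ (u ++ c :: r)) := by
  induction u generalizing s with
  | nil => exact h
  | cons y u ih =>
    simp only [List.length_cons] at hn
    have h1 := NZ.swap hq (s := s) (r := u ++ r) (a := y) (b := c) (by simpa using h)
      (hu y List.mem_cons_self) (by simp; omega)
    have := ih (s := s ++ [y]) (by simpa using h1) (fun z hz => hu z (List.mem_cons_of_mem _ hz))
      (by simp; omega)
    simpa using this

lemma NZ.move' (hq : 0 < q) {s u r : List ℤ} {c : ℤ} (h : NZ q n (s ++ (u ++ c :: r)))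
    (hu : ∀ y ∈ u, 2 ≤ |y - c|) (hn : s.length + u.length + r.length + 1 ≤ n) :
    NZ q n (s ++ c :: (u ++ r)) := by
  induction u generalizing s with
  | nil => exact h
  | cons y u ih =>
    simp only [List.length_cons] at hn
    have h1 := ih (s := s ++ [y]) (by simpa using h) (fun z hz => hu z (List.mem_cons_of_mem _ hz))
      (by simp; omega)
    have := NZ.swap hq (s := s) (r := u ++ r) (a := c) (b := y) (by simpa using h1)
      (by rw [abs_sub_comm]; exact hu y List.mem_cons_self) (by simp; omega)
    simpa using this

lemma exists_first_split {α : Type*} (p : α → Prop) (l : List α) (h : ∃ x ∈ l, p x) :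
    ∃ u x r, l = u ++ x :: r ∧ p x ∧ ∀ y ∈ u, ¬ p y := by
  classical
  induction l with
  | nil => simp at h
  | cons a l ih =>
    by_cases ha : p a
    · exact ⟨[], a, l, rfl, ha, by simp⟩
    · obtain ⟨x, hx, hpx⟩ := h
      rcases List.mem_cons.1 hx with rfl | hx
      · exact absurd hpx ha
      · obtain ⟨u, x, r, rfl, h1, h2⟩ := ih ⟨x, hx, hpx⟩
        refine ⟨a :: u, x, r, rfl, h1, ?_⟩
        intro y hy
        rcases List.mem_cons.1 hy with rfl | hy
        · exact ha
        · exact h2 y hy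

/-- The eigenvalues of the next Jucys--Murphy element on a joint eigenspace that belongs to a
standard filling are given by the contents of the cells that can be added. -/
theorem NZ.exists_addable (hq : 0 < q) {l : List (ℕ × ℕ)} (hl : Std l) {c : ℤ}
    (h : NZ q n (c :: l.map content)) (hn : l.length + 1 ≤ n) :
    ∃ b, content b = c ∧ Std (b :: l) := by
  classical
  by_cases hex : ∃ x ∈ l, content x = c
  -- Let `(i, j)` be the last cell on the diagonal of content `c`. The contents `c + 1` and `c - 1`
  -- can occur after it only through the cells `(i, j + 1)` and `(i + 1, j)`. If both occur, then
  -- `(i + 1, j + 1)` can be added. If only one occurs, then `c, c ± 1, c` can be made consecutive,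
  -- and if none occurs, then `c, c` can: both are impossible.
  · obtain ⟨l2, x, l1, rfl, hx, hl2⟩ := exists_first_split _ _ hex
    subst hx
    obtain ⟨hlp, hld⟩ := hl
    have hlp' := hlp
    rw [List.pairwise_append, List.pairwise_cons] at hlp
    obtain ⟨hp2, ⟨hpx, hp1⟩, hp21⟩ := hlp
    obtain ⟨i, j⟩ := x
    simp only [List.length_append, List.length_cons] at hn
    have hnot : ((i + 1, j + 1) : ℕ × ℕ) ∉ l2 ++ (i, j) :: l1 := by
      rw [List.mem_append, List.mem_cons]
      rintro (h | h | h)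
      · exact hl2 _ h (by simp [content])
      · simp at h
      · exact hpx _ h (by simp)
    have hup : ∀ y ∈ l2, content y = content (i, j) + 1 → y = (i, j + 1) := by
      rintro ⟨r, s⟩ hy hc
      simp only [content] at hc
      have h1 : ¬ (r, s) ≤ (i, j) := hp21 _ hy _ List.mem_cons_self
      have h2 : ¬ ((i + 1, j + 1) : ℕ × ℕ) ≤ (r, s) := fun h =>
        hnot (hld _ (List.mem_append_left _ hy) _ h)
      simp only [Prod.mk_le_mk, Prod.mk.injEq] at h1 h2 ⊢
      omega
    have hdn : ∀ y ∈ l2, content y = content (i, j) - 1 → y = (i + 1, j) := by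
      rintro ⟨r, s⟩ hy hc
      simp only [content] at hc
      have h1 : ¬ (r, s) ≤ (i, j) := hp21 _ hy _ List.mem_cons_self
      have h2 : ¬ ((i + 1, j + 1) : ℕ × ℕ) ≤ (r, s) := fun h =>
        hnot (hld _ (List.mem_append_left _ hy) _ h)
      simp only [Prod.mk_le_mk, Prod.mk.injEq] at h1 h2 ⊢
      omega
    -- exactly one neighbour of the last cell on the diagonal cannot follow it
    have one : ∀ y z : ℕ × ℕ, y ∈ l2 → z ∉ l2 → (content (i, j) = content y + 1 ∨
        content y = content (i, j) + 1) →
        (∀ w ∈ l2, 2 ≤ |content w - content (i, j)| ∨ w = y ∨ w = z) → False := by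
      intro y z hy hz hc hw
      obtain ⟨u, v, rfl⟩ := List.append_of_mem hy
      have hnd : (u ++ y :: v).Nodup := hp2.imp fun h e => h e.le
      rw [List.nodup_append, List.nodup_cons] at hnd
      have hu : ∀ w ∈ u.map content, 2 ≤ |w - content (i, j)| := by
        simp only [List.mem_map]
        rintro _ ⟨w, hwu, rfl⟩
        rcases hw w (List.mem_append_left _ hwu) with h | rfl | rfl
        · exact h
        · exact absurd rfl (hnd.2.2 _ hwu _ List.mem_cons_self)
        · exact absurd (List.mem_append_left _ hwu) hz
      have hv : ∀ w ∈ v.map content, 2 ≤ |w - content (i, j)| := by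
        simp only [List.mem_map]
        rintro _ ⟨w, hwv, rfl⟩
        rcases hw w (List.mem_append_right _ (List.mem_cons_of_mem _ hwv)) with h | rfl | rfl
        · exact h
        · exact absurd hwv hnd.2.1.1
        · exact absurd (List.mem_append_right _ (List.mem_cons_of_mem _ hwv)) hz
      simp only [List.length_append, List.length_cons] at hn
      have h1 := NZ.move hq (s := []) (u := u.map content) (by simpa using h) hu
        (by simp; omega)
      have h2 := NZ.move' hq (s := u.map content ++ [content (i, j), content y])
        (u := v.map content) (c := content (i, j)) (r := l1.map content) (by simpa using h1) hv
        (by simp; omega)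
      refine NZ.not_braid hq (s := u.map content) (r := v.map content ++ l1.map content)
        (a := content (i, j)) (b := content y) (by simpa using h2) (by simp; omega) hc
    have hall : ∀ w ∈ l2, 2 ≤ |content w - content (i, j)| ∨ w = (i, j + 1) ∨ w = (i + 1, j) := by
      intro w hw
      by_contra hcon
      push Not at hcon
      have h0 := hl2 w hw
      have h1 := mt (hup w hw) hcon.2.1
      have h2 := mt (hdn w hw) hcon.2.2
      have h3 := abs_lt.1 hcon.1
      omega
    by_cases hA : ((i, j + 1) : ℕ × ℕ) ∈ l2 <;> by_cases hB : ((i + 1, j) : ℕ × ℕ) ∈ l2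
    · refine ⟨(i + 1, j + 1), by simp [content], std_cons.2 ⟨⟨hlp', hld⟩, hnot, ?_⟩⟩
      rintro ⟨r, s⟩ hy
      have h1 := hy.le
      have h2 := hy.ne
      simp only [Prod.mk_le_mk, ne_eq, Prod.mk.injEq] at h1 h2
      by_cases hr : r ≤ i
      · exact hld _ (List.mem_append_left _ hA) _ (by simp; omega)
      · exact hld _ (List.mem_append_left _ hB) _ (by simp; omega)
    · exact (one _ _ hA hB (Or.inr (by simp [content]; ring)) hall).elim
    · exact (one _ _ hB hA (Or.inl (by simp [content]; ring))
        fun w hw => (hall w hw).imp id Or.symm).elim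
    · exfalso
      have hu : ∀ w ∈ l2.map content, 2 ≤ |w - content (i, j)| := by
        simp only [List.mem_map]
        rintro _ ⟨w, hwu, rfl⟩
        rcases hall w hwu with h | rfl | rfl
        · exact h
        · exact absurd hwu hA
        · exact absurd hwu hB
      have h1 := NZ.move hq (s := []) (u := l2.map content) (r := content (i, j) :: l1.map content)
        (by simpa using h) hu (by simp; omega)
      exact NZ.ne hq (s := l2.map content) (r := l1.map content) (by simpa using h1)
        (by simp; omega) rfl
  -- On an empty diagonal, only a cell in the first row or column can be added. If its predecessor is
  -- missing, then no content is close to `c`, which therefore can be moved to `J_1 = 0`.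
  · push Not at hex
    have far : (∀ w ∈ l, 2 ≤ |content w - c|) → c = 0 := by
      intro hw
      have h1 := NZ.move hq (s := []) (u := l.map content) (r := []) (c := c) (by simpa using h)
        (by simp only [List.mem_map]; rintro _ ⟨w, hwl, rfl⟩; exact hw w hwl) (by simp; omega)
      exact NZ.last hq (s := l.map content) (by simpa using h1)
    rcases lt_trichotomy c 0 with hc | rfl | hc
    · obtain ⟨k, rfl⟩ : ∃ k : ℕ, c = -((k : ℤ) + 1) := ⟨(-c - 1).toNat, by omega⟩
      by_cases hm : ((k, 0) : ℕ × ℕ) ∈ l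
      · refine ⟨(k + 1, 0), by simp [content], std_cons.2 ⟨hl, fun h => hex _ h (by simp [content]), ?_⟩⟩
        rintro ⟨r, s⟩ hy
        have h1 := hy.le
        have h2 := hy.ne
        simp only [Prod.mk_le_mk, ne_eq, Prod.mk.injEq] at h1 h2
        exact hl.2 _ hm _ (by simp; omega)
      · exfalso
        have hm' : ((k + 1, 0) : ℕ × ℕ) ∉ l := fun h => hex _ h (by simp [content])
        have := far fun ⟨r, s⟩ hw => by
          have h1 : ¬ ((k, 0) : ℕ × ℕ) ≤ (r, s) := fun h => hm (hl.2 _ hw _ h)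
          simp only [Prod.mk_le_mk] at h1
          simp only [content]
          rcases abs_cases ((s : ℤ) - r - -((k : ℤ) + 1)) with h | h <;> omega
        omega
    · by_cases hm : ((0, 0) : ℕ × ℕ) ∈ l
      · exact absurd (by simp [content]) (hex _ hm)
      · have hnil : l = [] := by
          rw [List.eq_nil_iff_forall_not_mem]
          exact fun x hx => hm (hl.2 x hx _ (by simp [Prod.le_def]))
        subst hnil
        refine ⟨(0, 0), by simp [content], std_cons.2 ⟨hl, by simp, ?_⟩⟩
        intro y hy
        exact absurd hy (by simp [Prod.lt_iff])
    · obtain ⟨k, rfl⟩ : ∃ k : ℕ, c = (k : ℤ) + 1 := ⟨(c - 1).toNat, by omega⟩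
      by_cases hm : ((0, k) : ℕ × ℕ) ∈ l
      · refine ⟨(0, k + 1), by simp [content], std_cons.2 ⟨hl, fun h => hex _ h (by simp [content]), ?_⟩⟩
        rintro ⟨r, s⟩ hy
        have h1 := hy.le
        have h2 := hy.ne
        simp only [Prod.mk_le_mk, ne_eq, Prod.mk.injEq] at h1 h2
        exact hl.2 _ hm _ (by simp; omega)
      · exfalso
        have := far fun ⟨r, s⟩ hw => by
          have h1 : ¬ ((0, k) : ℕ × ℕ) ≤ (r, s) := fun h => hm (hl.2 _ hw _ h)
          simp only [Prod.mk_le_mk] at h1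
          simp only [content]
          rcases abs_cases ((s : ℤ) - r - ((k : ℤ) + 1)) with h | h <;> omega
        omega

end Eigenspaces

/-! ### Seminormal projections and isotypic components -/

section Projections

set_option linter.unusedSectionVars false

variable {K : Type*} [Field K] {q : K} {n : ℕ}

variable (q n) in
/-- The seminormal projection `∏_k L_k(J_k)` for a list of cells, where `L_k` is the Lagrange
polynomial of the content of the cell that is added in the step `k`. -/
noncomputable def proj : List (ℕ × ℕ) → Hecke q n
  | [] => 1
  | b :: l => proj l * Polynomial.aeval (Jm q n (l.length + 1)) (lagr q n (content b))

lemma commute_aeval {A : Type*} [Ring A] [Algebra K A] {x y : A} (h : Commute x y)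
    (p : Polynomial K) : Commute x (Polynomial.aeval y p) := by
  induction p using Polynomial.induction_on' with
  | add p r hp hr => rw [map_add]; exact hp.add_right hr
  | monomial k a =>
    rw [Polynomial.aeval_monomial, ← Algebra.smul_def]
    exact (h.pow_right k).smul_right a

lemma commute_proj (hq : q ≠ 0) {l : List (ℕ × ℕ)} {m : ℕ} (hl : l.length ≤ n) (hm : m ≤ n) :
    Commute (Jm q n m) (proj q n l) := by
  induction l with
  | nil => exact Commute.one_right _
  | cons b l ih =>
    rw [List.length_cons] at hl
    exact (ih (by omega)).mul_right
      (commute_aeval ((isHecke q n).jm_commute_jm hq hm hl) _)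

/-- The generators beyond the length of the list commute with the projection. -/
lemma T_commute_proj {l : List (ℕ × ℕ)} {i : ℕ} (hl : l.length < i) (hin : i < n) :
    Commute (T q n i) (proj q n l) := by
  induction l with
  | nil => exact Commute.one_right _
  | cons b l ih =>
    rw [List.length_cons] at hl
    exact (ih (by omega)).mul_right
      (commute_aeval ((isHecke q n).t_commute_jm_of_lt hl hin) _)

variable [LinearOrder K] [IsStrictOrderedRing K]

lemma IsAdj.proj (hq : 0 < q) {l : List (ℕ × ℕ)} (hl : l.length ≤ n) :
    IsAdj (proj q n l) (proj q n l) := by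
  induction l with
  | nil => exact IsAdj.one
  | cons b l ih =>
    rw [List.length_cons] at hl
    have h := (ih (by omega)).mul ((IsAdj.jm (l.length + 1)).aeval (lagr q n (content b)))
    rwa [← (commute_aeval (commute_proj hq.ne' (l := l) (by omega) hl).symm
      (lagr q n (content b))).eq] at h

lemma act_proj_mem (hq : 0 < q) {l : List (ℕ × ℕ)} (hl : Std l) (hn : l.length ≤ n)
    (v : Words K n) : v ◃ proj q n l ∈ eig q n 0 (l.map content) := by
  induction l with
  | nil => simp
  | cons b l ih =>
    rw [List.length_cons] at hn
    rw [List.map_cons, mem_eig_cons, proj, act_mul]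
    refine ⟨act_mem_eig (ih hl.tail (by omega)) fun k _ hk => ?_, ?_⟩
    · rw [List.length_map, zero_add] at hk
      exact (commute_aeval ((isHecke q n).jm_commute_jm hq.ne' (hk.trans (by omega)) hn) _).symm
    · rw [List.length_map, zero_add]
      refine act_lagr_act (act_specPoly_self hq (by omega) hn _) ?_
      have := hl.abs_content_lt List.mem_cons_self
      rw [List.length_cons] at this
      omega

lemma eval_lagr (hq : 0 < q) {c d : ℤ} (hc : |c| < n) (hd : |d| < n) :
    (lagr q n c).eval (qInt q d) = if c = d then 1 else 0 := by
  rw [abs_lt] at hc hd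
  split_ifs with h
  · subst h
    exact Lagrange.eval_basis_self (qInt_strictMono hq).injective.injOn (Finset.mem_Ioo.2 hc)
  · exact Lagrange.eval_basis_of_ne h (Finset.mem_Ioo.2 hd)

lemma act_proj_of_mem (hq : 0 < q) {l : List (ℕ × ℕ)} (hl : Std l) (hn : l.length ≤ n)
    {v : Words K n} (hv : v ∈ eig q n 0 (l.map content)) : v ◃ proj q n l = v := by
  induction l with
  | nil => simp [proj]
  | cons b l ih =>
    have hb := hl.abs_content_lt List.mem_cons_self
    rw [List.length_cons] at hn hb
    rw [List.map_cons, mem_eig_cons, List.length_map, zero_add] at hv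
    rw [proj, act_mul, ih hl.tail (by omega) hv.1, act_aeval_of_eigen hv.2,
      eval_lagr hq (by omega) (by omega), if_pos rfl, one_smul]

lemma act_proj_of_mem_ne (hq : 0 < q) {l l' : List (ℕ × ℕ)} (hl : Std l) (hl' : Std l')
    (hn : l.length ≤ n) (hll : l'.length = l.length) (hne : l' ≠ l)
    {v : Words K n} (hv : v ∈ eig q n 0 (l'.map content)) : v ◃ proj q n l = 0 := by
  induction l generalizing l' with
  | nil => exact absurd (List.length_eq_zero_iff.1 hll) hne
  | cons b l ih =>
    obtain ⟨b', l', rfl⟩ := List.exists_cons_of_length_eq_add_one hll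
    have hb := hl.abs_content_lt List.mem_cons_self
    have hb' := hl'.abs_content_lt List.mem_cons_self
    rw [List.length_cons] at hn hb hb'
    rw [List.length_cons, List.length_cons, add_left_inj] at hll
    rw [List.map_cons, mem_eig_cons, List.length_map, zero_add, hll] at hv
    rw [proj, act_mul]
    by_cases h : l' = l
    · subst h
      rw [act_proj_of_mem hq hl'.tail (by omega) hv.1, act_aeval_of_eigen hv.2,
        eval_lagr hq (by omega) (by omega), if_neg, zero_smul]
      intro h
      exact hne (by rw [hl.cons_inj hl' h])
    · rw [ih hl.tail hl'.tail (by omega) hll h hv.1, zero_act]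

/-- The words are spanned by the joint eigenspaces of `J_1, …, J_m` that belong to the standard
fillings with `m` cells. -/
theorem eig_induction (hq : 0 < q) {m : ℕ} (hm : m ≤ n) {C : Words K n → Prop} (zero : C 0)
    (add : ∀ v u, C v → C u → C (v + u))
    (h : ∀ l, Std l → l.length = m → ∀ v ∈ eig q n 0 (l.map content), C v) (v : Words K n) :
    C v := by
  induction m generalizing v with
  | zero => exact h [] std_nil rfl v (by simp)
  | succ m ih =>
    refine ih (by omega) (fun l hl hlm v hv => ?_) v
    have hsum : ∀ s : Finset ℤ, ∀ f : ℤ → Words K n, (∀ c ∈ s, C (f c)) → C (∑ c ∈ s, f c) := by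
      intro s f hf
      induction s using Finset.induction_on with
      | empty => simpa using zero
      | insert c s hc ihs =>
        rw [Finset.sum_insert hc]
        exact add _ _ (hf c (by simp)) (ihs fun d hd => hf d (by simp [hd]))
    rw [← sum_act_lagr hq (h := Jm q n (m + 1)) (m := n) (by omega) v]
    refine hsum _ _ fun c hc => ?_
    have hc' : |c| < n := by rw [abs_lt]; exact Finset.mem_Ioo.1 hc
    have hmem : v ◃ Polynomial.aeval (Jm q n (m + 1)) (lagr q n c) ∈
        eig q n 0 (c :: l.map content) := by
      rw [mem_eig_cons, List.length_map, zero_add, hlm]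
      refine ⟨act_mem_eig hv fun k _ hk => ?_,
        act_lagr_act (act_specPoly_self hq (by omega) hm _) hc'⟩
      rw [List.length_map, zero_add, hlm] at hk
      exact (commute_aeval ((isHecke q n).jm_commute_jm hq.ne' (by omega) hm) _).symm
    by_cases h0 : v ◃ Polynomial.aeval (Jm q n (m + 1)) (lagr q n c) = 0
    · rw [h0]; exact zero
    · obtain ⟨b, rfl, hb⟩ := NZ.exists_addable hq hl ⟨_, hmem, h0⟩ (by omega)
      exact h (b :: l) hb (by simp [hlm]) _ (by simpa using hmem)

lemma act_eq_of_eig (hq : 0 < q) {m : ℕ} (hm : m ≤ n) {g h : Hecke q n}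
    (H : ∀ l, Std l → l.length = m → ∀ v ∈ eig q n 0 (l.map content), v ◃ g = v ◃ h)
    (v : Words K n) : v ◃ g = v ◃ h :=
  eig_induction hq hm (C := fun v => v ◃ g = v ◃ h) (by simp)
    (fun v u h1 h2 => by simp [h1, h2]) H v

lemma form_proj (hq : 0 < q) {l : List (ℕ × ℕ)} (hl : Std l) (hn : l.length ≤ n)
    (z : Words K n) {u : Words K n} (hu : u ∈ eig q n 0 (l.map content)) :
    form q z u = form q (z ◃ proj q n l) u := by
  rw [IsAdj.proj hq hn, act_proj_of_mem hq hl hn hu]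

lemma eq_zero_of_act_proj (hq : 0 < q) {m : ℕ} (hm : m ≤ n) {v : Words K n}
    (h : ∀ l, Std l → l.length = m → v ◃ proj q n l = 0) : v = 0 := by
  rw [← form_self_eq_zero hq]
  refine eig_induction hq hm (C := fun u => form q v u = 0) (by simp)
    (fun u w h1 h2 => by simp [h1, h2]) (fun l hl hlm u hu => ?_) v
  rw [form_proj hq hl (by omega) v hu, h l hl hlm]
  simp

/-- A generator acts on a seminormal vector by a scalar, up to a seminormal vector for the filling
with the two cells exchanged. -/
lemma exists_act_T (hq : 0 < q) {s r : List (ℕ × ℕ)} {x y : ℕ × ℕ} (h : Std (s ++ y :: x :: r))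
    (hn : s.length + r.length + 2 ≤ n) {v : Words K n}
    (hv : v ∈ eig q n 0 ((s ++ y :: x :: r).map content)) :
    ∃ (d : K) (w : Words K n), v ◃ T q n (r.length + 1) = d • v + w ∧
      (w = 0 ∨ Std (s ++ x :: y :: r) ∧ w ∈ eig q n 0 ((s ++ x :: y :: r).map content)) := by
  simp only [List.map_append, List.map_cons] at hv ⊢
  obtain ⟨h1, h2⟩ := eig_consecutive hv rfl
  simp only [List.length_map, zero_add] at h1 h2
  by_cases hxy : x ≤ y
  · rcases (Std.of_append h).adjacent hxy with e | e
    · exact ⟨-1, 0, by rw [act_T_of_content_pred hq (by omega) (by omega) h1 h2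
        (by rw [e]; simp only [content]; push_cast; ring)]; simp, Or.inl rfl⟩
    · exact ⟨q, 0, by rw [act_T_of_content_succ hq (by omega) (by omega) h1 h2
        (by rw [e]; simp only [content]; push_cast; ring)]; simp, Or.inl rfl⟩
  · have hyx : ¬ y ≤ x := (List.pairwise_cons.1 (Std.of_append h).1).1 x (by simp)
    have hne : content x ≠ content y := fun e => by
      have := two_le_abs_content_sub hyx hxy
      rw [e] at this; simp at this
    refine ⟨diagCoef q (content x) (content y), swapVec q (r.length + 1) (content x) (content y) v,
      by rw [swapVec]; abel, Or.inr ⟨h.swap hxy, ?_⟩⟩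
    exact swapVec_mem_eig hq hv hne (by simp; omega) (by simp)

/-- A list of length `m` has two consecutive entries number `i` and `i + 1`, counted from the
end. -/
lemma exists_split_two {α : Type*} {l : List α} {i : ℕ} (h : i + 2 ≤ l.length) :
    ∃ s y x r, l = s ++ y :: x :: r ∧ r.length = i := by
  have h1 : l.length - i - 2 + 1 < l.length := by omega
  refine ⟨l.take (l.length - i - 2), l[l.length - i - 2], l[l.length - i - 2 + 1],
    l.drop (l.length - i - 2 + 2), ?_, by simp; omega⟩
  rw [← List.drop_eq_getElem_cons h1, ← List.drop_eq_getElem_cons, List.take_append_drop]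

open Classical in
/-- All standard fillings of a set of cells. -/
noncomputable def stdLists (μ : Finset (ℕ × ℕ)) : Finset (List (ℕ × ℕ)) :=
  μ.toList.permutations.toFinset.filter Std

lemma mem_stdLists {μ : Finset (ℕ × ℕ)} {l : List (ℕ × ℕ)} :
    l ∈ stdLists μ ↔ Std l ∧ l.toFinset = μ := by
  classical
  rw [stdLists, Finset.mem_filter, List.mem_toFinset, List.mem_permutations, and_comm]
  refine and_congr_right fun hl => ⟨fun h => ?_, fun h => ?_⟩
  · ext x
    rw [List.mem_toFinset, h.mem_iff, Finset.mem_toList]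
  · subst h
    exact (List.toFinset_toList hl.nodup).symm

lemma length_of_mem_stdLists {μ : Finset (ℕ × ℕ)} {l : List (ℕ × ℕ)} (h : l ∈ stdLists μ) :
    l.length = μ.card := by
  rw [mem_stdLists] at h
  rw [← h.2, h.1.card_toFinset]

variable (q n) in
/-- The isotypic projection for a set of cells: the sum of the seminormal projections over its
standard fillings. -/
noncomputable def shapeProj (μ : Finset (ℕ × ℕ)) : Hecke q n := ∑ l ∈ stdLists μ, proj q n l

lemma act_shapeProj_of_mem (hq : 0 < q) {μ : Finset (ℕ × ℕ)} (hn : μ.card ≤ n)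
    {l : List (ℕ × ℕ)} (hl : Std l) (hlm : l.length = μ.card) {v : Words K n}
    (hv : v ∈ eig q n 0 (l.map content)) :
    v ◃ shapeProj q n μ = if l.toFinset = μ then v else 0 := by
  classical
  rw [shapeProj, act_sum]
  have : ∀ l' ∈ stdLists μ, v ◃ proj q n l' = if l = l' then v else 0 := by
    intro l' hl'
    have hlen := length_of_mem_stdLists hl'
    split_ifs with h
    · subst h; exact act_proj_of_mem hq hl (by omega) hv
    · exact act_proj_of_mem_ne hq (mem_stdLists.1 hl').1 hl (by omega) (by omega) h hv
  rw [Finset.sum_congr rfl this, Finset.sum_ite_eq]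
  simp [mem_stdLists, hl]

lemma act_shapeProj_comm (hq : 0 < q) {μ : Finset (ℕ × ℕ)} (hn : μ.card ≤ n) {i : ℕ} (hi : 1 ≤ i)
    (him : i < μ.card) (v : Words K n) :
    v ◃ T q n i ◃ shapeProj q n μ = v ◃ shapeProj q n μ ◃ T q n i := by
  rw [← act_mul, ← act_mul]
  refine act_eq_of_eig hq hn (fun l hl hlm v hv => ?_) v
  obtain ⟨s, y, x, r, rfl, hr⟩ := exists_split_two (l := l) (i := i - 1) (by omega)
  simp only [List.length_append, List.length_cons] at hlm
  obtain ⟨d, w, h1, h2⟩ := exists_act_T hq hl (by omega) hv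
  rw [show r.length + 1 = i by omega] at h1
  have hset : (s ++ x :: y :: r).toFinset = (s ++ y :: x :: r).toFinset := by
    ext a; simp only [List.mem_toFinset, List.mem_append, List.mem_cons]; tauto
  have h3 : w ◃ shapeProj q n μ = if (s ++ y :: x :: r).toFinset = μ then w else 0 := by
    rcases h2 with rfl | ⟨h2, h4⟩
    · simp
    · rw [act_shapeProj_of_mem hq hn h2 (by simp; omega) h4, hset]
  rw [act_mul, act_mul, h1, add_act, smul_act, h3,
    act_shapeProj_of_mem hq hn hl (by simp; omega) hv]
  split_ifs
  · rw [h1]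
  · simp

lemma act_shapeProj_idem (hq : 0 < q) {μ : Finset (ℕ × ℕ)} (hn : μ.card ≤ n) (v : Words K n) :
    v ◃ shapeProj q n μ ◃ shapeProj q n μ = v ◃ shapeProj q n μ := by
  rw [← act_mul]
  refine act_eq_of_eig hq hn (fun l hl hlm v hv => ?_) v
  have := act_shapeProj_of_mem hq hn hl hlm hv
  rw [act_mul, this]
  split_ifs with h
  · rw [this, if_pos h]
  · simp

lemma act_shapeProj_ne (hq : 0 < q) {μ ν : Finset (ℕ × ℕ)} (hn : μ.card ≤ n)
    (hc : ν.card = μ.card) (hne : μ ≠ ν) (v : Words K n) :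
    v ◃ shapeProj q n μ ◃ shapeProj q n ν = 0 := by
  rw [← act_mul, ← act_zero (q := q) v]
  refine act_eq_of_eig hq hn (fun l hl hlm v hv => ?_) v
  rw [act_mul, act_shapeProj_of_mem hq hn hl hlm hv]
  split_ifs with h
  · rw [act_shapeProj_of_mem hq (by omega) hl (by omega) hv, if_neg (by rw [h]; exact hne), act_zero]
  · simp

lemma act_shapeProj_proj (hq : 0 < q) {l : List (ℕ × ℕ)} (hl : Std l) (hn : l.length ≤ n)
    (v : Words K n) : v ◃ shapeProj q n l.toFinset ◃ proj q n l = v ◃ proj q n l := by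
  rw [← act_mul]
  refine act_eq_of_eig hq hn (fun l' hl' hlm v hv => ?_) v
  rw [act_mul, act_shapeProj_of_mem hq (by rwa [hl.card_toFinset]) hl'
    (by rw [hl.card_toFinset, hlm]) hv]
  split_ifs with h
  · rfl
  · rw [zero_act, act_proj_of_mem_ne hq hl hl' hn hlm (by rintro rfl; exact h rfl) hv]

/-- A finite collection of sets of cells that contains all Young diagrams with `m` cells. -/
def shapes (m : ℕ) : Finset (Finset (ℕ × ℕ)) :=
  (Finset.range m ×ˢ Finset.range m).powersetCard m

lemma Std.toFinset_mem_shapes {l : List (ℕ × ℕ)} (hl : Std l) : l.toFinset ∈ shapes l.length := by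
  rw [shapes, Finset.mem_powersetCard, hl.card_toFinset]
  refine ⟨fun x hx => ?_, rfl⟩
  rw [List.mem_toFinset] at hx
  have h1 := hl.abs_content_lt (hl.2 x hx (x.1, 0) (Prod.le_def.2 ⟨le_rfl, Nat.zero_le _⟩))
  have h2 := hl.abs_content_lt (hl.2 x hx (0, x.2) (Prod.le_def.2 ⟨Nat.zero_le _, le_rfl⟩))
  simp only [content] at h1 h2
  rw [abs_lt] at h1 h2
  rw [Finset.mem_product, Finset.mem_range, Finset.mem_range]
  push_cast at h1 h2
  omega

lemma sum_act_shapeProj (hq : 0 < q) {m : ℕ} (hm : m ≤ n) (v : Words K n) :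
    ∑ μ ∈ shapes m, v ◃ shapeProj q n μ = v := by
  rw [← act_sum]
  nth_rewrite 2 [← act_one (q := q) v]
  refine act_eq_of_eig hq hm (fun l hl hlm v hv => ?_) v
  rw [act_sum, act_one]
  have : ∀ μ ∈ shapes m, v ◃ shapeProj q n μ = if l.toFinset = μ then v else 0 := by
    intro μ hμ
    have hc := (Finset.mem_powersetCard.1 hμ).2
    exact act_shapeProj_of_mem hq (by omega) hl (by omega) hv
  rw [Finset.sum_congr rfl this, Finset.sum_ite_eq, if_pos]
  rw [← hlm]
  exact hl.toFinset_mem_shapes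

lemma exists_act_proj_ne_zero {μ : Finset (ℕ × ℕ)} {v : Words K n} (h : v ◃ shapeProj q n μ ≠ 0) :
    ∃ l ∈ stdLists μ, v ◃ proj q n l ≠ 0 := by
  rw [shapeProj, act_sum] at h
  exact Finset.exists_ne_zero_of_sum_ne_zero h

end Projections

/-! ### Vectors on which some generators act by a scalar -/

section Transport

set_option linter.unusedSectionVars false

variable {K : Type*} [Field K] {q : K} {n : ℕ} [LinearOrder K] [IsStrictOrderedRing K]

lemma Adm.std {s s' : List (ℕ × ℕ)} (h : Adm s s') {t r : List (ℕ × ℕ)}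
    (hs : Std (t ++ (s ++ r))) : Std (t ++ (s' ++ r)) := by
  induction h with
  | refl => exact hs
  | swap s l x y hxy =>
    have h1 : Std ((t ++ s) ++ x :: y :: (l ++ r)) := by simpa using hs
    have : ¬ y ≤ x := fun hyx => by
      rcases (Std.of_append h1).adjacent hyx with e | e <;> rw [e] at hxy <;>
        simp [content] at hxy
    simpa using h1.swap this
  | trans _ _ h1 h2 => exact h2 (h1 hs)

/-- If `T_i` acts on `z` by `q` or `-1`, then the components of `z` for two fillings that differ by
an admissible exchange in the step `i` vanish simultaneously. -/
lemma act_proj_swap (hq : 0 < q) {ε : K} (hε : ε = q ∨ ε = -1) {s r : List (ℕ × ℕ)} {x y : ℕ × ℕ}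
    (h : Std (s ++ y :: x :: r)) (hxy : 2 ≤ |content x - content y|)
    (hn : s.length + r.length + 2 ≤ n) {z : Words K n} (hz : z ◃ T q n (r.length + 1) = ε • z)
    (h' : Std (s ++ x :: y :: r)) (h0 : z ◃ proj q n (s ++ x :: y :: r) = 0) :
    z ◃ proj q n (s ++ y :: x :: r) = 0 := by
  have hlen : (s ++ y :: x :: r).length ≤ n := by simp; omega
  have hv := act_proj_mem hq h hlen z
  have e1 := form_proj hq h hlen z hv
  set v := z ◃ proj q n (s ++ y :: x :: r)
  have hne : content x ≠ content y := fun e => by rw [e] at hxy; simp at hxy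
  have hv' : swapVec q (r.length + 1) (content x) (content y) v ∈
      eig q n 0 ((s ++ x :: y :: r).map content) := by
    simp only [List.map_append, List.map_cons] at hv ⊢
    exact swapVec_mem_eig hq hv hne (by simp; omega) (by simp)
  have e2 := form_proj hq h' (by simp; omega) z hv'
  rw [h0, map_zero, LinearMap.zero_apply, swapVec, map_sub, map_smul, ← IsAdj.T, hz, map_smul,
    LinearMap.smul_apply, ← sub_smul, e1, smul_eq_mul] at e2
  obtain ⟨h1, h2⟩ := diagCoef_ne hq hxy
  refine (form_self_eq_zero hq).1 ((mul_eq_zero.1 e2).resolve_left ?_)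
  rcases hε with rfl | rfl
  · exact h1
  · intro h; apply h2; linear_combination -h

lemma act_proj_adm (hq : 0 < q) {ε : K} (hε : ε = q ∨ ε = -1) {s s' : List (ℕ × ℕ)}
    (hs : Adm s s') {t r : List (ℕ × ℕ)} (h : Std (t ++ (s ++ r)))
    (hn : t.length + s.length + r.length ≤ n) {z : Words K n}
    (hz : ∀ i, r.length < i → i < r.length + s.length → z ◃ T q n i = ε • z)
    (h0 : z ◃ proj q n (t ++ (s' ++ r)) = 0) : z ◃ proj q n (t ++ (s ++ r)) = 0 := by
  induction hs with
  | refl => exact h0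
  | swap s l x y hxy =>
    simp only [List.length_append, List.length_cons] at hn hz
    have h1 : Std ((t ++ s) ++ x :: y :: (l ++ r)) := by simpa using h
    have h2 : Std ((t ++ s) ++ y :: x :: (l ++ r)) := by
      simpa using (Adm.swap s l x y hxy).std h
    have := act_proj_swap hq hε h1 (by rwa [abs_sub_comm]) (by simp; omega)
      (hz _ (by simp) (by simp; omega)) h2 (by simpa using h0)
    simpa using this
  | trans h1 h2 ih1 ih2 =>
    have hl := h1.perm.length_eq
    exact ih1 h hn hz (ih2 (h1.std h) (by omega) (by rwa [← hl]) h0)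

/-- If the generators on a segment act on `z` by `q` (by `-1`), then the component of `z` for a
filling that has two cells of one column (of one row) in this segment vanishes. -/
theorem act_proj_eq_zero_of_covby (hq : 0 < q) {t s r : List (ℕ × ℕ)} {x x' : ℕ × ℕ}
    (h : Std (t ++ x' :: (s ++ x :: r))) {ε : K}
    (hx : ε = q ∧ x' = (x.1 + 1, x.2) ∨ ε = -1 ∧ x' = (x.1, x.2 + 1))
    (hn : t.length + s.length + r.length + 2 ≤ n) {z : Words K n}
    (hz : ∀ i, r.length < i → i < r.length + s.length + 2 → z ◃ T q n i = ε • z) :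
    z ◃ proj q n (t ++ x' :: (s ++ x :: r)) = 0 := by
  have hcov : x ⋖ x' := by
    rcases hx with ⟨-, rfl⟩ | ⟨-, rfl⟩
    · exact Prod.mk_covBy_mk_iff_left.2 (Nat.covBy_iff_add_one_eq.2 rfl)
    · exact Prod.mk_covBy_mk_iff_right.2 (Nat.covBy_iff_add_one_eq.2 rfl)
  obtain ⟨A, B, h1, h2⟩ := Std.make_adjacent hcov (Std.of_append h)
  have hlen := h2.length_eq
  simp only [List.length_append, List.length_cons, List.length_nil] at hlen
  have h3 : Std ((x' :: (s ++ [x])) ++ r) := by simpa using Std.of_append h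
  have hadm : Adm (x' :: (s ++ [x])) (B ++ x' :: x :: A) := Std.adm h3 (by simpa using h1) h2
  have hst : Std (t ++ ((x' :: (s ++ [x])) ++ r)) := by simpa using h
  have hst' : Std ((t ++ B) ++ x' :: x :: (A ++ r)) := by simpa using hadm.std hst
  have key : z ◃ proj q n ((t ++ B) ++ x' :: x :: (A ++ r)) = 0 := by
    have hl : ((t ++ B) ++ x' :: x :: (A ++ r)).length ≤ n := by simp; omega
    have hv := act_proj_mem hq hst' hl z
    have e1 := form_proj hq hst' hl z hv
    set v := z ◃ proj q n ((t ++ B) ++ x' :: x :: (A ++ r))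
    simp only [List.map_append, List.map_cons] at hv
    obtain ⟨h4, h5⟩ := eig_consecutive (r := A.map content ++ r.map content) hv rfl
    simp only [List.length_map, zero_add, List.length_append] at h4 h5
    have hzi := hz (A.length + r.length + 1) (by omega) (by omega)
    have e2 : form q (z ◃ T q n (A.length + r.length + 1)) v = ε * form q v v := by
      rw [hzi, map_smul, LinearMap.smul_apply, e1, smul_eq_mul]
    rw [IsAdj.T] at e2
    refine (form_self_eq_zero hq).1 ?_
    rcases hx with ⟨rfl, rfl⟩ | ⟨rfl, rfl⟩
    · rw [act_T_of_content_pred hq (by omega) (by omega) h4 h5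
        (by simp only [content]; push_cast; ring), map_neg, e1] at e2
      have : (ε + 1) * form ε v v = 0 := by linear_combination -e2
      exact (mul_eq_zero.1 this).resolve_left (by positivity)
    · rw [act_T_of_content_succ hq (by omega) (by omega) h4 h5
        (by simp only [content]; push_cast; ring), map_smul, e1, smul_eq_mul] at e2
      have : (q + 1) * form q v v = 0 := by linear_combination e2
      exact (mul_eq_zero.1 this).resolve_left (by positivity)
  have hε : ε = q ∨ ε = -1 := hx.imp And.left And.left
  have := act_proj_adm hq hε hadm hst (by simp; omega)
    (fun i hi hi' => hz i hi (by simp at hi'; omega)) (by simpa using key)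
  simpa using this

end Transport

/-! ### Dominance for words and shapes -/

section Dominance

set_option linter.unusedSectionVars false

variable {K : Type*} [Field K] {q : K} {n : ℕ}

lemma single_act_T_of_lt {y : Fin n → ℕ} {a b : Fin n} (hab : b.1 = a.1 + 1) (h : y a < y b) :
    Finsupp.single y (1 : K) ◃ T q n b.1 = Finsupp.single (y ∘ Equiv.swap a b) 1 := by
  rw [act_T _ ⟨by omega, b.2⟩, genOp]
  have ha : (⟨b.1 - 1, by omega⟩ : Fin n) = a := Fin.ext (by simp; omega)
  rw [ha, swapOp_single, if_neg h.ne, if_pos h]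

lemma single_act_T_of_eq {y : Fin n → ℕ} {a b : Fin n} (hab : b.1 = a.1 + 1) (h : y a = y b) :
    Finsupp.single y (1 : K) ◃ T q n b.1 = q • Finsupp.single y 1 := by
  rw [act_T _ ⟨by omega, b.2⟩, genOp]
  have ha : (⟨b.1 - 1, by omega⟩ : Fin n) = a := Fin.ext (by simp; omega)
  rw [ha, swapOp_single, if_pos h]

lemma single_act_T_of_gt {y : Fin n → ℕ} {a b : Fin n} (hab : b.1 = a.1 + 1) (h : y b < y a) :
    Finsupp.single y (1 : K) ◃ T q n b.1 = q • Finsupp.single (y ∘ Equiv.swap a b) 1 +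
      (q - 1) • Finsupp.single y 1 := by
  rw [act_T _ ⟨by omega, b.2⟩, genOp]
  have ha : (⟨b.1 - 1, by omega⟩ : Fin n) = a := Fin.ext (by simp; omega)
  rw [ha, swapOp_single, if_neg h.ne', if_neg h.not_gt]

/-- Induction over the Hecke algebra from its generators. -/
lemma hecke_induction {C : Hecke q n → Prop} (one : C 1) (T : ∀ i, 1 ≤ i → i < n → C (T q n i))
    (smul : ∀ (c : K) h, C h → C (c • h)) (add : ∀ g h, C g → C h → C (g + h))
    (mul : ∀ g h, C g → C h → C (g * h)) (h : Hecke q n) : C h := by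
  obtain ⟨f, rfl⟩ := RingQuot.mkAlgHom_surjective K (HeckeRel q n) h
  induction f using FreeAlgebra.induction with
  | grade0 r =>
    rw [AlgHom.commutes, Algebra.algebraMap_eq_smul_one]
    exact smul r 1 one
  | grade1 i =>
    have := T i.1 i.2.1 i.2.2
    rwa [T_of_lt q n i.2] at this
  | mul a b ha hb => rw [map_mul]; exact mul _ _ ha hb
  | add a b ha hb => rw [map_add]; exact add _ _ ha hb

variable [LinearOrder K] [IsStrictOrderedRing K]

lemma exists_split_one {α : Type*} {l : List α} {k : ℕ} (h : k < l.length) :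
    ∃ t r, l = t ++ l[l.length - 1 - k] :: r ∧ r.length = k :=
  ⟨l.take (l.length - 1 - k), l.drop (l.length - 1 - k + 1),
    by rw [← List.drop_eq_getElem_cons, List.take_append_drop], by simp; omega⟩

/-- If the generators within each block of a decomposition of the positions into intervals act on
`z` by `q` (by `-1`), then the cells of one block in a filling that contributes to `z` lie in
different columns (rows). So the row (column) of a cell is at most the number of its block. -/
theorem coord_le (hq : 0 < q) {ε : K} {g : ℕ × ℕ → ℕ}
    (hg : ε = q ∧ g = Prod.fst ∨ ε = -1 ∧ g = Prod.snd) {l : List (ℕ × ℕ)} (hl : Std l)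
    (hn : l.length ≤ n) {f : ℕ → ℕ} (hf : ∀ k k', k ≤ k' → k' < l.length → f k ≤ f k')
    {z : Words K n} (hz : ∀ i, 1 ≤ i → i < l.length → f (i - 1) = f i → z ◃ T q n i = ε • z)
    (hzl : z ◃ proj q n l ≠ 0) {t r : List (ℕ × ℕ)} {x : ℕ × ℕ} (h : l = t ++ x :: r) :
    g x ≤ f r.length := by
  induction hd : g x generalizing t x r with
  | zero => exact Nat.zero_le _
  | succ d ih =>
    obtain ⟨x₀, hlt, hgx, hx⟩ : ∃ x₀ : ℕ × ℕ, x₀ < x ∧ g x₀ = d ∧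
        (ε = q ∧ x = (x₀.1 + 1, x₀.2) ∨ ε = -1 ∧ x = (x₀.1, x₀.2 + 1)) := by
      obtain ⟨a, b⟩ := x
      rcases hg with ⟨h1, rfl⟩ | ⟨h1, rfl⟩
      · simp only at hd
        subst hd
        exact ⟨(d, b), Prod.mk_lt_mk_iff_left.2 (Nat.lt_succ_self d), rfl, Or.inl ⟨h1, rfl⟩⟩
      · simp only at hd
        subst hd
        exact ⟨(a, d), Prod.mk_lt_mk_iff_right.2 (Nat.lt_succ_self d), rfl, Or.inr ⟨h1, rfl⟩⟩
    have hxr : Std (x :: r) := Std.of_append (h ▸ hl)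
    obtain ⟨s, r₀, rfl⟩ := List.append_of_mem ((std_cons.1 hxr).2.2 x₀ hlt)
    have hlen : l.length = t.length + s.length + r₀.length + 2 := by rw [h]; simp; omega
    have h1 := ih (t := t ++ x :: s) (r := r₀) (x := x₀) (by rw [h]; simp) hgx
    have h2 : (s ++ x₀ :: r₀).length = s.length + r₀.length + 1 := by simp; omega
    rw [h2]
    have h3 := hf r₀.length (s.length + r₀.length + 1) (by omega) (by omega)
    by_contra hcon
    apply hzl
    rw [h]
    refine act_proj_eq_zero_of_covby hq (h ▸ hl) hx (by omega) fun i hi1 hi2 => ?_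
    refine hz i (by omega) (by omega) ?_
    have h4 := hf r₀.length (i - 1) (by omega) (by omega)
    have h5 := hf (i - 1) i (by omega) (by omega)
    have h6 := hf i (s.length + r₀.length + 1) (by omega) (by omega)
    omega

lemma card_filter_le_of_getElem {l : List (ℕ × ℕ)} (hl : l.Nodup)
    (p : Fin n → Prop) (p' : ℕ × ℕ → Prop) [DecidablePred p] [DecidablePred p']
    (h : ∀ k : Fin n, p k → ∃ hk : k.1 < l.length, p' (l[l.length - 1 - k.1])) :
    (Finset.univ.filter p).card ≤ (l.toFinset.filter p').card := by
  refine Finset.card_le_card_of_injOn (fun k => l.getD (l.length - 1 - k.1) (0, 0)) ?_ ?_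
  · intro k hk
    obtain ⟨h1, h2⟩ := h k (by simpa using hk)
    have h3 : l.length - 1 - k.1 < l.length := by omega
    simp only [Finset.coe_filter, Set.mem_ofPred_eq, List.mem_toFinset,
      List.getD_eq_getElem _ _ h3]
    exact ⟨List.getElem_mem _, h2⟩
  · intro k hk k' hk' e
    obtain ⟨h1, -⟩ := h k (by simpa using hk)
    obtain ⟨h1', -⟩ := h k' (by simpa using hk')
    have h3 : l.length - 1 - k.1 < l.length := by omega
    have h3' : l.length - 1 - k'.1 < l.length := by omega
    simp only [List.getD_eq_getElem _ _ h3, List.getD_eq_getElem _ _ h3'] at e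
    have := (hl.getElem_inj_iff).1 e
    exact Fin.ext (by omega)

/-- A word contributes to an isotypic component only if the shape dominates its content. -/
theorem dominance (hq : 0 < q) {μ : Finset (ℕ × ℕ)} (hn : μ.card ≤ n) {y : Fin n → ℕ}
    (hy : ∀ k : Fin n, k.1 < μ.card → 1 ≤ y k)
    (h : Finsupp.single y (1 : K) ◃ shapeProj q n μ ≠ 0) (r : ℕ) :
    (Finset.univ.filter fun k : Fin n => k.1 < μ.card ∧ y k ≤ r).card ≤
      (μ.filter fun x => x.1 < r).card := by
  induction hN : inv y using Nat.strong_induction_on generalizing y with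
  | _ N ih =>
  -- A descent is removed by an exchange of letters, which keeps the content. For a weakly increasing
  -- word, the letter at the position of a cell bounds the row of the cell.
  by_cases hdes : ∃ a b : Fin n, b.1 = a.1 + 1 ∧ b.1 < μ.card ∧ y b < y a
  · obtain ⟨a, b, hab, hbm, hyab⟩ := hdes
    set y' := y ∘ Equiv.swap a b with hy'
    have hyy : y' ∘ Equiv.swap a b = y := by funext k; simp [y']
    have hlt : y' a < y' b := by simpa [y'] using hyab
    have hinv := inv_swap hab hlt
    rw [hyy] at hinv
    have hmem : ∀ k : Fin n, k.1 < μ.card → (Equiv.swap a b k).1 < μ.card := by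
      intro k hk
      rw [Equiv.swap_apply_def]
      split_ifs <;> omega
    have e := single_act_T_of_lt (K := K) (q := q) hab hlt
    rw [hyy] at e
    have h' : Finsupp.single y' (1 : K) ◃ shapeProj q n μ ≠ 0 := by
      intro h0
      apply h
      rw [← e, act_shapeProj_comm hq hn (by omega) hbm, h0, zero_act]
    refine le_of_eq_of_le ?_ (ih (inv y') (by omega) (fun k hk => hy _ (hmem k hk)) h' rfl)
    refine Finset.card_bij' (fun k _ => Equiv.swap a b k) (fun k _ => Equiv.swap a b k) ?_ ?_ ?_ ?_
    · intro k hk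
      simp only [Finset.mem_filter, Finset.mem_univ, true_and] at hk ⊢
      exact ⟨hmem k hk.1, by simpa [y'] using hk.2⟩
    · intro k hk
      simp only [Finset.mem_filter, Finset.mem_univ, true_and] at hk ⊢
      exact ⟨hmem k hk.1, by simpa [y'] using hk.2⟩
    · intro k _; simp
    · intro k _; simp
  · push Not at hdes
    obtain ⟨l, hl, hzl⟩ := exists_act_proj_ne_zero h
    have hlen := length_of_mem_stdLists hl
    rw [mem_stdLists] at hl
    obtain ⟨hl, rfl⟩ := hl
    rw [← hlen] at hn hy hdes ⊢
    set f : ℕ → ℕ := fun k => if hk : k < n then y ⟨k, hk⟩ - 1 else 0 with hf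
    have hmono : ∀ k k', k ≤ k' → k' < l.length → f k ≤ f k' := by
      intro k k' hkk
      induction k', hkk using Nat.le_induction with
      | base => intro _; exact le_rfl
      | succ k' _ ihk =>
        intro hk
        refine (ihk (by omega)).trans ?_
        have := hdes ⟨k', by omega⟩ ⟨k' + 1, by omega⟩ rfl hk
        simp only [hf, dif_pos (show k' < n by omega), dif_pos (show k' + 1 < n by omega)]
        omega
    refine card_filter_le_of_getElem hl.nodup _ _ fun k hk => ⟨hk.1, ?_⟩
    obtain ⟨t, s, hts, hs⟩ := exists_split_one hk.1
    have := coord_le hq (Or.inl ⟨rfl, rfl⟩) hl hn hmono (fun i hi hil hfi => ?_) hzl hts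
    · rw [hs] at this
      have h1 := hy k hk.1
      simp only [hf, dif_pos k.2, Fin.eta] at this
      have h2 := hk.2
      omega
    · simp only [hf, dif_pos (show i - 1 < n by omega), dif_pos (show i < n by omega)] at hfi
      have h1 := hy ⟨i - 1, by omega⟩ (by simp; omega)
      have h2 := hy ⟨i, by omega⟩ hil
      exact single_act_T_of_eq (a := ⟨i - 1, by omega⟩) (b := ⟨i, by omega⟩) (by simp; omega)
        (by omega)

end Dominance

/-! ### Tableaux as lists of cells -/

section Tableaux

set_option linter.unusedSectionVars false

/-- The list of the cells of a tableau, in the decreasing order of their entries. -/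
def cellList {lam : YoungDiagram} (t : lam.cells ≃ Fin lam.card) : List (ℕ × ℕ) :=
  (List.ofFn fun m => (t.symm m).1).reverse

lemma length_cellList {lam : YoungDiagram} (t : lam.cells ≃ Fin lam.card) :
    (cellList t).length = lam.card := by simp [cellList]

lemma toFinset_cellList {lam : YoungDiagram} (t : lam.cells ≃ Fin lam.card) :
    (cellList t).toFinset = lam.cells := by
  ext x
  simp only [cellList, List.mem_toFinset, List.mem_reverse, List.mem_ofFn]
  exact ⟨fun ⟨m, hm⟩ => hm ▸ (t.symm m).2, fun hx => ⟨t ⟨x, hx⟩, by simp⟩⟩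

lemma std_cellList {lam : YoungDiagram} (t : lam.cells ≃ Fin lam.card) :
    Std (cellList t) ↔ IsStandard t := by
  have hmem : ∀ x, x ∈ cellList t ↔ x ∈ lam.cells := fun x => by
    rw [← toFinset_cellList t, List.mem_toFinset]
  have hp : (cellList t).Pairwise (fun x y => ¬ x ≤ y) ↔
      ∀ c d : lam.cells, t c < t d → ¬ d.1 ≤ c.1 := by
    rw [cellList, List.pairwise_reverse, List.pairwise_ofFn]
    exact ⟨fun h c d hcd => by simpa using h hcd, fun h i j hij => h _ _ (by simpa using hij)⟩
  rw [Std, hp]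
  constructor
  · rintro ⟨h, -⟩
    constructor
    · intro c d h1 h2
      by_contra hcon
      rcases eq_or_lt_of_le (not_lt.1 hcon) with e | e
      · rw [t.injective e] at h2; exact lt_irrefl _ h2
      · exact h d c e (Prod.le_def.2 ⟨h1.le, h2.le⟩)
    · intro c d h1 h2
      by_contra hcon
      rcases eq_or_lt_of_le (not_lt.1 hcon) with e | e
      · rw [t.injective e] at h2; exact lt_irrefl _ h2
      · exact h d c e (Prod.le_def.2 ⟨h2.le, h1.le⟩)
  · rintro ⟨h1, h2⟩
    refine ⟨fun c d hcd hdc => ?_, fun x hx y hyx => ?_⟩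
    · have hm : (d.1.1, c.1.2) ∈ lam.cells :=
        lam.isLowerSet (Prod.le_def.2 ⟨hdc.1, le_rfl⟩ : (d.1.1, c.1.2) ≤ c.1) c.2
      have e1 : t d ≤ t ⟨_, hm⟩ := by
        rcases eq_or_lt_of_le hdc.2 with e | e
        · exact le_of_eq (congrArg t (Subtype.ext (Prod.ext rfl e)))
        · exact (h1 d ⟨_, hm⟩ rfl e).le
      have e2 : t ⟨_, hm⟩ ≤ t c := by
        rcases eq_or_lt_of_le hdc.1 with e | e
        · exact le_of_eq (congrArg t (Subtype.ext (Prod.ext e rfl)))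
        · exact (h2 ⟨_, hm⟩ c rfl e).le
      exact absurd hcd (e1.trans e2).not_gt
    · rw [hmem] at hx ⊢
      exact lam.isLowerSet hyx hx

lemma cellList_injective (lam : YoungDiagram) :
    Function.Injective (cellList (lam := lam)) := by
  intro t t' h
  rw [cellList, cellList, List.reverse_inj] at h
  have h1 := List.ofFn_injective h
  have h2 : t.symm = t'.symm := Equiv.ext fun m => Subtype.ext (congrFun h1 m)
  rw [← t.symm_symm, h2, t'.symm_symm]

lemma exists_cellList {lam : YoungDiagram} {l : List (ℕ × ℕ)} (hl : l.Nodup)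
    (h : l.toFinset = lam.cells) : ∃ t : lam.cells ≃ Fin lam.card, cellList t = l := by
  classical
  have hlen : l.reverse.length = lam.card := by
    rw [List.length_reverse, YoungDiagram.card, ← h, List.toFinset_card_of_nodup hl]
  have hmem : ∀ x, x ∈ l.reverse ↔ x ∈ lam.cells := fun x => by
    rw [← h, List.mem_toFinset, List.mem_reverse]
  let e1 := List.Nodup.getEquiv l.reverse (List.nodup_reverse.2 hl)
  let e2 : {x // x ∈ l.reverse} ≃ lam.cells := Equiv.subtypeEquivRight hmem
  refine ⟨((finCongr hlen).symm.trans (e1.trans e2)).symm, ?_⟩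
  rw [cellList, List.reverse_eq_iff]
  refine List.ext_getElem (by simp [← hlen]) fun i h1 h2 => ?_
  simp [e1, e2]

variable {K : Type*} [Field K] {q : K}

lemma proj_reverse_ofFn (n : ℕ) {N : ℕ} (f : Fin N → ℕ × ℕ) :
    proj q n (List.ofFn f).reverse = (List.ofFn fun m : Fin N =>
      Polynomial.aeval (Jm q n (m.1 + 1)) (lagr q n (content (f m)))).prod := by
  induction N with
  | zero => simp [proj]
  | succ N ih =>
    rw [List.ofFn_succ', List.ofFn_succ', List.concat_eq_append, List.concat_eq_append,
      List.reverse_append, List.prod_append]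
    simp only [List.reverse_cons, List.reverse_nil, List.nil_append, List.cons_append, proj,
      List.prod_cons, List.prod_nil, mul_one, ih, List.length_reverse, List.length_ofFn]
    rfl

lemma youngIdempotent_eq (hq : q ≠ 0) {lam : YoungDiagram} (t : lam.cells ≃ Fin lam.card) :
    youngIdempotent q t = proj q lam.card (cellList t) := by
  rw [cellList, proj_reverse_ofFn, youngIdempotent]
  simp only [J_eq q _ hq]
  rfl

lemma isotypicProjector_eq (hq : q ≠ 0) (lam : YoungDiagram) :
    isotypicProjector q lam = shapeProj q lam.card lam.cells := by
  classical
  rw [isotypicProjector, shapeProj]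
  refine Finset.sum_bij (fun t _ => cellList t) ?_ ?_ ?_ ?_
  · intro t ht
    exact mem_stdLists.2 ⟨(std_cellList t).2 (Finset.mem_filter.1 ht).2, toFinset_cellList t⟩
  · intro t _ t' _ h
    exact cellList_injective lam h
  · intro l hl
    obtain ⟨h1, h2⟩ := mem_stdLists.1 hl
    obtain ⟨t, rfl⟩ := exists_cellList h1.nodup h2
    exact ⟨t, by simpa using (std_cellList t).1 h1, rfl⟩
  · intro t _
    exact youngIdempotent_eq hq t

/-- The word of a filling: the letters are the `1`-based numbers of the rows of its cells. -/
def rowWord (n : ℕ) (l : List (ℕ × ℕ)) : Fin n → ℕ :=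
  fun k => (l.getD (l.length - 1 - k.1) (0, 0)).1 + 1

variable (q) in
/-- The Young seminormal unit `word(t) p_t` of a filling. -/
noncomputable def unit (n : ℕ) (l : List (ℕ × ℕ)) : Words K n :=
  Finsupp.single (rowWord n l) 1 ◃ proj q n l

lemma rowWord_cellList {lam : YoungDiagram} (t : lam.cells ≃ Fin lam.card) :
    rowWord lam.card (cellList t) = tableauWord t := by
  funext k
  have hk : (cellList t).length - 1 - k.1 < (cellList t).length := by
    have := k.2; rw [length_cellList]; omega
  rw [rowWord, tableauWord, List.getD_eq_getElem _ _ hk]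
  simp only [cellList, List.getElem_reverse, List.getElem_ofFn]
  congr 4
  refine Fin.ext ?_
  have := k.2
  simp only [List.length_reverse, List.length_ofFn]
  omega

lemma specht_eq (hq : q ≠ 0) (lam : YoungDiagram) :
    specht q lam = Submodule.span K {v | ∃ l ∈ stdLists lam.cells, v = unit q lam.card l} := by
  rw [specht]
  congr 1
  ext v
  constructor
  · rintro ⟨t, ht, rfl⟩
    refine ⟨cellList t, mem_stdLists.2 ⟨(std_cellList t).2 ht, toFinset_cellList t⟩, ?_⟩
    rw [youngIdempotent_eq hq, unit, rowWord_cellList]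
    rfl
  · rintro ⟨l, hl, rfl⟩
    obtain ⟨h1, h2⟩ := mem_stdLists.1 hl
    obtain ⟨t, rfl⟩ := exists_cellList h1.nodup h2
    refine ⟨t, (std_cellList t).1 h1, ?_⟩
    rw [youngIdempotent_eq hq, unit, rowWord_cellList]
    rfl

end Tableaux

/-! ### Young seminormal units -/

section Units

set_option linter.unusedSectionVars false

variable {K : Type*} [Field K] {q : K} {n : ℕ}

lemma rowWord_apply {t r : List (ℕ × ℕ)} {x : ℕ × ℕ} (hr : r.length < n) :
    rowWord n (t ++ x :: r) ⟨r.length, hr⟩ = x.1 + 1 := by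
  have h : (t ++ x :: r).length - 1 - r.length = t.length := by simp
  rw [rowWord, h]
  simp

lemma rowWord_swap {s r : List (ℕ × ℕ)} {x y : ℕ × ℕ} (hn : (s ++ y :: x :: r).length = n)
    {a b : Fin n} (ha : a.1 = r.length) (hb : b.1 = r.length + 1) :
    rowWord n (s ++ y :: x :: r) ∘ Equiv.swap a b = rowWord n (s ++ x :: y :: r) := by
  have hn' : s.length + r.length + 2 = n := by rw [← hn]; simp; omega
  have hr : r.length < n := by omega
  have hr' : r.length + 1 < n := by omega
  obtain rfl : a = ⟨r.length, hr⟩ := Fin.ext ha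
  obtain rfl : b = ⟨r.length + 1, hr'⟩ := Fin.ext hb
  have ea : ∀ x y, rowWord n (s ++ y :: x :: r) ⟨r.length, by omega⟩ = x.1 + 1 := fun x y => by
    have := rowWord_apply (n := n) (t := s ++ [y]) (x := x) (r := r) (by omega)
    rw [← this]
    simp
  have eb : ∀ x y, rowWord n (s ++ y :: x :: r) ⟨r.length + 1, by omega⟩ = y.1 + 1 :=
    fun x y => rowWord_apply (n := n) (t := s) (x := y) (r := x :: r) (by simp; omega)
  funext k
  rw [Function.comp_apply, Equiv.swap_apply_def]
  split_ifs with h1 h2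
  · rw [h1, eb, ea]
  · rw [h2, ea, eb]
  · have hk1 : k.1 ≠ r.length := fun h => h1 (Fin.ext (by omega))
    have hk2 : k.1 ≠ r.length + 1 := fun h => h2 (Fin.ext (by omega))
    have hk := k.2
    have hl : (s ++ x :: y :: r).length = n := by simp; omega
    simp only [rowWord, hn, hl, add_left_inj]
    by_cases hks : n - 1 - k.1 < s.length
    · rw [List.getD_append _ _ _ _ hks, List.getD_append _ _ _ _ hks]
    · rw [List.getD_append_right _ _ _ _ (by omega), List.getD_append_right _ _ _ _ (by omega)]
      obtain ⟨d, hd⟩ : ∃ d, n - 1 - k.1 - s.length = d + 2 :=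
        ⟨n - 1 - k.1 - s.length - 2, by omega⟩
      rw [hd]
      rfl

lemma act_proj_append {t r : List (ℕ × ℕ)} {v : Words K n} (h : v ◃ proj q n r = 0) :
    v ◃ proj q n (t ++ r) = 0 := by
  induction t with
  | nil => exact h
  | cons b t ih => rw [List.cons_append, proj, act_mul, ih, zero_act]

lemma act_proj_append_congr {t r : List (ℕ × ℕ)} {v u : Words K n}
    (h : v ◃ proj q n r = u ◃ proj q n r) : v ◃ proj q n (t ++ r) = u ◃ proj q n (t ++ r) := by
  rw [← sub_eq_zero, ← sub_act] at h ⊢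
  exact act_proj_append h

variable [LinearOrder K] [IsStrictOrderedRing K]

/-- The word of a filling does not contribute to a filling whose first deviation is a cell in a
lower row. -/
lemma rowWord_act_proj_eq_zero (hq : 0 < q) {t r : List (ℕ × ℕ)} {x y : ℕ × ℕ}
    (hn : (t ++ x :: r).length = n) (hy : Std (y :: r)) (hxy : x.1 < y.1) (s : List (ℕ × ℕ)) :
    Finsupp.single (rowWord n (t ++ x :: r)) (1 : K) ◃ proj q n (s ++ y :: r) = 0 := by
  classical
  refine act_proj_append ?_
  by_contra h0
  have hn' : t.length + r.length + 1 = n := by rw [← hn]; simp; omega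
  set w := rowWord n (t ++ x :: r) with hw
  have hc := hy.card_toFinset
  rw [List.length_cons] at hc
  have h1 : Finsupp.single w (1 : K) ◃ shapeProj q n (y :: r).toFinset ≠ 0 := by
    intro h1
    apply h0
    rw [← act_shapeProj_proj hq hy (by simp; omega), h1, zero_act]
  have h2 := dominance hq (by omega) (fun k _ => by simp [hw, rowWord]) h1 (x.1 + 1)
  rw [hc] at h2
  have h3 : (y :: r).toFinset.filter (fun z => z.1 < x.1 + 1) =
      r.toFinset.filter (fun z => z.1 < x.1 + 1) := by
    ext z
    simp only [List.toFinset_cons, Finset.mem_filter, Finset.mem_insert]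
    constructor
    · rintro ⟨rfl | h, h'⟩
      · omega
      · exact ⟨h, h'⟩
    · rintro ⟨h, h'⟩
      exact ⟨Or.inr h, h'⟩
  have h4 : r.toFinset.filter (fun z => z.1 < x.1 + 1) ⊆
      (Finset.univ.filter fun k : Fin n => k.1 < r.length ∧ w k ≤ x.1 + 1).image
        (fun k => r.getD (r.length - 1 - k.1) (0, 0)) := by
    intro z hz
    rw [Finset.mem_filter, List.mem_toFinset] at hz
    obtain ⟨t₁, r₁, rfl⟩ := List.append_of_mem hz.1
    rw [List.length_append, List.length_cons] at hn'
    rw [Finset.mem_image]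
    refine ⟨⟨r₁.length, by omega⟩, ?_, ?_⟩
    · simp only [Finset.mem_filter, Finset.mem_univ, true_and]
      refine ⟨by simp; omega, ?_⟩
      have := rowWord_apply (n := n) (t := t ++ x :: t₁) (x := z) (r := r₁) (by omega)
      rw [List.append_assoc, List.cons_append] at this
      rw [hw, this]
      omega
    · have : (t₁ ++ z :: r₁).length - 1 - r₁.length = t₁.length := by simp
      simp only [this]
      simp
  have h5 := (Finset.card_le_card h4).trans Finset.card_image_le
  rw [h3] at h2
  have h6 := h2.trans h5
  refine absurd h6 (not_le.2 (Finset.card_lt_card ?_))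
  refine Finset.ssubset_iff_of_subset ?_ |>.2 ⟨⟨r.length, by omega⟩, ?_, ?_⟩
  · intro k hk
    simp only [Finset.mem_filter, Finset.mem_univ, true_and] at hk ⊢
    exact ⟨by omega, hk.2⟩
  · simp only [Finset.mem_filter, Finset.mem_univ, true_and]
    exact ⟨by omega, (rowWord_apply (by omega)).le⟩
  · simp

lemma form_eq_zero_of_eig (hq : 0 < q) {l l' : List (ℕ × ℕ)} (hl : Std l) (hl' : Std l')
    (hn : l.length ≤ n) (hll : l'.length = l.length) (hne : l' ≠ l) {v u : Words K n}
    (hv : v ∈ eig q n 0 (l.map content)) (hu : u ∈ eig q n 0 (l'.map content)) :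
    form q v u = 0 := by
  rw [form_comm, form_proj hq hl hn u hv, act_proj_of_mem_ne hq hl hl' hn hll hne hu]
  simp

lemma swap_ne {s r : List (ℕ × ℕ)} {x y : ℕ × ℕ} (h : Std (s ++ y :: x :: r)) :
    s ++ x :: y :: r ≠ s ++ y :: x :: r := by
  intro e
  rw [List.append_cancel_left_eq, List.cons.injEq] at e
  have h1 := (Std.of_append h).nodup
  rw [e.1] at h1
  simp at h1

lemma form_swapVec (i : ℕ) (a b : ℤ) (v u : Words K n) : form q (swapVec q i a b v) u =
    form q v (u ◃ T q n i) - diagCoef q a b * form q v u := by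
  rw [← IsAdj.T, swapVec, map_sub, LinearMap.sub_apply, map_smul, LinearMap.smul_apply,
    smul_eq_mul]

/-- If the component of `w` for a filling vanishes, then the corresponding component of `w T_i` is
obtained by exchange from a component of `w`. -/
lemma act_T_act_proj (hq : 0 < q) {s r : List (ℕ × ℕ)} {x y : ℕ × ℕ}
    (h : Std (s ++ y :: x :: r)) (hxy : ¬ x ≤ y) (hn : s.length + r.length + 2 ≤ n)
    {w : Words K n} (hw : w ◃ proj q n (s ++ x :: y :: r) = 0) :
    w ◃ T q n (r.length + 1) ◃ proj q n (s ++ x :: y :: r) =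
      swapVec q (r.length + 1) (content x) (content y) (w ◃ proj q n (s ++ y :: x :: r)) := by
  have h' := h.swap hxy
  have hyx : ¬ y ≤ x := (List.pairwise_cons.1 (Std.of_append h).1).1 x (by simp)
  have hne : content x ≠ content y := fun e => by
    have := two_le_abs_content_sub hyx hxy
    rw [e] at this; simp at this
  have hlen : (s ++ y :: x :: r).length ≤ n := by simp; omega
  have hlen' : (s ++ x :: y :: r).length ≤ n := by simp; omega
  have hll : (s ++ x :: y :: r).length = (s ++ y :: x :: r).length := by simp
  set i := r.length + 1 with hi
  set l := s ++ y :: x :: r with hl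
  set l' := s ++ x :: y :: r with hl'
  have hwl := act_proj_mem hq h hlen w
  have hsw : swapVec q i (content x) (content y) (w ◃ proj q n l) ∈
      eig q n 0 (l'.map content) := by
    simp only [hl, hl', List.map_append, List.map_cons] at hwl ⊢
    exact swapVec_mem_eig hq hwl hne (by simp; omega) (by simp [hi])
  have hmem : w ◃ T q n i ◃ proj q n l' - swapVec q i (content x) (content y) (w ◃ proj q n l) ∈
      eig q n 0 (l'.map content) :=
    Submodule.sub_mem _ (act_proj_mem hq h' hlen' _) hsw
  rw [← sub_eq_zero]
  set u := w ◃ T q n i ◃ proj q n l' - swapVec q i (content x) (content y) (w ◃ proj q n l)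
  have hu2 : swapVec q i (content y) (content x) u ∈ eig q n 0 (l.map content) := by
    have := hmem
    simp only [hl, hl', List.map_append, List.map_cons] at this ⊢
    exact swapVec_mem_eig hq this hne.symm (by simp; omega) (by simp [hi])
  have horth : form q (w ◃ proj q n l) u = 0 :=
    form_eq_zero_of_eig hq h h' hlen hll (swap_ne h) hwl hmem
  have e1 : form q (w ◃ T q n i ◃ proj q n l') u = form q w (u ◃ T q n i) := by
    rw [← form_proj hq h' hlen' _ hmem, IsAdj.T]
  have e2 : form q (swapVec q i (content x) (content y) (w ◃ proj q n l)) u =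
      form q (w ◃ proj q n l) (u ◃ T q n i) := by
    rw [form_swapVec, horth, mul_zero, sub_zero]
  have e3 : u ◃ T q n i = diagCoef q (content y) (content x) • u +
      swapVec q i (content y) (content x) u := by rw [swapVec]; abel
  have e4 : form q w u = 0 := by
    rw [form_proj hq h' hlen' w hmem, hw]; simp
  have e5 := form_proj hq h hlen w hu2
  refine (form_self_eq_zero hq).1 ?_
  have : form q u u = form q (w ◃ T q n i ◃ proj q n l') u -
      form q (swapVec q i (content x) (content y) (w ◃ proj q n l)) u := by
    rw [← LinearMap.sub_apply, ← map_sub]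
  rw [this, e1, e2, e3, map_add, map_add, map_smul, map_smul, e4, horth, e5, sub_self]

lemma unit_mem (hq : 0 < q) {l : List (ℕ × ℕ)} (hl : Std l) (hn : l.length ≤ n) :
    unit q n l ∈ eig q n 0 (l.map content) :=
  act_proj_mem hq hl hn _

/-- Exchanging two cells in a seminormal unit, the upper one being added first. -/
lemma unit_swap (hq : 0 < q) {s r : List (ℕ × ℕ)} {x y : ℕ × ℕ}
    (h : Std (s ++ y :: x :: r)) (hxy : ¬ x ≤ y) (hn : (s ++ y :: x :: r).length = n)
    (hrow : x.1 < y.1) : unit q n (s ++ x :: y :: r) =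
      swapVec q (r.length + 1) (content x) (content y) (unit q n (s ++ y :: x :: r)) := by
  have hn' : s.length + r.length + 2 = n := by rw [← hn]; simp; omega
  have h1 : Finsupp.single (rowWord n (s ++ y :: x :: r)) (1 : K) ◃
      proj q n (s ++ x :: y :: r) = 0 := by
    have := rowWord_act_proj_eq_zero (K := K) hq (t := s ++ [y]) (r := r) (x := x) (y := y)
      (n := n) (by simpa using hn) (Std.of_append (h.swap hxy)).tail hrow (s ++ [x])
    simpa using this
  simp only [unit]
  rw [← act_T_act_proj hq h hxy hn'.le h1]
  have hb : r.length + 1 < n := by omega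
  have e := single_act_T_of_lt (K := K) (q := q) (n := n) (y := rowWord n (s ++ y :: x :: r))
    (a := ⟨r.length, by omega⟩) (b := ⟨r.length + 1, hb⟩) rfl (by
      have e1 := rowWord_apply (n := n) (t := s ++ [y]) (x := x) (r := r) (by omega)
      have e2 := rowWord_apply (n := n) (t := s) (x := y) (r := x :: r) (by simp; omega)
      rw [List.append_assoc] at e1
      rw [List.singleton_append] at e1
      simp only [List.length_cons] at e2
      rw [e1, e2]
      omega)
  rw [e, rowWord_swap hn rfl rfl]

lemma fst_ne_of_incomparable {x y : ℕ × ℕ} (hxy : ¬ x ≤ y) (hyx : ¬ y ≤ x) : x.1 ≠ y.1 := by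
  rw [Prod.le_def] at hxy hyx
  omega

/-- The span of the seminormal units of one shape is stable under the generators. -/
lemma unit_act_T (hq : 0 < q) {μ : Finset (ℕ × ℕ)} (hn : μ.card = n) {l : List (ℕ × ℕ)}
    (hl : l ∈ stdLists μ) {i : ℕ} (hi : 1 ≤ i) (hin : i < n) :
    unit q n l ◃ T q n i ∈ Submodule.span K {v | ∃ l ∈ stdLists μ, v = unit q n l} := by
  have hlen := length_of_mem_stdLists hl
  obtain ⟨s, y, x, r, rfl, hr⟩ := exists_split_two (l := l) (i := i - 1) (by omega)
  rw [mem_stdLists] at hl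
  obtain ⟨hl, hμ⟩ := hl
  have hlen' : s.length + r.length + 2 = n := by
    rw [hn] at hlen; rw [← hlen]; simp; omega
  have hmem1 : unit q n (s ++ y :: x :: r) ∈
      Submodule.span K {v | ∃ l ∈ stdLists μ, v = unit q n l} :=
    Submodule.subset_span ⟨_, mem_stdLists.2 ⟨hl, hμ⟩, rfl⟩
  have hv := unit_mem hq hl (n := n) (by omega)
  obtain rfl : i = r.length + 1 := by omega
  by_cases hxy : x ≤ y
  · simp only [List.map_append, List.map_cons] at hv
    obtain ⟨h1, h2⟩ := eig_consecutive hv rfl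
    simp only [List.length_map, zero_add] at h1 h2
    rcases (Std.of_append hl).adjacent hxy with e | e
    · rw [act_T_of_content_pred hq (by omega) (by omega) h1 h2
        (by rw [e]; simp only [content]; push_cast; ring)]
      exact Submodule.neg_mem _ hmem1
    · rw [act_T_of_content_succ hq (by omega) (by omega) h1 h2
        (by rw [e]; simp only [content]; push_cast; ring)]
      exact Submodule.smul_mem _ _ hmem1
  · have hyx : ¬ y ≤ x := (List.pairwise_cons.1 (Std.of_append hl).1).1 x (by simp)
    have hl' := hl.swap hxy
    have hμ' : (s ++ x :: y :: r).toFinset = μ := by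
      rw [← hμ]
      ext a; simp only [List.mem_toFinset, List.mem_append, List.mem_cons]; tauto
    have hmem2 : unit q n (s ++ x :: y :: r) ∈
        Submodule.span K {v | ∃ l ∈ stdLists μ, v = unit q n l} :=
      Submodule.subset_span ⟨_, mem_stdLists.2 ⟨hl', hμ'⟩, rfl⟩
    rcases lt_or_gt_of_ne (fst_ne_of_incomparable hxy hyx) with hrow | hrow
    · have e := unit_swap hq hl hxy (n := n) (by simp; omega) hrow
      have : unit q n (s ++ y :: x :: r) ◃ T q n (r.length + 1) = unit q n (s ++ x :: y :: r) +
          diagCoef q (content x) (content y) • unit q n (s ++ y :: x :: r) := by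
        rw [e, swapVec]; abel
      rw [this]
      exact Submodule.add_mem _ hmem2 (Submodule.smul_mem _ _ hmem1)
    · have e := unit_swap hq hl' hyx (n := n) (by simp; omega) hrow
      rw [e, swapVec_act_T hi hin, ← e]
      exact Submodule.add_mem _ (Submodule.smul_mem _ _ hmem1) (Submodule.smul_mem _ _ hmem2)

lemma act_mem_of_stable {S : Submodule K (Words K n)}
    (hS : ∀ v ∈ S, ∀ i, 1 ≤ i → i < n → v ◃ T q n i ∈ S) (h : Hecke q n) :
    ∀ v ∈ S, v ◃ h ∈ S := by
  induction h using hecke_induction with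
  | one => intro v hv; simpa using hv
  | T i h1 h2 => exact fun v hv => hS v hv i h1 h2
  | smul c h ih => intro v hv; rw [act_smul]; exact S.smul_mem _ (ih v hv)
  | add g h ihg ihh => intro v hv; rw [act_add]; exact S.add_mem (ihg v hv) (ihh v hv)
  | mul g h ihg ihh => intro v hv; rw [act_mul]; exact ihh _ (ihg v hv)

lemma specht_act_T (hq : 0 < q) (lam : YoungDiagram) {v : Words K lam.card}
    (hv : v ∈ specht q lam) {i : ℕ} (hi : 1 ≤ i) (hin : i < lam.card) :
    v ◃ T q lam.card i ∈ specht q lam := by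
  rw [specht_eq hq.ne'] at hv ⊢
  induction hv using Submodule.span_induction with
  | mem v hv =>
    obtain ⟨l, hl, rfl⟩ := hv
    exact unit_act_T hq rfl hl hi hin
  | zero => simp
  | add v u _ _ h1 h2 => rw [add_act]; exact Submodule.add_mem _ h1 h2
  | smul c v _ h => rw [smul_act]; exact Submodule.smul_mem _ _ h

theorem specht_act (hq : 0 < q) (lam : YoungDiagram) (h : Hecke q lam.card) :
    ∀ v ∈ specht q lam, v ◃ h ∈ specht q lam :=
  act_mem_of_stable (fun _ hv _ hi hin => specht_act_T hq lam hv hi hin) h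

lemma unit_mem_specht (hq : 0 < q) {lam : YoungDiagram} {l : List (ℕ × ℕ)}
    (hl : l ∈ stdLists lam.cells) : unit q lam.card l ∈ specht q lam := by
  rw [specht_eq hq.ne']
  exact Submodule.subset_span ⟨l, hl, rfl⟩

lemma unit_act_proj (hq : 0 < q) {l l' : List (ℕ × ℕ)} (hl : Std l) (hl' : Std l')
    (hn : l.length ≤ n) (hll : l'.length = l.length) :
    unit q n l ◃ proj q n l' = if l = l' then unit q n l else 0 := by
  split_ifs with h
  · subst h; exact act_proj_of_mem hq hl hn (unit_mem hq hl hn)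
  · exact act_proj_of_mem_ne hq hl' hl (by omega) hll.symm h (unit_mem hq hl hn)

/-- Each seminormal projection maps the Specht module to a line. -/
lemma specht_act_proj (hq : 0 < q) {lam : YoungDiagram} {v : Words K lam.card}
    (hv : v ∈ specht q lam) {l : List (ℕ × ℕ)} (hl : Std l) (hn : l.length = lam.card) :
    (∃ c : K, v ◃ proj q lam.card l = c • unit q lam.card l) ∧
      (l.toFinset ≠ lam.cells → v ◃ proj q lam.card l = 0) := by
  rw [specht_eq hq.ne'] at hv
  induction hv using Submodule.span_induction with
  | mem v hv =>
    obtain ⟨l', hl', rfl⟩ := hv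
    have hlen := length_of_mem_stdLists hl'
    obtain ⟨h1, h2⟩ := mem_stdLists.1 hl'
    rw [unit_act_proj hq h1 hl (by rw [hlen]) (by rw [hlen, hn])]
    split_ifs with h
    · subst h
      exact ⟨⟨1, by simp⟩, fun h => absurd h2 h⟩
    · exact ⟨⟨0, by simp⟩, fun _ => rfl⟩
  | zero => exact ⟨⟨0, by simp⟩, fun _ => by simp⟩
  | add v u _ _ h1 h2 =>
    obtain ⟨⟨c, hc⟩, h1⟩ := h1
    obtain ⟨⟨d, hd⟩, h2⟩ := h2
    exact ⟨⟨c + d, by rw [add_act, hc, hd, add_smul]⟩,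
      fun h => by rw [add_act, h1 h, h2 h, add_zero]⟩
  | smul c v _ h =>
    obtain ⟨⟨d, hd⟩, h⟩ := h
    exact ⟨⟨c * d, by rw [smul_act, hd, mul_smul]⟩, fun h' => by rw [smul_act, h h', smul_zero]⟩

end Units

/-! ### The seminormal units do not vanish -/

section Existence

set_option linter.unusedSectionVars false

/-- A Young diagram that dominates another one of the same size both by rows and by columns is
equal to it. -/
lemma eq_of_dominance {lam ρ : Finset (ℕ × ℕ)} (hlam : ∀ x ∈ lam, ∀ y ≤ x, y ∈ lam)
    (hcard : ρ.card = lam.card)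
    (hrow : ∀ r, (lam.filter fun x => x.1 < r).card ≤ (ρ.filter fun x => x.1 < r).card)
    (hcol : ∀ c, (lam.filter fun x => x.2 < c).card ≤ (ρ.filter fun x => x.2 < c).card) :
    ρ = lam := by
  refine Finset.eq_of_subset_of_card_le ?_ hcard.ge
  rintro ⟨i, c⟩ hx
  induction i using Nat.strong_induction_on generalizing c with
  | _ i ih =>
  by_contra hcon
  have hrows : ρ.filter (fun x => x.1 < i) = lam.filter (fun x => x.1 < i) := by
    refine Finset.eq_of_subset_of_card_le (fun x hx => ?_) (hrow i)
    rw [Finset.mem_filter] at hx ⊢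
    exact ⟨ih x.1 hx.2 x.2 hx.1, hx.2⟩
  have h1 : (ρ.filter fun x => ¬ x.2 < c).card ≤ (lam.filter fun x => ¬ x.2 < c).card := by
    have e1 := Finset.card_filter_add_card_filter_not (s := ρ) (fun x => x.2 < c)
    have e2 := Finset.card_filter_add_card_filter_not (s := lam) (fun x => x.2 < c)
    have := hcol c
    omega
  refine absurd h1 (not_le.2 (Finset.card_lt_card ?_))
  refine (Finset.ssubset_iff_of_subset ?_).2 ⟨(i, c), by simp [hx], by simp [hcon]⟩
  intro x hx
  rw [Finset.mem_filter] at hx ⊢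
  have hxi : x.1 < i := by
    by_contra h
    exact hcon (hlam x hx.1 (i, c) (Prod.le_def.2 ⟨not_lt.1 h, not_lt.1 hx.2⟩))
  have : x ∈ ρ.filter (fun x => x.1 < i) := by rw [hrows, Finset.mem_filter]; exact ⟨hx.1, hxi⟩
  exact ⟨(Finset.mem_filter.1 this).1, hx.2⟩

variable {K : Type*} [Field K] {q : K} {n : ℕ}

/-- The alternating sum over a set of words. -/
noncomputable def altSum (q : K) (O : Finset (Fin n → ℕ)) : Words K n :=
  ∑ w ∈ O, (-q⁻¹) ^ inv w • Finsupp.single w 1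

/-- An alternating sum over words with distinct letters at the positions `a` and `a + 1` is
antisymmetric for the generator that exchanges them. -/
lemma altSum_act_T (hq : q ≠ 0) {O : Finset (Fin n → ℕ)} {a b : Fin n} (hab : b.1 = a.1 + 1)
    (hO : ∀ w ∈ O, w ∘ Equiv.swap a b ∈ O) (hne : ∀ w ∈ O, w a ≠ w b) :
    altSum q O ◃ T q n b.1 = (-1 : K) • altSum q O := by
  classical
  have hs : ∀ w : Fin n → ℕ, (w ∘ Equiv.swap a b) ∘ Equiv.swap a b = w := by
    intro w; funext p; simp
  have key : altSum q O = ∑ w ∈ O with w a < w b,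
      (-q⁻¹) ^ inv w • (Finsupp.single w 1 - q⁻¹ • Finsupp.single (w ∘ Equiv.swap a b) 1) := by
    rw [altSum, ← Finset.sum_filter_add_sum_filter_not O (fun w => w a < w b)]
    simp only [smul_sub, Finset.sum_sub_distrib]
    rw [sub_eq_add_neg, add_right_inj, ← Finset.sum_neg_distrib]
    refine Finset.sum_bij' (fun w _ => w ∘ Equiv.swap a b) (fun w _ => w ∘ Equiv.swap a b)
      ?_ ?_ ?_ ?_ ?_
    · intro w hw
      rw [Finset.mem_filter] at hw ⊢
      refine ⟨hO w hw.1, ?_⟩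
      simpa using lt_of_le_of_ne (not_lt.1 hw.2) (hne w hw.1).symm
    · intro w hw
      rw [Finset.mem_filter] at hw ⊢
      refine ⟨hO w hw.1, ?_⟩
      simpa using hw.2.le
    · intro w _; exact hs w
    · intro w _; exact hs w
    · intro w hw
      rw [Finset.mem_filter] at hw
      have hlt : (w ∘ Equiv.swap a b) a < (w ∘ Equiv.swap a b) b := by
        simpa using lt_of_le_of_ne (not_lt.1 hw.2) (hne w hw.1).symm
      have := inv_swap hab hlt
      rw [hs] at this
      rw [hs, this, pow_succ]
      module
  rw [key, sum_act, Finset.smul_sum]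
  refine Finset.sum_congr rfl fun w hw => ?_
  have hlt := (Finset.mem_filter.1 hw).2
  rw [smul_act, sub_act, smul_act, single_act_T_of_lt hab hlt,
    single_act_T_of_gt (y := w ∘ Equiv.swap a b) hab (by simpa using hlt), hs]
  match_scalars <;> field_simp
  ring

variable [LinearOrder K] [IsStrictOrderedRing K]

/-- In a filling that contributes to a weakly increasing word, the row of a cell is smaller than the
letter at its position. -/
lemma row_lt_of_sorted (hq : 0 < q) {l : List (ℕ × ℕ)} (hl : Std l) (hn : l.length ≤ n)
    {y : Fin n → ℕ} (hy : ∀ k : Fin n, k.1 < l.length → 1 ≤ y k)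
    (hdes : ∀ a b : Fin n, b.1 = a.1 + 1 → b.1 < l.length → y a ≤ y b)
    (hzl : Finsupp.single y (1 : K) ◃ proj q n l ≠ 0) (k : Fin n) (hk : k.1 < l.length) :
    (l[l.length - 1 - k.1]).1 < y k := by
  set f : ℕ → ℕ := fun k => if hk : k < n then y ⟨k, hk⟩ - 1 else 0 with hf
  have hmono : ∀ k k', k ≤ k' → k' < l.length → f k ≤ f k' := by
    intro k k' hkk
    induction k', hkk using Nat.le_induction with
    | base => intro _; exact le_rfl
    | succ k' _ ihk =>
      intro hk
      refine (ihk (by omega)).trans ?_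
      have := hdes ⟨k', by omega⟩ ⟨k' + 1, by omega⟩ rfl hk
      simp only [hf, dif_pos (show k' < n by omega), dif_pos (show k' + 1 < n by omega)]
      omega
  obtain ⟨t, s, hts, hs⟩ := exists_split_one hk
  have := coord_le hq (Or.inl ⟨rfl, rfl⟩) hl hn hmono (fun i hi hil hfi => ?_) hzl hts
  · rw [hs] at this
    have h1 := hy k hk
    simp only [hf, dif_pos k.2, Fin.eta] at this
    omega
  · simp only [hf, dif_pos (show i - 1 < n by omega), dif_pos (show i < n by omega)] at hfi
    have h1 := hy ⟨i - 1, by omega⟩ (by simp; omega)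
    have h2 := hy ⟨i, by omega⟩ hil
    exact single_act_T_of_eq (a := ⟨i - 1, by omega⟩) (b := ⟨i, by omega⟩) (by simp; omega)
      (by omega)

lemma sum_map_fst {l : List (ℕ × ℕ)} (hl : l.Nodup) (hn : l.length = n) :
    ∑ k : Fin n, (l.getD (l.length - 1 - k.1) (0, 0)).1 = ∑ x ∈ l.toFinset, x.1 := by
  refine Finset.sum_bij (fun k _ => l.getD (l.length - 1 - k.1) (0, 0)) ?_ ?_ ?_ ?_
  · intro k _
    have hk : l.length - 1 - k.1 < l.length := by have := k.2; omega
    rw [List.getD_eq_getElem _ _ hk, List.mem_toFinset]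
    exact List.getElem_mem _
  · intro k _ k' _ e
    have hk : l.length - 1 - k.1 < l.length := by have := k.2; omega
    have hk' : l.length - 1 - k'.1 < l.length := by have := k'.2; omega
    rw [List.getD_eq_getElem _ _ hk, List.getD_eq_getElem _ _ hk'] at e
    have := (hl.getElem_inj_iff).1 e
    have := k.2
    have := k'.2
    exact Fin.ext (by omega)
  · intro x hx
    obtain ⟨k, hk, rfl⟩ := List.getElem_of_mem (List.mem_toFinset.1 hx)
    refine ⟨⟨l.length - 1 - k, by omega⟩, Finset.mem_univ _, ?_⟩
    rw [List.getD_eq_getElem _ _ (by simp; omega)]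
    congr 1
    simp
    omega
  · intro k _; rfl

/-- If the isotypic component of some word of content `λ` does not vanish for the shape `λ`, then
some seminormal unit of this shape does not vanish: sort the word. -/
lemma exists_unit_ne_zero (hq : 0 < q) {μ : Finset (ℕ × ℕ)} (hn : μ.card = n) {w : Fin n → ℕ}
    {e : Fin n → ℕ × ℕ} (he : Function.Injective e) (heμ : ∀ k, e k ∈ μ)
    (hw : ∀ k, w k = (e k).1 + 1) (h : Finsupp.single w (1 : K) ◃ shapeProj q n μ ≠ 0) :
    ∃ l ∈ stdLists μ, unit q n l ≠ 0 := by
  induction hN : inv w using Nat.strong_induction_on generalizing w e with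
  | _ N ih =>
  by_cases hdes : ∃ a b : Fin n, b.1 = a.1 + 1 ∧ w b < w a
  · obtain ⟨a, b, hab, hwab⟩ := hdes
    have hyy : (w ∘ Equiv.swap a b) ∘ Equiv.swap a b = w := by funext k; simp
    have hlt : (w ∘ Equiv.swap a b) a < (w ∘ Equiv.swap a b) b := by simpa using hwab
    have hinv := inv_swap hab hlt
    rw [hyy] at hinv
    have e1 := single_act_T_of_lt (K := K) (q := q) hab hlt
    rw [hyy] at e1
    refine ih _ (by omega) (w := w ∘ Equiv.swap a b) (e := e ∘ Equiv.swap a b)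
      (he.comp (Equiv.injective _)) (fun k => heμ _) (fun k => hw _) (fun h0 => h ?_) rfl
    rw [← e1, act_shapeProj_comm hq hn.le (by omega) (by omega), h0, zero_act]
  · push Not at hdes
    obtain ⟨l, hl, hzl⟩ := exists_act_proj_ne_zero h
    have hlen := length_of_mem_stdLists hl
    have hst := (mem_stdLists.1 hl).1
    have h1 : ∀ k : Fin n, (l.getD (l.length - 1 - k.1) (0, 0)).1 ≤ (e k).1 := by
      intro k
      have hk : k.1 < l.length := by have := k.2; omega
      have := row_lt_of_sorted hq hst (by omega) (fun k _ => by rw [hw]; omega)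
        (fun a b hab _ => hdes a b hab) hzl k hk
      rw [hw] at this
      rw [List.getD_eq_getElem _ _ (by omega)]
      omega
    have h2 : ∑ k : Fin n, (e k).1 = ∑ x ∈ μ, x.1 := by
      have himg : Finset.univ.image e = μ :=
        Finset.eq_of_subset_of_card_le (fun x hx => by
          obtain ⟨k, -, rfl⟩ := Finset.mem_image.1 hx; exact heμ k)
          (by rw [Finset.card_image_of_injective _ he, hn]; simp)
      rw [← himg, Finset.sum_image fun _ _ _ _ h => he h]
    have h3 : ∀ k : Fin n, (l.getD (l.length - 1 - k.1) (0, 0)).1 = (e k).1 := by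
      have := (Finset.sum_eq_sum_iff_of_le (s := Finset.univ) fun k _ => h1 k).1
        (by rw [h2, sum_map_fst hst.nodup (by omega), (mem_stdLists.1 hl).2])
      exact fun k => this k (Finset.mem_univ k)
    refine ⟨l, hl, ?_⟩
    have : rowWord n l = w := by
      funext k; rw [rowWord, h3, hw]
    rwa [unit, this]

/-- The word that reads a Young diagram column by column, antisymmetrized in the columns, lies in
the isotypic component of this diagram. -/
lemma exists_word_ne_zero (hq : 0 < q) {μ : Finset (ℕ × ℕ)} (hμ : ∀ x ∈ μ, ∀ y ≤ x, y ∈ μ)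
    (hn : μ.card = n) : ∃ e : Fin n → ℕ × ℕ, Function.Injective e ∧ (∀ k, e k ∈ μ) ∧
      Finsupp.single (fun k => (e k).1 + 1) (1 : K) ◃ shapeProj q n μ ≠ 0 := by
  classical
  obtain ⟨e₀⟩ : Nonempty (Fin n ≃ μ) := ⟨(μ.equivFinOfCardEq hn).symm⟩
  obtain ⟨e, hmono⟩ : ∃ e : Fin n ≃ μ, Monotone fun k => (e k).1.2 :=
    ⟨(Tuple.sort fun k => (e₀ k).1.2).trans e₀, Tuple.monotone_sort fun k => (e₀ k).1.2⟩
  set O : Finset (Fin n → ℕ) := (Finset.univ.filter fun σ : Equiv.Perm (Fin n) =>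
    ∀ k, (e (σ k)).1.2 = (e k).1.2).image fun σ k => (e (σ k)).1.1 + 1 with hO
  have memO : ∀ w, w ∈ O ↔ ∃ σ : Equiv.Perm (Fin n), (∀ k, (e (σ k)).1.2 = (e k).1.2) ∧
      (fun k => (e (σ k)).1.1 + 1) = w := by
    intro w; simp [hO]
  have hinj : ∀ σ : Equiv.Perm (Fin n), Function.Injective fun k => (e (σ k)).1 := fun σ k k' h =>
    σ.injective (e.injective (Subtype.ext h))
  have hcount : ∀ (σ : Equiv.Perm (Fin n)) (p : ℕ × ℕ → Prop) [DecidablePred p],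
      (μ.filter p).card = (Finset.univ.filter fun k => p (e (σ k)).1).card := by
    intro σ p _
    have : μ.filter p = (Finset.univ.filter fun k => p (e (σ k)).1).image fun k => (e (σ k)).1 := by
      ext x
      simp only [Finset.mem_filter, Finset.mem_image, Finset.mem_univ, true_and]
      constructor
      · rintro ⟨h1, h2⟩
        exact ⟨σ.symm (e.symm ⟨x, h1⟩), by simpa using h2, by simp⟩
      · rintro ⟨k, h1, rfl⟩
        exact ⟨(e (σ k)).2, h1⟩
    rw [this, Finset.card_image_of_injective _ (hinj σ)]
  set z := altSum q O
  have hz0 : z ≠ 0 := by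
    intro h0
    have hmem : (fun k => (e k).1.1 + 1) ∈ O := (memO _).2 ⟨1, fun _ => rfl, rfl⟩
    have h1 : z (fun k => (e k).1.1 + 1) = 0 := by rw [h0]; rfl
    simp only [z, altSum, Finsupp.coe_finsetSum, Finset.sum_apply, Finsupp.smul_apply,
      Finsupp.single_apply, smul_eq_mul, mul_ite, mul_one, mul_zero] at h1
    rw [Finset.sum_ite_eq', if_pos hmem] at h1
    exact pow_ne_zero _ (neg_ne_zero.2 (inv_ne_zero hq.ne')) h1
  obtain ⟨ρ, hρ, hzρ⟩ : ∃ ρ ∈ shapes n, z ◃ shapeProj q n ρ ≠ 0 := by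
    apply Finset.exists_ne_zero_of_sum_ne_zero
    rwa [sum_act_shapeProj hq le_rfl]
  have hρn : ρ.card = n := (Finset.mem_powersetCard.1 hρ).2
  obtain ⟨w, hw, hwρ⟩ : ∃ w ∈ O, Finsupp.single w (1 : K) ◃ shapeProj q n ρ ≠ 0 := by
    simp only [z, altSum, sum_act, smul_act] at hzρ
    obtain ⟨w, hw, h⟩ := Finset.exists_ne_zero_of_sum_ne_zero hzρ
    exact ⟨w, hw, fun h0 => h (by rw [h0, smul_zero])⟩
  obtain ⟨σ, hσ, rfl⟩ := (memO w).1 hw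
  have hrow : ∀ r, (μ.filter fun x => x.1 < r).card ≤ (ρ.filter fun x => x.1 < r).card := by
    intro r
    refine le_of_eq_of_le ?_ (dominance hq hρn.le (fun k _ => Nat.le_add_left _ _) hwρ r)
    rw [hcount σ]
    congr 1
    ext k
    simp only [Finset.mem_filter, Finset.mem_univ, true_and]
    have := k.2
    omega
  obtain ⟨l, hl, hzl⟩ := exists_act_proj_ne_zero hzρ
  have hlen := length_of_mem_stdLists hl
  have hst := (mem_stdLists.1 hl).1
  have hcol : ∀ c, (μ.filter fun x => x.2 < c).card ≤ (ρ.filter fun x => x.2 < c).card := by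
    intro c
    rw [hcount 1, ← (mem_stdLists.1 hl).2]
    refine card_filter_le_of_getElem hst.nodup _ _ fun k hk => ?_
    have hkl : k.1 < l.length := by have := k.2; omega
    refine ⟨hkl, ?_⟩
    obtain ⟨t, s, hts, hs⟩ := exists_split_one hkl
    have := coord_le hq (ε := -1) (Or.inr ⟨rfl, rfl⟩) hst (by omega)
      (f := fun k => if hk : k < n then (e ⟨k, hk⟩).1.2 else 0) ?_ ?_ hzl hts
    · rw [hs] at this
      simp only [dif_pos k.2, Fin.eta] at this
      exact lt_of_le_of_lt this hk
    · intro k k' hkk hk'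
      simp only [dif_pos (show k < n by omega), dif_pos (show k' < n by omega)]
      exact hmono (Fin.mk_le_mk.2 hkk)
    · intro i hi hil hfi
      simp only [dif_pos (show i - 1 < n by omega), dif_pos (show i < n by omega)] at hfi
      have hb : i < n := by omega
      set a : Fin n := ⟨i - 1, by omega⟩
      set b : Fin n := ⟨i, hb⟩
      refine altSum_act_T hq.ne' (a := a) (b := b) (by simp [a, b]; omega) ?_ ?_
      · intro w hw
        obtain ⟨τ, hτ, rfl⟩ := (memO w).1 hw
        refine (memO _).2 ⟨(Equiv.swap a b).trans τ, fun k => ?_, rfl⟩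
        rw [Equiv.trans_apply, hτ, Equiv.swap_apply_def]
        split_ifs with h1 h2
        · rw [h1, hfi]
        · rw [h2, hfi]
        · rfl
      · intro w hw
        obtain ⟨τ, hτ, rfl⟩ := (memO w).1 hw
        intro hab
        have : a = b := hinj τ (Prod.ext (by simpa using hab) (by
          change (e (τ a)).1.2 = (e (τ b)).1.2
          rw [hτ, hτ, hfi]))
        rw [Fin.ext_iff] at this
        simp only [a, b] at this
        omega
  obtain rfl := eq_of_dominance hμ (by omega) hrow hcol
  exact ⟨fun k => (e (σ k)).1, hinj σ, fun k => (e (σ k)).2, hwρ⟩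

lemma Adm.unit_ne_zero (hq : 0 < q) {l l' : List (ℕ × ℕ)} (h : Adm l l') (hl : Std l)
    (hn : l.length = n) (h0 : unit q n l ≠ 0) : unit q n l' ≠ 0 := by
  induction h with
  | refl => exact h0
  | swap s r y x hxy =>
    have hl' : Std (s ++ x :: y :: r) := by
      simpa using (Adm.swap s r y x hxy).std (t := []) (r := []) (by simpa using hl)
    have hyx : ¬ y ≤ x := (List.pairwise_cons.1 (Std.of_append hl).1).1 x (by simp)
    have hxy' : ¬ x ≤ y := (List.pairwise_cons.1 (Std.of_append hl').1).1 y (by simp)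
    have hlen : s.length + r.length + 2 = n := by rw [← hn]; simp; omega
    intro h1
    apply h0
    rcases lt_or_gt_of_ne (fst_ne_of_incomparable hxy' hyx) with hrow | hrow
    · rw [unit_swap hq hl hxy' hn hrow] at h1
      exact eq_zero_of_swapVec_eq_zero hq (by omega) (by omega) (by rwa [abs_sub_comm]) h1
    · rw [unit_swap hq hl' hyx (by simp; omega) hrow, h1, swapVec]
      simp
  | trans h1 h2 ih1 ih2 =>
    have hs := h1.std (t := []) (r := []) (by simpa using hl)
    exact ih2 (by simpa using hs) (by rw [← h1.perm.length_eq, hn]) (ih1 hl hn h0)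

/-- A column-reading word has a nonzero component in the isotypic component of its shape, so some
seminormal unit of the shape is nonzero; admissible exchanges transport this to all the others. -/
theorem unit_ne_zero (hq : 0 < q) {l : List (ℕ × ℕ)} (hl : Std l) (hn : l.length = n) :
    unit q n l ≠ 0 := by
  have hμ : l.toFinset.card = n := by rw [hl.card_toFinset, hn]
  obtain ⟨e, h1, h2, h3⟩ := exists_word_ne_zero (K := K) hq (μ := l.toFinset)
    (fun x hx y hy => List.mem_toFinset.2 (hl.2 x (List.mem_toFinset.1 hx) y hy)) hμ
  obtain ⟨l', hl', h4⟩ := exists_unit_ne_zero hq hμ h1 h2 (fun k => rfl) h3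
  obtain ⟨h5, h6⟩ := mem_stdLists.1 hl'
  have hp : l'.Perm l := (List.perm_ext_iff_of_nodup h5.nodup hl.nodup).2 fun x => by
    rw [← List.mem_toFinset, h6, List.mem_toFinset]
  have := Std.adm (s := l') (s' := l) (l := []) (by simpa using h5) (by simpa using hl) hp
  exact this.unit_ne_zero hq h5 (by rw [hp.length_eq, hn]) h4

end Existence

/-! ### Skew shapes and the lifting map -/

section Skew

set_option linter.unusedSectionVars false

/-- The order in which the cells of a skew shape are listed row by row. -/
def RowLex (x y : ℕ × ℕ) : Prop := x.1 < y.1 ∨ x.1 = y.1 ∧ x.2 < y.2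

lemma mem_skewCells {lam mu : YoungDiagram} {x : ℕ × ℕ} :
    x ∈ skewCells lam mu ↔ x ∈ lam.cells ∧ x ∉ mu.cells := by
  obtain ⟨i, j⟩ := x
  rw [YoungDiagram.mem_cells, YoungDiagram.mem_cells, YoungDiagram.mem_iff_lt_rowLen,
    YoungDiagram.mem_iff_lt_rowLen]
  simp only [skewCells, List.mem_flatMap, List.mem_range, List.mem_map, List.mem_range'_1,
    Prod.mk.injEq]
  constructor
  · rintro ⟨i, hi, j, hj, rfl, rfl⟩
    omega
  · rintro ⟨h1, h2⟩
    refine ⟨i, ?_, j, by omega, rfl, rfl⟩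
    rw [← YoungDiagram.mem_iff_lt_colLen]
    exact lam.isLowerSet (Prod.mk_le_mk.2 ⟨le_rfl, Nat.zero_le j⟩)
      (YoungDiagram.mem_iff_lt_rowLen.2 h1)

lemma pairwise_skewCells (lam mu : YoungDiagram) : (skewCells lam mu).Pairwise RowLex := by
  rw [skewCells, List.pairwise_flatMap]
  refine ⟨fun i _ => ?_, ?_⟩
  · rw [List.pairwise_map]
    exact (List.pairwise_lt_range' (s := mu.rowLen i)
      (n := lam.rowLen i - mu.rowLen i)).imp fun h => Or.inr ⟨rfl, h⟩
  · refine List.pairwise_lt_range.imp fun h => ?_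
    intro x hx y hy
    rw [List.mem_map] at hx hy
    obtain ⟨_, _, rfl⟩ := hx
    obtain ⟨_, _, rfl⟩ := hy
    exact Or.inl h

lemma not_le_of_rowLex {x y : ℕ × ℕ} (h : RowLex x y) : ¬ y ≤ x := by
  rw [RowLex] at h
  rw [Prod.le_def]
  omega

/-- The cells of a skew shape, listed row by row, as a list of added cells. -/
def skewList (lam mu : YoungDiagram) : List (ℕ × ℕ) := (skewCells lam mu).reverse

lemma mem_skewList {lam mu : YoungDiagram} {x : ℕ × ℕ} :
    x ∈ skewList lam mu ↔ x ∈ lam.cells ∧ x ∉ mu.cells := by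
  rw [skewList, List.mem_reverse, mem_skewCells]

lemma pairwise_skewList (lam mu : YoungDiagram) :
    (skewList lam mu).Pairwise fun x y => RowLex y x := by
  rw [skewList, List.pairwise_reverse]
  exact pairwise_skewCells lam mu

lemma skewList_append_mem {lam mu : YoungDiagram} (h : mu ≤ lam) {l : List (ℕ × ℕ)}
    (hl : l ∈ stdLists mu.cells) : skewList lam mu ++ l ∈ stdLists lam.cells := by
  obtain ⟨h1, h2⟩ := mem_stdLists.1 hl
  have hmem : ∀ x, x ∈ l ↔ x ∈ mu.cells := fun x => by rw [← h2, List.mem_toFinset]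
  have hsub : ∀ x, x ∈ mu.cells → x ∈ lam.cells := fun x hx => h hx
  have hset : ∀ x, x ∈ skewList lam mu ++ l ↔ x ∈ lam.cells := by
    intro x
    rw [List.mem_append, mem_skewList, hmem]
    have := hsub x
    tauto
  refine mem_stdLists.2 ⟨⟨?_, fun x hx y hy => ?_⟩, ?_⟩
  · rw [List.pairwise_append]
    refine ⟨(pairwise_skewList lam mu).imp not_le_of_rowLex, h1.1, fun x hx y hy hxy => ?_⟩
    exact (mem_skewList.1 hx).2 (mu.isLowerSet hxy ((hmem y).1 hy))
  · rw [hset] at hx ⊢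
    exact lam.isLowerSet hy hx
  · ext x
    rw [List.mem_toFinset, hset]

lemma card_le_of_le {lam mu : YoungDiagram} (h : mu ≤ lam) : mu.card ≤ lam.card :=
  Finset.card_le_card (YoungDiagram.cells_subset_iff.2 h)

lemma stdLists_nonempty (lam : YoungDiagram) : (stdLists lam.cells).Nonempty := by
  have h0 : [] ∈ stdLists (⊥ : YoungDiagram).cells := mem_stdLists.2 ⟨std_nil, by simp⟩
  exact ⟨_, skewList_append_mem bot_le h0⟩

lemma length_skewList {lam mu : YoungDiagram} (h : mu ≤ lam) :
    (skewList lam mu).length = lam.card - mu.card := by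
  obtain ⟨l, hl⟩ := stdLists_nonempty mu
  have h1 := length_of_mem_stdLists (skewList_append_mem h hl)
  rw [List.length_append, length_of_mem_stdLists hl] at h1
  have h2 : mu.cells.card = mu.card := rfl
  have h3 : lam.cells.card = lam.card := rfl
  omega

lemma appendWord_rowWord {lam mu : YoungDiagram} (h : mu ≤ lam) {l : List (ℕ × ℕ)}
    (hl : l.length = mu.card) :
    appendWord lam mu (rowWord mu.card l) = rowWord lam.card (skewList lam mu ++ l) := by
  have hs := length_skewList h
  have hle := card_le_of_le h
  funext m
  have hm := m.2
  rw [appendWord, rowWord, List.length_append, hs, hl]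
  split_ifs with hm'
  · rw [rowWord, List.getD_append_right _ _ _ _ (by omega), hl]
    congr 3
    simp only
    omega
  · rw [List.getD_append _ _ _ _ (by omega), skewCell]
    have hc : (skewCells lam mu).length = lam.card - mu.card := by
      rw [← hs, skewList, List.length_reverse]
    rw [List.getD_eq_getElem _ _ (by omega), List.getD_eq_getElem _ _ (by omega)]
    simp only [skewList, List.getElem_reverse]
    congr 3
    omega

lemma exists_common_suffix {α : Type*} {t s : List α} (h : t.length = s.length) (hne : t ≠ s) :
    ∃ t' s' c x y, t = t' ++ y :: c ∧ s = s' ++ x :: c ∧ x ≠ y := by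
  induction t generalizing s with
  | nil => exact absurd (List.length_eq_zero_iff.1 h.symm).symm hne
  | cons a t ih =>
    cases s with
    | nil => simp at h
    | cons b s =>
      by_cases hts : t = s
      · subst hts
        exact ⟨[], [], t, b, a, rfl, rfl, fun e => hne (by rw [e])⟩
      · obtain ⟨t', s', c, x, y, rfl, rfl, hxy⟩ := ih (by simpa using h) hts
        exact ⟨a :: t', b :: s', c, x, y, rfl, rfl, hxy⟩

variable {K : Type*} [Field K] {q : K} {n : ℕ} [LinearOrder K] [IsStrictOrderedRing K]

/-- Among the standard fillings of a skew shape, only the row-reading one sees the row word. -/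
lemma rowWord_act_proj_of_ne (hq : 0 < q) {s t l : List (ℕ × ℕ)} (hs : Std (s ++ l))
    (hlex : s.Pairwise fun x y => RowLex y x) (ht : Std (t ++ l)) (hn : (s ++ l).length = n)
    (hst : (t ++ l).toFinset = (s ++ l).toFinset) (hne : t ≠ s) :
    Finsupp.single (rowWord n (s ++ l)) (1 : K) ◃ proj q n (t ++ l) = 0 := by
  have hlen : t.length = s.length := by
    have h1 := ht.card_toFinset
    rw [hst, hs.card_toFinset] at h1
    simp only [List.length_append] at h1
    omega
  obtain ⟨t', s', c, x, y, rfl, rfl, hxy⟩ := exists_common_suffix hlen hne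
  have hy : Std (y :: (c ++ l)) := Std.of_append (s := t') (by simpa using ht)
  have hx : Std (x :: (c ++ l)) := Std.of_append (s := s') (by simpa using hs)
  have hmem : y ∈ s' := by
    have h1 : y ∈ ((t' ++ y :: c) ++ l).toFinset := by simp
    rw [hst] at h1
    have h2 := (std_cons.1 hy).2.1
    simp only [List.mem_toFinset, List.mem_append, List.mem_cons] at h1 h2
    rcases h1 with (h1 | rfl | h1) | h1
    · exact h1
    · exact absurd rfl hxy
    · exact absurd (Or.inl h1) h2
    · exact absurd (Or.inr h1) h2
  rw [List.pairwise_append] at hlex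
  rcases hlex.2.2 y hmem x (by simp) with h | ⟨h1, h2⟩
  · have := rowWord_act_proj_eq_zero (K := K) hq (t := s') (r := c ++ l) (n := n)
      (by simpa using hn) hy h t'
    simpa using this
  · exfalso
    refine (std_cons.1 hx).2.1 ((std_cons.1 hy).2.2 x ?_)
    exact lt_of_le_of_ne (Prod.le_def.2 ⟨h1.le, h2.le⟩) hxy

/-- The word of a filling whose last part is listed row by row: its component in the isotypic
component of the full shape is a seminormal unit. -/
lemma lift_unit_aux (hq : 0 < q) {s l : List (ℕ × ℕ)} (hs : Std (s ++ l))
    (hlex : s.Pairwise fun x y => RowLex y x) (hn : (s ++ l).length = n) :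
    Finsupp.single (rowWord n (s ++ l)) (1 : K) ◃ proj q n l ◃
      shapeProj q n (s ++ l).toFinset = unit q n (s ++ l) := by
  have hln : s.length + l.length = n := by rw [← hn]; simp
  have hl : Std l := Std.of_append hs
  set w := Finsupp.single (rowWord n (s ++ l)) (1 : K)
  have hidem : w ◃ proj q n l ◃ proj q n l = w ◃ proj q n l :=
    act_proj_of_mem hq hl (by omega) (act_proj_mem hq hl (by omega) w)
  rw [shapeProj, act_sum, Finset.sum_eq_single (s ++ l)]
  · exact act_proj_append_congr hidem
  · intro l' hl' hne
    have hlen := length_of_mem_stdLists hl'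
    rw [hs.card_toFinset, hn] at hlen
    obtain ⟨h1, h2⟩ := mem_stdLists.1 hl'
    rw [← List.take_append_drop s.length l'] at h1 h2 hne ⊢
    set t := l'.take s.length
    set r := l'.drop s.length with hr
    have hrl : r.length = l.length := by rw [hr, List.length_drop]; omega
    by_cases h : r = l
    · rw [h] at h1 h2 hne ⊢
      rw [act_proj_append_congr hidem]
      exact rowWord_act_proj_of_ne hq hs hlex h1 hn h2 fun e => hne (by rw [e])
    · refine act_proj_append ?_
      exact act_proj_of_mem_ne hq (Std.of_append h1) hl (by omega) hrl.symm (Ne.symm h)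
        (act_proj_mem hq hl (by omega) w)
  · intro h
    exact absurd (mem_stdLists.2 ⟨hs, rfl⟩) h

section Phi

variable {lam mu : YoungDiagram}

/-- The lifting map intertwines the actions of `g` and `h`. -/
def Intertwines (lam mu : YoungDiagram) (g : Hecke q mu.card) (h : Hecke q lam.card) : Prop :=
  ∀ v : Words K mu.card, Phi lam mu (v ◃ g) = Phi lam mu v ◃ h

lemma Phi_single (w : Fin mu.card → ℕ) (c : K) :
    Phi lam mu (Finsupp.single w c) = Finsupp.single (appendWord lam mu w) c :=
  Finsupp.mapDomain_single

namespace Intertwines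

variable {g g' : Hecke q mu.card} {h h' : Hecke q lam.card}

lemma one : Intertwines lam mu (1 : Hecke q mu.card) 1 := fun v => by simp
lemma zero : Intertwines lam mu (0 : Hecke q mu.card) 0 := fun v => by simp

lemma mul (h1 : Intertwines lam mu g h) (h2 : Intertwines lam mu g' h') :
    Intertwines lam mu (g * g') (h * h') := fun v => by rw [act_mul, act_mul, h2, h1]

lemma add (h1 : Intertwines lam mu g h) (h2 : Intertwines lam mu g' h') :
    Intertwines lam mu (g + g') (h + h') := fun v => by rw [act_add, act_add, map_add, h1, h2]

lemma smul (c : K) (h1 : Intertwines lam mu g h) : Intertwines lam mu (c • g) (c • h) :=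
  fun v => by rw [act_smul, act_smul, map_smul, h1]

lemma T (hle : mu ≤ lam) {i : ℕ} (him : i < mu.card) :
    Intertwines lam mu (T q mu.card i) (T q lam.card i) := by
  have hc := card_le_of_le hle
  intro v
  rcases Nat.eq_zero_or_pos i with rfl | hi
  · simp [T_zero]
  induction v using Finsupp.induction_linear with
  | zero => simp
  | add v u h1 h2 => simp only [add_act, map_add, h1, h2]
  | single w c =>
    rw [← mul_one c, ← smul_eq_mul, ← Finsupp.smul_single, smul_act, map_smul, map_smul, smul_act]
    congr 1
    rw [Phi_single]
    set a : Fin mu.card := ⟨i - 1, by omega⟩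
    set b : Fin mu.card := ⟨i, him⟩
    set a' : Fin lam.card := ⟨i - 1, by omega⟩
    set b' : Fin lam.card := ⟨i, by omega⟩
    have hab : b.1 = a.1 + 1 := by simp [a, b]; omega
    have hab' : b'.1 = a'.1 + 1 := by simp [a', b']; omega
    have ea : ∀ w, appendWord lam mu w a' = w a := fun w => by
      rw [appendWord, dif_pos (by simp [a']; omega)]
    have eb : ∀ w, appendWord lam mu w b' = w b := fun w => by
      rw [appendWord, dif_pos (by simp [b']; omega)]
    have es : appendWord lam mu (w ∘ Equiv.swap a b) =
        appendWord lam mu w ∘ Equiv.swap a' b' := by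
      funext k
      rw [Function.comp_apply, Equiv.swap_apply_def]
      split_ifs with h1 h2
      · rw [h1, ea, eb]; simp
      · rw [h2, ea, eb]; simp
      · rw [appendWord, appendWord]
        split_ifs with h3
        · rw [Function.comp_apply, Equiv.swap_apply_of_ne_of_ne]
          · intro h; apply h1; simp only [a, Fin.mk.injEq] at h; exact Fin.ext h
          · intro h; apply h2; simp only [b, Fin.mk.injEq] at h; exact Fin.ext h
        · rfl
    rcases lt_trichotomy (w a) (w b) with h | h | h
    · have e1 := single_act_T_of_lt (K := K) (q := q) hab h
      have e2 := single_act_T_of_lt (K := K) (q := q) (y := appendWord lam mu w) hab'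
        (by rwa [ea, eb])
      simp only [b, b'] at e1 e2
      rw [e1, e2, Phi_single, es]
    · have e1 := single_act_T_of_eq (K := K) (q := q) hab h
      have e2 := single_act_T_of_eq (K := K) (q := q) (y := appendWord lam mu w) hab'
        (by rwa [ea, eb])
      simp only [b, b'] at e1 e2
      rw [e1, e2, map_smul, Phi_single]
    · have e1 := single_act_T_of_gt (K := K) (q := q) hab h
      have e2 := single_act_T_of_gt (K := K) (q := q) (y := appendWord lam mu w) hab'
        (by rwa [ea, eb])
      simp only [b, b'] at e1 e2
      rw [e1, e2, map_add, map_smul, map_smul, Phi_single, Phi_single, es]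

lemma jm (hle : mu ≤ lam) {m : ℕ} (hm : m ≤ mu.card) :
    Intertwines lam mu (Jm q mu.card m) (Jm q lam.card m) := by
  induction m with
  | zero => exact zero
  | succ m ih =>
    have hT := T (q := q) hle (i := m) (by omega)
    exact (((hT.mul (ih (by omega))).mul hT).add hT).smul q⁻¹

lemma remSum (hle : mu ≤ lam) {m : ℕ} (hm : m ≤ mu.card) :
    Intertwines lam mu (remSum (HeckeShuffle.T q mu.card) m)
      (remSum (HeckeShuffle.T q lam.card) m) := by
  induction m with
  | zero => exact zero
  | succ m ih =>
    rw [remSum_succ, remSum_succ]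
    exact one.add ((ih (by omega)).mul (T hle (by omega)))

end Intertwines

/-- The lifting map sends components to components, although the two projections are built from
Lagrange polynomials for different sets of nodes. -/
lemma Phi_act_proj (hq : 0 < q) (hle : mu ≤ lam) {l : List (ℕ × ℕ)} (hl : Std l)
    (hn : l.length ≤ mu.card) (v : Words K mu.card) :
    Phi lam mu (v ◃ proj q mu.card l) = Phi lam mu v ◃ proj q lam.card l := by
  have hc := card_le_of_le hle
  refine eig_induction hq hn (C := fun v => Phi lam mu (v ◃ proj q mu.card l) =
    Phi lam mu v ◃ proj q lam.card l) (by simp) (fun v u h1 h2 => by simp [h1, h2]) ?_ v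
  intro l' hl' hlen v hv
  have hmem : ∀ s : List ℤ, s.length ≤ mu.card → v ∈ eig q mu.card 0 s →
      Phi lam mu v ∈ eig q lam.card 0 s := by
    intro s
    induction s with
    | nil => simp
    | cons c s ih =>
      intro hs hv
      rw [List.length_cons] at hs
      rw [mem_eig_cons] at hv ⊢
      refine ⟨ih (by omega) hv.1, ?_⟩
      rw [← Intertwines.jm hle (by omega), hv.2, map_smul]
  have hv' := hmem _ (by simpa using hlen.trans_le hn) hv
  by_cases h : l' = l
  · subst h
    rw [act_proj_of_mem hq hl hn hv, act_proj_of_mem hq hl (hn.trans hc) hv']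
  · rw [act_proj_of_mem_ne hq hl hl' hn hlen h hv,
      act_proj_of_mem_ne hq hl hl' (hn.trans hc) hlen h hv', map_zero]

variable (q) in
/-- The lifting map followed by the isotypic projector. -/
noncomputable def lift (lam mu : YoungDiagram) : Words K mu.card →ₗ[K] Words K lam.card :=
  rightAct q (shapeProj q lam.card lam.cells) ∘ₗ Phi lam mu

lemma lift_apply (u : Words K mu.card) :
    lift q lam mu u = Phi lam mu u ◃ shapeProj q lam.card lam.cells := rfl

/-- The lift extends a standard filling by the cells of the skew shape, read row by row. -/
lemma lift_unit (hq : 0 < q) (hle : mu ≤ lam) {l : List (ℕ × ℕ)} (hl : l ∈ stdLists mu.cells) :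
    lift q lam mu (unit q mu.card l) = unit q lam.card (skewList lam mu ++ l) := by
  have hlen := length_of_mem_stdLists hl
  obtain ⟨h1, h2⟩ := mem_stdLists.1 (skewList_append_mem hle hl)
  have := lift_unit_aux (K := K) hq h1 (pairwise_skewList lam mu) (n := lam.card)
    (length_of_mem_stdLists (skewList_append_mem hle hl))
  rw [h2] at this
  rw [lift_apply, unit, Phi_act_proj hq hle (mem_stdLists.1 hl).1 hlen.le, Phi_single,
    appendWord_rowWord hle hlen, this]

/-- The isotypic projection for a shape with `n` cells is central. -/
lemma act_shapeProj_central (hq : 0 < q) {μ : Finset (ℕ × ℕ)} (hn : μ.card = n) (h : Hecke q n)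
    (v : Words K n) : v ◃ h ◃ shapeProj q n μ = v ◃ shapeProj q n μ ◃ h := by
  induction h using hecke_induction generalizing v with
  | one => simp
  | T i h1 h2 => exact act_shapeProj_comm hq hn.le h1 (by omega) v
  | smul c h ih => simp only [act_smul, smul_act, ih]
  | add g h ihg ihh => simp only [act_add, add_act, ihg, ihh]
  | mul g h ihg ihh => rw [act_mul, ihh, ihg, act_mul]

lemma lift_act (hq : 0 < q) {g : Hecke q mu.card} {h : Hecke q lam.card}
    (hgh : Intertwines lam mu g h) (u : Words K mu.card) :
    lift q lam mu (u ◃ g) = lift q lam mu u ◃ h := by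
  rw [lift_apply, lift_apply, hgh, act_shapeProj_central hq rfl]

/-- The lift of a vector of a Specht module. -/
lemma lift_mem (hq : 0 < q) (hle : mu ≤ lam) {u : Words K mu.card} (hu : u ∈ specht q mu) :
    lift q lam mu u ∈ specht q lam ∧
      lift q lam mu u ∈ eig q lam.card mu.card ((skewList lam mu).map content) ∧
      lift q lam mu u ◃ shapeProj q lam.card mu.cells = lift q lam mu u := by
  have hc := card_le_of_le hle
  rw [specht_eq hq.ne'] at hu
  induction hu using Submodule.span_induction with
  | mem v hv =>
    obtain ⟨l, hl, rfl⟩ := hv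
    have hlen := length_of_mem_stdLists hl
    have hmem := skewList_append_mem hle hl
    obtain ⟨h1, h2⟩ := mem_stdLists.1 hmem
    rw [lift_unit hq hle hl]
    have h3 := unit_mem hq h1 (n := lam.card) (length_of_mem_stdLists hmem).le
    rw [List.map_append, mem_eig_append, List.length_map, zero_add, hlen] at h3
    refine ⟨unit_mem_specht hq hmem, h3.2, ?_⟩
    rw [act_shapeProj_of_mem hq hc (mem_stdLists.1 hl).1 hlen h3.1, if_pos (mem_stdLists.1 hl).2]
  | zero => simp
  | add v u _ _ h1 h2 =>
    rw [map_add, add_act]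
    exact ⟨Submodule.add_mem _ h1.1 h2.1, Submodule.add_mem _ h1.2.1 h2.2.1, by
      rw [h1.2.2, h2.2.2]⟩
  | smul c v _ h =>
    rw [map_smul, smul_act]
    exact ⟨Submodule.smul_mem _ _ h.1, Submodule.smul_mem _ _ h.2.1, by rw [h.2.2]⟩

/-- Every vector of the Specht module with the eigenvalues of the lifted vectors is lifted. -/
lemma exists_lift_eq (hq : 0 < q) (hle : mu ≤ lam) {v : Words K lam.card} (hv : v ∈ specht q lam)
    (he : v ∈ eig q lam.card mu.card ((skewList lam mu).map content))
    (hs : v ◃ shapeProj q lam.card mu.cells = v) : ∃ u ∈ specht q mu, lift q lam mu u = v := by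
  have hc := card_le_of_le hle
  have key : ∀ l ∈ stdLists mu.cells, ∃ u ∈ specht q mu,
      lift q lam mu u = v ◃ proj q lam.card l := by
    intro l hl
    have hlen : l.length = mu.card := length_of_mem_stdLists hl
    have hmem := skewList_append_mem hle hl
    obtain ⟨h1, h2⟩ := mem_stdLists.1 hmem
    have hlen' := length_of_mem_stdLists hmem
    have hlen2 : ((skewList lam mu).map content).length = lam.card - mu.card := by
      rw [List.length_map, length_skewList hle]
    have h3 : v ◃ proj q lam.card l ∈
        eig q lam.card 0 ((skewList lam mu ++ l).map content) := by
      rw [List.map_append, mem_eig_append, List.length_map, zero_add, hlen]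
      refine ⟨act_proj_mem hq (mem_stdLists.1 hl).1 (by omega) v, act_mem_eig he fun k _ hk => ?_⟩
      exact (commute_proj hq.ne' (by omega) (by omega)).symm
    obtain ⟨⟨c, hcu⟩, -⟩ := specht_act_proj hq (specht_act hq lam (proj q lam.card l) v hv) h1 hlen'
    rw [act_proj_of_mem hq h1 hlen'.le h3] at hcu
    exact ⟨c • unit q mu.card l, Submodule.smul_mem _ _ (unit_mem_specht hq hl), by
      rw [map_smul, lift_unit hq hle hl, hcu]⟩
  choose! u hu hlu using key
  refine ⟨∑ l ∈ stdLists mu.cells, u l, Submodule.sum_mem _ hu, ?_⟩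
  rw [map_sum, Finset.sum_congr rfl hlu, ← act_sum]
  exact hs

/-- The lift is injective on the Specht module, since it sends seminormal units to seminormal units. -/
lemma lift_eq_zero (hq : 0 < q) (hle : mu ≤ lam) {u : Words K mu.card} (hu : u ∈ specht q mu)
    (h : lift q lam mu u = 0) : u = 0 := by
  refine eq_zero_of_act_proj hq le_rfl fun l hl hlen => ?_
  obtain ⟨⟨c, hc⟩, h0⟩ := specht_act_proj hq hu hl hlen
  by_cases hset : l.toFinset = mu.cells
  swap
  · exact h0 hset
  have hmem : l ∈ stdLists mu.cells := mem_stdLists.2 ⟨hl, hset⟩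
  have h1 : lift q lam mu (u ◃ proj q mu.card l) = 0 := by
    rw [lift_apply, Phi_act_proj hq hle hl hlen.le, act_shapeProj_central hq rfl, ← lift_apply, h,
      zero_act]
  rw [hc, map_smul, lift_unit hq hle hmem] at h1
  have h2 := skewList_append_mem hle hmem
  have h3 := (smul_eq_zero.1 h1).resolve_right
    (unit_ne_zero hq (mem_stdLists.1 h2).1 (length_of_mem_stdLists h2))
  rw [hc, h3, zero_smul]

end Phi

end Skew

/-! ### Eigenvalues -/

section StrictSum

variable {R : Type*} [CommRing R]

open Classical in
/-- The sum of `∏_m f (l_m) m` over all `j < l_0 < ⋯ < l_{k-1} ≤ n`. -/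
noncomputable def strictSum (f : ℕ → ℕ → R) (j n k : ℕ) : R :=
  ∑ l ∈ Fintype.piFinset (fun _ : Fin k => Finset.Ioc j n) with StrictMono l, ∏ m : Fin k, f (l m) m

lemma strictSum_zero (f : ℕ → ℕ → R) (j n : ℕ) : strictSum f j n 0 = 1 := by
  classical
  rw [strictSum, Finset.filter_true_of_mem fun l _ i => i.elim0]
  simp

lemma strictSum_of_lt (f : ℕ → ℕ → R) {j n k : ℕ} (h : n - j < k) : strictSum f j n k = 0 := by
  classical
  rw [strictSum, Finset.filter_false_of_mem, Finset.sum_empty]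
  intro l hl hmono
  have h1 := Finset.card_le_card_of_injOn (s := Finset.univ) (t := Finset.Ioc j n) l
    (fun i _ => Fintype.mem_piFinset.1 hl i) hmono.injective.injOn
  rw [Finset.card_univ, Fintype.card_fin, Nat.card_Ioc] at h1
  omega

/-- Splitting off the sequences with the last term `n + 1`. -/
lemma strictSum_succ (f : ℕ → ℕ → R) {j n : ℕ} (hj : j ≤ n) (k : ℕ) :
    strictSum f j (n + 1) (k + 1) = strictSum f j n (k + 1) + strictSum f j n k * f (n + 1) k := by
  classical
  rw [strictSum, ← Finset.sum_filter_add_sum_filter_not _ fun l => l (Fin.last k) ≤ n]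
  congr 1
  · rw [strictSum]
    refine Finset.sum_congr ?_ fun _ _ => rfl
    ext l
    simp only [Finset.mem_filter, Fintype.mem_piFinset, Finset.mem_Ioc]
    constructor
    · rintro ⟨⟨h1, h2⟩, h3⟩
      exact ⟨fun i => ⟨(h1 i).1, (h2.monotone (Fin.le_last i)).trans h3⟩, h2⟩
    · rintro ⟨h1, h2⟩
      exact ⟨⟨fun i => ⟨(h1 i).1, (h1 i).2.trans (Nat.le_succ n)⟩, h2⟩, (h1 _).2⟩
  · rw [strictSum, Finset.sum_mul]
    refine Finset.sum_bij' (fun l _ => fun i => l i.castSucc)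
      (fun l _ => Fin.snoc (α := fun _ => ℕ) l (n + 1)) ?_ ?_ ?_ ?_ ?_
    · intro l hl
      simp only [Finset.mem_filter, Fintype.mem_piFinset, Finset.mem_Ioc] at hl ⊢
      obtain ⟨⟨h1, h2⟩, h3⟩ := hl
      refine ⟨fun i => ⟨(h1 _).1, ?_⟩, fun i i' h => h2 (Fin.castSucc_lt_castSucc_iff.2 h)⟩
      have := h2 (Fin.castSucc_lt_last i)
      have := (h1 (Fin.last k)).2
      omega
    · intro l hl
      simp only [Finset.mem_filter, Fintype.mem_piFinset, Finset.mem_Ioc] at hl ⊢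
      obtain ⟨h1, h2⟩ := hl
      refine ⟨⟨fun i => ?_, fun i i' h => ?_⟩, by simp⟩
      · refine Fin.lastCases ?_ (fun i => ?_) i
        · simp; omega
        · simp only [Fin.snoc_castSucc]
          exact ⟨(h1 i).1, (h1 i).2.trans (Nat.le_succ n)⟩
      · induction i' using Fin.lastCases with
        | last =>
          induction i using Fin.lastCases with
          | last => exact absurd h (lt_irrefl _)
          | cast i =>
            simp only [Fin.snoc_castSucc, Fin.snoc_last]
            exact Nat.lt_succ_of_le (h1 i).2
        | cast i' =>
          induction i using Fin.lastCases with
          | last => exact absurd h (Fin.castSucc_lt_last i').not_gt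
          | cast i =>
            simp only [Fin.snoc_castSucc]
            exact h2 (Fin.castSucc_lt_castSucc_iff.1 h)
    · intro l hl
      simp only [Finset.mem_filter, Fintype.mem_piFinset, Finset.mem_Ioc] at hl
      obtain ⟨⟨h1, h2⟩, h3⟩ := hl
      funext i
      induction i using Fin.lastCases with
      | last =>
        have := (h1 (Fin.last k)).2
        simp only [Fin.snoc_last]
        omega
      | cast i => simp
    · intro l _
      funext i
      simp
    · intro l hl
      simp only [Finset.mem_filter, Fintype.mem_piFinset, Finset.mem_Ioc] at hl
      obtain ⟨⟨h1, h2⟩, h3⟩ := hl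
      have h4 : l (Fin.last k) = n + 1 := by
        have := (h1 (Fin.last k)).2
        omega
      rw [Fin.prod_univ_castSucc, h4]
      rfl

end StrictSum

section Eigenvalues

set_option linter.unusedSectionVars false

variable {K : Type*} [Field K] {q : K} {n : ℕ}

lemma remProd_of_lt {A : Type*} [Ring A] (t : ℕ → A) {m k : ℕ} (h : m < k) :
    remProd t m k = 0 := by
  induction m generalizing k with
  | zero => cases k with
    | zero => omega
    | succ k => rfl
  | succ m ih => cases k with
    | zero => omega
    | succ k => rw [remProd_succ, ih (by omega), mul_zero]

lemma qFactorial_succ (q : K) (k : ℕ) :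
    qFactorial q (k + 1) = qFactorial q k * qInt q ((k : ℤ) + 1) := by
  rw [qFactorial, Finset.prod_range_succ, qFactorial]

/-- The summands of the eigenvalue. -/
noncomputable def eigTerm (q : K) (c : ℕ → ℤ) (l m : ℕ) : K :=
  q ^ (-(l : ℤ)) * qInt q ((l : ℤ) + 1 - ((m + 1 : ℕ) : ℤ) + c l)

/-- The eigenvalue of a shuffle on the vectors that are generated from the kernel at the level `j`,
where `c l` is the content in the step `l`. -/
noncomputable def shuffleEigenvalue (q : K) (c : ℕ → ℤ) (j n k : ℕ) : K :=
  q ^ ((n : ℤ) * (k : ℤ) - (k.choose 2 : ℤ)) * strictSum (eigTerm q c) j n k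

lemma eigenvalue_eq (q : K) (lam mu : YoungDiagram) (k : ℕ) : eigenvalue q lam mu k =
    shuffleEigenvalue q (fun l => content (skewCell lam mu l)) mu.card lam.card k := rfl

lemma shuffleEigenvalue_zero (q : K) (c : ℕ → ℤ) (j n : ℕ) : shuffleEigenvalue q c j n 0 = 1 := by
  simp [shuffleEigenvalue, strictSum_zero]

lemma shuffleEigenvalue_of_lt (q : K) (c : ℕ → ℤ) {j n k : ℕ} (h : n - j < k) :
    shuffleEigenvalue q c j n k = 0 := by
  rw [shuffleEigenvalue, strictSum_of_lt _ h, mul_zero]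

lemma shuffleEigenvalue_succ (hq : q ≠ 0) (c : ℕ → ℤ) {j n : ℕ} (hj : j ≤ n) (k : ℕ) :
    shuffleEigenvalue q c j (n + 1) (k + 1) = q ^ (k + 1) * shuffleEigenvalue q c j n (k + 1) +
      qInt q ((n : ℤ) + 1 - k + c (n + 1)) * shuffleEigenvalue q c j n k := by
  rw [shuffleEigenvalue, strictSum_succ _ hj, shuffleEigenvalue, shuffleEigenvalue, eigTerm]
  have e0 : (((k + 1).choose 2 : ℕ) : ℤ) = k + k.choose 2 := by
    rw [Nat.choose_succ_succ' k 1, Nat.choose_one_right]; push_cast; ring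
  have e1 : q ^ (((n + 1 : ℕ) : ℤ) * ((k + 1 : ℕ) : ℤ) - ((k + 1).choose 2 : ℤ)) =
      q ^ (k + 1) * q ^ ((n : ℤ) * ((k + 1 : ℕ) : ℤ) - ((k + 1).choose 2 : ℤ)) := by
    rw [← zpow_natCast, ← zpow_add₀ hq]
    congr 1
    push_cast
    ring
  have e2 : q ^ (((n + 1 : ℕ) : ℤ) * ((k + 1 : ℕ) : ℤ) - ((k + 1).choose 2 : ℤ)) *
      q ^ (-((n + 1 : ℕ) : ℤ)) = q ^ ((n : ℤ) * (k : ℤ) - (k.choose 2 : ℤ)) := by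
    rw [← zpow_add₀ hq]
    congr 1
    rw [e0]
    push_cast
    ring
  have e3 : ((n + 1 : ℕ) : ℤ) + 1 - ((k + 1 : ℕ) : ℤ) = (n : ℤ) + 1 - k := by push_cast; ring
  rw [mul_add, e3]
  congr 1
  · rw [e1]; ring
  · rw [← e2]; ring

/-- Inserting into a joint eigenvector of `J_{j+1}, …, J_n` that is annihilated by `B*_j` gives an
eigenvector of the shuffles. -/
theorem act_insProd_act (hq : q ≠ 0) {c : ℕ → ℤ} {j m : ℕ} {x : Words K n} (hjm : j ≤ m)
    (hm : m ≤ n) (hx : x ◃ remSum (T q n) j = 0)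
    (hJ : ∀ l, j < l → l ≤ m → x ◃ Jm q n l = qInt q (c l) • x) (k : ℕ) :
    x ◃ insProd (T q n) m (m - j) ◃ (remProd (T q n) m k * insProd (T q n) m k) =
      (qFactorial q k * shuffleEigenvalue q c j m k) • x ◃ insProd (T q n) m (m - j) := by
  have H := isHecke q n
  induction m, hjm using Nat.le_induction generalizing k with
  | base =>
    rw [Nat.sub_self, insProd_zero, act_one]
    cases k with
    | zero => simp [remProd_zero, insProd_zero, qFactorial, shuffleEigenvalue_zero]
    | succ k =>
      rw [shuffleEigenvalue_of_lt _ _ (by omega), mul_zero, zero_smul, act_mul]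
      cases j with
      | zero => simp [remProd]
      | succ j => rw [remProd_succ, act_mul, hx]; simp
  | succ m hjm ih =>
    have ih := ih (by omega) fun l h1 h2 => hJ l h1 (by omega)
    cases k with
    | zero => simp [remProd_zero, insProd_zero, qFactorial, shuffleEigenvalue_zero]
    | succ k =>
      by_cases hk : k ≤ m
      swap
      · rw [shuffleEigenvalue_of_lt _ _ (by omega), remProd_of_lt _ (by omega)]
        simp
      rw [show m + 1 - j = (m - j) + 1 by omega, insProd_succ]
      rw [act_mul x]
      set x' := x ◃ insProd (T q n) m (m - j) with hx'
      have hX : x' ◃ xm q (T q n) (m + 1) = qInt q (((m : ℤ) + 1) + c (m + 1)) • x' := by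
        have hc : Commute (xm q (T q n) (m + 1)) (insProd (T q n) m (m - j)) :=
          commute_insProd fun i h1 h2 =>
            (((Commute.one_right _).smul_right _).add_right
              ((H.t_commute_jm_of_gt hq h1 (by omega) hm).smul_right _)).symm
        rw [hx', ← act_comm x hc]
        rw [xm, act_add, act_smul, act_one, act_smul, hJ _ (by omega) le_rfl, smul_smul, ← add_smul,
          smul_act, qInt_add hq]
        congr 2
        rw [← zpow_natCast]
        push_cast
        rfl
      have hX' : x' ◃ (xm q (T q n) (m + 1) - qInt q (k : ℤ) • 1) =
          (q ^ k * qInt q ((m : ℤ) + 1 - k + c (m + 1))) • x' := by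
        rw [act_sub, hX, act_smul, act_one, ← sub_smul,
          show (m : ℤ) + 1 + c (m + 1) = k + (m + 1 - k + c (m + 1)) by ring, qInt_add hq k,
          zpow_natCast]
        congr 1
        ring
      rw [← act_mul x', H.insSum_mul_remProd_mul_insProd hq (by omega) hk]
      simp only [act_add, act_smul, act_mul, hX', smul_act]
      have ih1 := ih k
      have ih2 := ih (k + 1)
      rw [act_mul] at ih1 ih2
      rw [ih1, ih2, smul_act, smul_act, smul_smul, smul_smul, smul_smul, ← add_smul,
        shuffleEigenvalue_succ hq c hjm, qFactorial_succ]
      congr 1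
      field_simp
      ring

lemma act_R (k : ℕ) (v : Words K n) : v ◃ R q n k =
    (qFactorial q k)⁻¹ • v ◃ (remProd (T q n) n k * insProd (T q n) n k) := by
  rw [R, Bk_eq, BkStar_eq, act_smul]

lemma eig_act_Jm {j : ℕ} {s : List ℤ} {v : Words K n} (hv : v ∈ eig q n j s) {l : ℕ} (h1 : j < l)
    (h2 : l ≤ j + s.length) : v ◃ Jm q n l = qInt q (s.getD (s.length - (l - j)) 0) • v := by
  induction s with
  | nil => simp at h2; omega
  | cons c s ih =>
    rw [mem_eig_cons] at hv
    rw [List.length_cons] at h2 ⊢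
    rcases eq_or_lt_of_le h2 with h | h
    · rw [show s.length + 1 - (l - j) = 0 by omega, List.getD_cons_zero, h]
      exact hv.2
    · rw [show s.length + 1 - (l - j) = (s.length - (l - j)) + 1 by omega, List.getD_cons_succ]
      exact ih hv.1 (by omega)

variable [LinearOrder K] [IsStrictOrderedRing K]

lemma qInt_pos (hq : 0 < q) {a : ℤ} (h : 0 < a) : 0 < qInt q a := by
  rw [← qInt_zero q]; exact qInt_strictMono hq h

lemma qFactorial_pos (hq : 0 < q) (k : ℕ) : 0 < qFactorial q k :=
  Finset.prod_pos fun i _ => qInt_pos hq (by positivity)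

lemma act_insProd_act_R (hq : 0 < q) {c : ℕ → ℤ} {j : ℕ} {x : Words K n} (hj : j ≤ n)
    (hx : x ◃ remSum (T q n) j = 0)
    (hJ : ∀ l, j < l → l ≤ n → x ◃ Jm q n l = qInt q (c l) • x) (k : ℕ) :
    x ◃ insProd (T q n) n (n - j) ◃ R q n k =
      shuffleEigenvalue q c j n k • x ◃ insProd (T q n) n (n - j) := by
  rw [act_R, act_insProd_act hq.ne' hj le_rfl hx hJ k, smul_smul,
    inv_mul_cancel_left₀ (qFactorial_pos hq k).ne']

lemma skewList_act_Jm {lam mu : YoungDiagram} (hle : mu ≤ lam) {v : Words K lam.card}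
    (hv : v ∈ eig q lam.card mu.card ((skewList lam mu).map content)) {l : ℕ} (h1 : mu.card < l)
    (h2 : l ≤ lam.card) : v ◃ Jm q lam.card l = qInt q (content (skewCell lam mu l)) • v := by
  have hs := length_skewList hle
  rw [eig_act_Jm hv h1 (by rw [List.length_map, hs]; omega)]
  congr 2
  have hc : (skewCells lam mu).length = lam.card - mu.card := by
    rw [← hs, skewList, List.length_reverse]
  rw [List.length_map, hs, skewCell, List.getD_eq_getElem _ _ (by rw [List.length_map]; omega),
    List.getD_eq_getElem _ _ (by omega), List.getElem_map]
  simp only [skewList, List.getElem_reverse]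
  congr 2
  omega

/-- The vectors killed by `R_{m,1}` are those killed by `B*_m`. -/
lemma mem_spechtKer (hq : 0 < q) {mu : YoungDiagram} {u : Words K mu.card} :
    u ∈ spechtKer q mu ↔ u ∈ specht q mu ∧ u ◃ remSum (T q mu.card) mu.card = 0 := by
  rw [spechtKer, Submodule.mem_inf, LinearMap.mem_ker, ← act_def]
  refine and_congr_right fun _ => ?_
  have h1 : u ◃ R q mu.card 1 =
      u ◃ remSum (T q mu.card) mu.card ◃ insSum (T q mu.card) 0 mu.card := by
    rw [act_R, qFactorial_succ]
    rcases Nat.eq_zero_or_pos mu.card with h | h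
    · have e1 : remProd (T q mu.card) mu.card 1 = 0 := remProd_of_lt _ (by omega)
      have e2 : remSum (T q mu.card) mu.card = 0 := by
        have : ∀ m, m = 0 → remSum (T q mu.card) m = 0 := by rintro _ rfl; rfl
        exact this _ h
      rw [e1, e2]; simp
    · obtain ⟨m, hm⟩ : ∃ m, mu.card = m + 1 := ⟨mu.card - 1, by omega⟩
      have e1 : ∀ t : ℕ → Hecke q mu.card, remProd t (m + 1) 1 = remSum t (m + 1) := fun t => by
        rw [remProd_succ, remProd_zero, mul_one]
      have e2 : ∀ t : ℕ → Hecke q mu.card, insProd t (m + 1) 1 = insSum t 0 (m + 1) := fun t => by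
        rw [insProd_succ, insProd_zero, one_mul]
      have e3 : ∀ m' , m' = m + 1 → u ◃ (remProd (T q mu.card) m' 1 * insProd (T q mu.card) m' 1) =
          u ◃ remSum (T q mu.card) m' ◃ insSum (T q mu.card) 0 m' := by
        rintro _ rfl
        rw [e1, e2, act_mul]
      rw [e3 _ hm]
      simp [qFactorial, qInt_one]
  rw [h1]
  refine ⟨fun h => ?_, fun h => by rw [h]; simp⟩
  rw [← form_self_eq_zero hq, ← IsAdj.insSum, h]
  simp

/-- The eigenvector attached to a vector of the kernel, in terms of the lift. -/
lemma eigenvec_eq (hq : 0 < q) {lam mu : YoungDiagram} (u : Words K mu.card) :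
    eigenvec q lam mu u = lift q lam mu u ◃
      insProd (T q lam.card) lam.card (lam.card - mu.card) := by
  rw [eigenvec, isotypicProjector_eq hq.ne', Bk_eq, ← act_def, ← act_def,
    act_shapeProj_central hq rfl, ← lift_apply]

lemma lift_act_remSum (hq : 0 < q) {lam mu : YoungDiagram} (hle : mu ≤ lam)
    (u : Words K mu.card) : lift q lam mu u ◃ remSum (T q lam.card) mu.card =
      lift q lam mu (u ◃ remSum (T q mu.card) mu.card) :=
  (lift_act hq (Intertwines.remSum hle le_rfl) u).symm

/-- The eigenvalue is the one of `act_insProd_act`, as the lift of `u` has the contents of the cells of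
the skew shape as eigenvalues of the last Jucys--Murphy elements. -/
theorem eigenvec_act_R (hq : 0 < q) {lam mu : YoungDiagram} (hle : mu ≤ lam)
    {u : Words K mu.card} (hu : u ∈ spechtKer q mu) (k : ℕ) :
    eigenvec q lam mu u ◃ R q lam.card k = eigenvalue q lam mu k • eigenvec q lam mu u := by
  rw [mem_spechtKer hq] at hu
  rw [eigenvec_eq hq, eigenvalue_eq]
  refine act_insProd_act_R hq (card_le_of_le hle) ?_ (fun l h1 h2 => ?_) k
  · rw [lift_act_remSum hq hle, hu.2, map_zero]
  · exact skewList_act_Jm hle (lift_mem hq hle hu.1).2.1 h1 h2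

end Eigenvalues

/-! ### Spanning by eigenvectors -/

section Level

set_option linter.unusedSectionVars false

variable {K : Type*} [Field K] {q : K} {n : ℕ}

/-- A vector of `M` that is annihilated by `B*_j`, belongs to the shape `μ` at the level `j = |μ|`,
and is a joint eigenvector of the subsequent Jucys--Murphy elements for the contents `s`. -/
structure LevelVec (q : K) (M : Submodule K (Words K n)) (μ : Finset (ℕ × ℕ)) (s : List ℤ)
    (x : Words K n) : Prop where
  mem : x ∈ M
  remSum : x ◃ remSum (T q n) μ.card = 0
  shape : x ◃ shapeProj q n μ = x
  eig : x ∈ eig q n μ.card s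

lemma T_commute_shapeProj {μ : Finset (ℕ × ℕ)} {i : ℕ} (hi : μ.card < i) (hin : i < n) :
    Commute (T q n i) (shapeProj q n μ) :=
  Commute.sum_right _ _ _ fun _ hl => T_commute_proj (by rwa [length_of_mem_stdLists hl]) hin

lemma Jm_commute_shapeProj (hq : q ≠ 0) {μ : Finset (ℕ × ℕ)} {m : ℕ} (hμ : μ.card ≤ n)
    (hm : m ≤ n) : Commute (Jm q n m) (shapeProj q n μ) :=
  Commute.sum_right _ _ _ fun _ hl =>
    commute_proj hq (by rwa [length_of_mem_stdLists hl]) hm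

lemma T_commute_remSum {i j : ℕ} (hi : j < i) (hin : i < n) :
    Commute (T q n i) (remSum (T q n) j) :=
  commute_remSum fun k _ h2 => (isHecke q n).commute (by omega) hin (by omega)

lemma Jm_commute_remSum (hq : q ≠ 0) {j m : ℕ} (hj : j < m) (hm : m ≤ n) :
    Commute (Jm q n m) (remSum (T q n) j) :=
  commute_remSum fun k h1 h2 => ((isHecke q n).t_commute_jm_of_gt hq h1 (by omega) hm).symm

variable [LinearOrder K] [IsStrictOrderedRing K]

/-- An admissible exchange of cells changes the vector that results from the insertions only by a
nonzero factor. -/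
lemma Adm.exists_levelVec (hq : 0 < q) {M : Submodule K (Words K n)}
    (hM : ∀ h : Hecke q n, ∀ v ∈ M, v ◃ h ∈ M) {μ : Finset (ℕ × ℕ)} {t t' : List (ℕ × ℕ)} (h : Adm t t')
    (hn : μ.card + t.length ≤ n) {x : Words K n} (hx : LevelVec q M μ (t.map content) x) :
    ∃ (x' : Words K n) (c : K), c ≠ 0 ∧ LevelVec q M μ (t'.map content) x' ∧
      x' ◃ insProd (T q n) n (n - μ.card) = c • x ◃ insProd (T q n) n (n - μ.card) ∧
      (x ≠ 0 → x' ≠ 0) := by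
  induction h generalizing x with
  | refl t => exact ⟨x, 1, one_ne_zero, hx, by simp, id⟩
  | swap s r y z hyz =>
    simp only [List.length_append, List.length_cons] at hn
    obtain ⟨h1, h2, h3, h4⟩ := hx
    set i := μ.card + r.length + 1 with hi
    have hin : i < n := by omega
    have hcomm := (isHecke q n).t_mul_insProd (m := n) (k := n - μ.card) (i := i) (by omega) hin
      le_rfl (by omega)
    rw [abs_sub_comm] at hyz
    have hne : content z ≠ content y := fun e => by rw [e] at hyz; simp at hyz
    refine ⟨swapVec q i (content z) (content y) x, q - diagCoef q (content z) (content y),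
      (diagCoef_ne hq hyz).1, ⟨?_, ?_, ?_, ?_⟩, ?_, ?_⟩
    · exact Submodule.sub_mem _ (hM _ _ h1) (Submodule.smul_mem _ _ h1)
    · rw [swapVec, sub_act, smul_act, act_comm x (T_commute_remSum (by omega) hin), h2]
      simp
    · rw [swapVec, sub_act, smul_act, act_comm x (T_commute_shapeProj (by omega) hin), h3]
    · simp only [List.map_append, List.map_cons] at h4 ⊢
      exact swapVec_mem_eig hq h4 hne (by simp; omega) (by simp [hi])
    · rw [swapVec, sub_act, smul_act, ← act_mul, hcomm, act_smul, sub_smul]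
    · exact fun hx0 h0 => hx0 (eq_zero_of_swapVec_eq_zero hq (by omega) hin hyz h0)
  | trans ha hb iha ihb =>
    obtain ⟨x₁, c₁, hc₁, hx₁, e₁, n₁⟩ := iha hn hx
    obtain ⟨x₂, c₂, hc₂, hx₂, e₂, n₂⟩ := ihb (by rw [← ha.perm.length_eq]; exact hn) hx₁
    exact ⟨x₂, c₂ * c₁, mul_ne_zero hc₂ hc₁, hx₂, by rw [e₂, e₁, smul_smul], fun h => n₂ (n₁ h)⟩

lemma act_shapeProj_remSum (hq : 0 < q) {μ : Finset (ℕ × ℕ)} (hn : μ.card ≤ n) {m : ℕ}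
    (hm : m ≤ μ.card) (v : Words K n) :
    v ◃ shapeProj q n μ ◃ remSum (T q n) m = v ◃ remSum (T q n) m ◃ shapeProj q n μ := by
  induction m with
  | zero => simp [remSum]
  | succ m ih =>
    rw [remSum_succ]
    simp only [act_add, act_mul, act_one, add_act]
    rw [ih (by omega)]
    rcases Nat.eq_zero_or_pos m with rfl | h
    · simp [T_zero]
    · rw [act_shapeProj_comm hq hn h (by omega)]

lemma sum_induction {C : Words K n → Prop} (zero : C 0) (add : ∀ v u, C v → C u → C (v + u))
    {ι : Type*} (s : Finset ι) (f : ι → Words K n) (hf : ∀ c ∈ s, C (f c)) :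
    C (∑ c ∈ s, f c) := by
  classical
  induction s using Finset.induction_on with
  | empty => simpa using zero
  | insert c s hc ihs =>
    rw [Finset.sum_insert hc]
    exact add _ _ (hf c (by simp)) (ihs fun d hd => hf d (by simp [hd]))

/-- The vectors of a submodule that are annihilated by `B*_j` are sums of vectors for shapes with
`j` cells and standard fillings of skew shapes. -/
theorem level_induction (hq : 0 < q) {M : Submodule K (Words K n)}
    (hM : ∀ h : Hecke q n, ∀ v ∈ M, v ◃ h ∈ M) {j m : ℕ} (hjm : j ≤ m) (hm : m ≤ n) {C : Words K n → Prop}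
    (zero : C 0) (add : ∀ v u, C v → C u → C (v + u))
    (H : ∀ (μ : Finset (ℕ × ℕ)) (t : List (ℕ × ℕ)) (x : Words K n), μ.card = j →
      t.length = m - j → (∀ l ∈ stdLists μ, Std (t ++ l)) → LevelVec q M μ (t.map content) x →
      x ≠ 0 → C x) {x : Words K n} (hx : x ∈ M) (hxj : x ◃ remSum (T q n) j = 0) : C x := by
  induction m, hjm using Nat.le_induction with
  | base =>
    rw [← sum_act_shapeProj hq hm x]
    refine sum_induction zero add _ _ fun μ hμ => ?_
    have hc : μ.card = j := (Finset.mem_powersetCard.1 hμ).2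
    subst hc
    by_cases h0 : x ◃ shapeProj q n μ = 0
    · rw [h0]; exact zero
    refine H μ [] _ rfl (by simp) (fun l hl => (mem_stdLists.1 hl).1) ⟨hM _ _ hx, ?_, ?_, ?_⟩ h0
    · rw [act_shapeProj_remSum hq hm le_rfl, hxj, zero_act]
    · exact act_shapeProj_idem hq hm x
    · simp
  | succ m hjm ih =>
    refine ih (by omega) fun μ t x hμ ht hst hx _ => ?_
    subst hμ
    rw [← sum_act_lagr hq (h := Jm q n (m + 1)) (m := n) (by omega) x]
    refine sum_induction zero add _ _ fun c hc => ?_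
    have hc' : |c| < n := by rw [abs_lt]; exact Finset.mem_Ioo.1 hc
    by_cases h0 : x ◃ Polynomial.aeval (Jm q n (m + 1)) (lagr q n c) = 0
    · rw [h0]; exact zero
    obtain ⟨h1, h2, h3, h4⟩ := hx
    have hx' : LevelVec q M μ (c :: t.map content)
        (x ◃ Polynomial.aeval (Jm q n (m + 1)) (lagr q n c)) := by
      refine ⟨hM _ _ h1, ?_, ?_, ?_⟩
      · rw [act_comm x (commute_aeval (Jm_commute_remSum hq.ne' (by omega) hm).symm _).symm, h2,
          zero_act]
      · rw [act_comm x (commute_aeval (Jm_commute_shapeProj hq.ne' (by omega) hm).symm _).symm, h3]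
      · rw [mem_eig_cons, List.length_map, ht, show μ.card + (m - μ.card) = m by omega]
        refine ⟨act_mem_eig h4 fun k _ hk => ?_, act_lagr_act (act_specPoly_self hq (by omega) hm _) hc'⟩
        rw [List.length_map] at hk
        exact (commute_aeval ((isHecke q n).jm_commute_jm hq.ne' (by omega) hm) _).symm
    -- the new eigenvalue is the content of an addable cell
    obtain ⟨l, hl, hxl⟩ := exists_act_proj_ne_zero (hx'.shape.symm ▸ h0)
    have hlen := length_of_mem_stdLists hl
    have hmem : x ◃ Polynomial.aeval (Jm q n (m + 1)) (lagr q n c) ◃ proj q n l ∈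
        eig q n 0 (c :: (t ++ l).map content) := by
      rw [List.map_append, ← List.cons_append, mem_eig_append, List.length_map, zero_add, hlen]
      refine ⟨act_proj_mem hq (mem_stdLists.1 hl).1 (by omega) _, act_mem_eig hx'.eig fun k _ hk => ?_⟩
      rw [List.length_cons, List.length_map] at hk
      exact (commute_proj hq.ne' (by omega) (by omega)).symm
    obtain ⟨b, rfl, hb⟩ := NZ.exists_addable hq (hst l hl) ⟨_, hmem, hxl⟩ (by simp; omega)
    refine H μ (b :: t) _ rfl (by simp; omega) (fun l' hl' => ?_) hx' h0
    rw [std_cons] at hb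
    have hset : ∀ y, y ∈ t ++ l ↔ y ∈ t ++ l' := fun y => by
      rw [List.mem_append, List.mem_append, ← List.mem_toFinset (l := l),
        ← List.mem_toFinset (l := l'), (mem_stdLists.1 hl).2, (mem_stdLists.1 hl').2]
    rw [List.cons_append, std_cons]
    exact ⟨hst l' hl', fun h => hb.2.1 ((hset b).2 h), fun y hy => (hset y).1 (hb.2.2 y hy)⟩

lemma exists_eq_ker_add_range {E : Type*} [AddCommGroup E] [Module K E] [FiniteDimensional K E]
    {f : E →ₗ[K] E} (hf : ∀ w, f (f w) = 0 → f w = 0) (x : E) : ∃ k v, f k = 0 ∧ x = k + f v := by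
  have hdisj : Disjoint (LinearMap.ker f) (LinearMap.range f) := by
    rw [Submodule.disjoint_def]
    rintro _ h1 ⟨w, rfl⟩
    exact hf w h1
  have htop : LinearMap.ker f ⊔ LinearMap.range f = ⊤ :=
    Submodule.eq_top_of_disjoint _ _
      (by rw [add_comm, LinearMap.finrank_range_add_finrank_ker]) hdisj
  obtain ⟨k, hk, _, ⟨v, rfl⟩, hkv⟩ := Submodule.mem_sup.1
    (show x ∈ LinearMap.ker f ⊔ LinearMap.range f by rw [htop]; trivial)
  exact ⟨k, v, hk, hkv.symm⟩

/-- A stable finite-dimensional module is the sum of the kernel of `B*_m` and of the image of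
`B_m`. -/
lemma exists_eq_add_act_insSum (hq : 0 < q) {M : Submodule K (Words K n)} [FiniteDimensional K M]
    (hM : ∀ h : Hecke q n, ∀ v ∈ M, v ◃ h ∈ M) (m : ℕ) {x : Words K n} (hx : x ∈ M) :
    ∃ k ∈ M, ∃ v ∈ M, k ◃ remSum (T q n) m = 0 ∧ x = k + v ◃ insSum (T q n) 0 m := by
  set A : Hecke q n := remSum (T q n) m * insSum (T q n) 0 m with hA
  have hadj : IsAdj A A := (IsAdj.insSum m).symm.mul (IsAdj.insSum m)
  set f : M →ₗ[K] M := (rightAct q A).restrict (hM A) with hf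
  have hfv : ∀ v : M, (f v : Words K n) = v.1 ◃ A := fun v => rfl
  obtain ⟨k, v, hk, hkv⟩ := exists_eq_ker_add_range (K := K) (E := M) (f := f) (fun w hw => by
    rw [Subtype.ext_iff, hfv, hfv] at hw
    exact Subtype.ext ((hfv w).trans (act_eq_zero_of_act_act hq hadj hw))) ⟨x, hx⟩
  refine ⟨k, k.2, v.1 ◃ remSum (T q n) m, hM _ _ v.2, ?_, ?_⟩
  · rw [Subtype.ext_iff, hfv, hA, act_mul] at hk
    rw [← form_self_eq_zero hq, ← IsAdj.insSum, hk]
    simp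
  · have := congrArg Subtype.val hkv
    rw [Submodule.coe_add, hfv, hA, act_mul] at this
    exact this

/-- A finite-dimensional stable space is the sum of the kernel of `B*_m` and the image of its adjoint
`B_m`; iteration for `m, m - 1, …` gives the spanning set. -/
theorem mem_span_insProd (hq : 0 < q) {M : Submodule K (Words K n)} [FiniteDimensional K M]
    (hM : ∀ h : Hecke q n, ∀ v ∈ M, v ◃ h ∈ M) (m : ℕ) {x : Words K n} (hx : x ∈ M) :
    x ∈ Submodule.span K {y | ∃ j ≤ m, ∃ u ∈ M, u ◃ remSum (T q n) j = 0 ∧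
      y = u ◃ insProd (T q n) m (m - j)} := by
  induction m generalizing x with
  | zero => exact Submodule.subset_span ⟨0, le_rfl, x, hx, by simp [remSum], by simp [insProd]⟩
  | succ m ih =>
    obtain ⟨k, hk, v, hv, h0, rfl⟩ := exists_eq_add_act_insSum hq hM (m + 1) hx
    refine Submodule.add_mem _ (Submodule.subset_span ⟨m + 1, le_rfl, k, hk, h0, by
      rw [Nat.sub_self, insProd_zero, act_one]⟩) ?_
    have := Submodule.mem_map_of_mem (f := rightAct q (insSum (T q n) 0 (m + 1))) (ih hv)
    rw [Submodule.map_span] at this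
    refine Submodule.span_mono ?_ this
    rintro _ ⟨_, ⟨j, hj, u, hu, hu0, rfl⟩, rfl⟩
    refine ⟨j, by omega, u, hu, hu0, ?_⟩
    rw [show m + 1 - j = (m - j) + 1 by omega, insProd_succ, act_mul]
    rfl

end Level

section SpechtSpan

set_option linter.unusedSectionVars false

variable {K : Type*} [Field K] {q : K} [LinearOrder K] [IsStrictOrderedRing K]
  {lam mu : YoungDiagram}

lemma finiteDimensional_specht (hq : 0 < q) (lam : YoungDiagram) :
    FiniteDimensional K (specht q lam) := by
  rw [specht_eq hq.ne']
  refine FiniteDimensional.span_of_finite K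
    (((stdLists lam.cells).image (unit q lam.card)).finite_toSet.subset ?_)
  rintro _ ⟨l, hl, rfl⟩
  exact Finset.mem_coe.2 (Finset.mem_image_of_mem _ hl)

lemma levelVec_lift (hq : 0 < q) (hle : mu ≤ lam) {u : Words K mu.card} (hu : u ∈ spechtKer q mu) :
    LevelVec q (specht q lam) mu.cells ((skewList lam mu).map content) (lift q lam mu u) := by
  rw [mem_spechtKer hq] at hu
  obtain ⟨h1, h2, h3⟩ := lift_mem hq hle hu.1
  refine ⟨h1, ?_, h3, h2⟩
  have := lift_act_remSum hq hle u
  rw [hu.2, map_zero] at this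
  exact this

/-- The vectors at the level of `mu` with row-reading contents are the lifts of vectors of the Specht
module of `mu` that are annihilated by the removal of a letter. -/
lemma exists_lift_of_levelVec (hq : 0 < q) (hle : mu ≤ lam) {x : Words K lam.card}
    (hx : LevelVec q (specht q lam) mu.cells ((skewList lam mu).map content) x) :
    ∃ u ∈ spechtKer q mu, lift q lam mu u = x := by
  obtain ⟨h1, h2, h3, h4⟩ := hx
  obtain ⟨u, hu, rfl⟩ := exists_lift_eq hq hle h1 h4 h3
  refine ⟨u, (mem_spechtKer hq).2 ⟨hu, ?_⟩, rfl⟩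
  refine lift_eq_zero hq hle (specht_act hq mu _ u hu) ?_
  rw [← lift_act_remSum hq hle]
  exact h2

/-- The vectors attached to a skew shape with two cells in one column vanish: after an admissible
reordering these cells are consecutive, and a generator acts by `-1` and by `q`. -/
lemma eigenvec_eq_zero (hq : 0 < q) (hle : mu ≤ lam) (hh : ¬ IsHorizontalStrip lam mu)
    {u : Words K mu.card} (hu : u ∈ spechtKer q mu) : eigenvec q lam mu u = 0 := by
  obtain ⟨x, x', hx, hx', hxx⟩ : ∃ x x' : ℕ × ℕ, x ∈ skewList lam mu ∧ x' ∈ skewList lam mu ∧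
      x' = (x.1 + 1, x.2) := by
    have : ∃ c ∈ lam.cells \ mu.cells, ∃ d ∈ lam.cells \ mu.cells, c.2 = d.2 ∧ c.1 < d.1 := by
      rw [IsHorizontalStrip, not_and] at hh
      have := hh hle
      push Not at this
      obtain ⟨c, hc, d, hd, h1, h2⟩ := this
      rcases lt_trichotomy c.1 d.1 with h | h | h
      · exact ⟨c, hc, d, hd, h1, h⟩
      · exact absurd (Prod.ext h h1) h2
      · exact ⟨d, hd, c, hc, h1.symm, h⟩
    obtain ⟨c, hc, d, hd, h1, h2⟩ := this
    rw [Finset.mem_sdiff] at hc hd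
    refine ⟨c, (c.1 + 1, c.2), mem_skewList.2 hc, mem_skewList.2 ⟨?_, fun h => hc.2 ?_⟩, rfl⟩
    · exact lam.isLowerSet (Prod.le_def.2 ⟨h2, h1.le⟩ : (c.1 + 1, c.2) ≤ d) hd.1
    · exact mu.isLowerSet (Prod.le_def.2 ⟨Nat.le_succ _, le_rfl⟩ : c ≤ (c.1 + 1, c.2)) h
  obtain ⟨l, hl⟩ := stdLists_nonempty mu
  have hstd := (mem_stdLists.1 (skewList_append_mem hle hl)).1
  have hcov : x ⋖ x' := by
    rw [hxx]; exact Prod.mk_covBy_mk_iff_left.2 (Nat.covBy_iff_add_one_eq.2 rfl)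
  obtain ⟨t, w, hw⟩ := List.append_of_mem hx'
  rw [hw] at hstd
  have hxw : x ∈ w := by
    have h1 : Std (x' :: (w ++ l)) := Std.of_append (s := t) (by simpa using hstd)
    rcases List.mem_append.1 ((std_cons.1 h1).2.2 x hcov.lt) with h | h
    · exact h
    · rw [← List.mem_toFinset, (mem_stdLists.1 hl).2] at h
      exact absurd h (mem_skewList.1 hx).2
  obtain ⟨s, r, rfl⟩ := List.append_of_mem hxw
  obtain ⟨A, B, h1, h2⟩ := Std.make_adjacent (s := s) (l := r ++ l) hcov
    (Std.of_append (s := t) (by simpa using hstd))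
  have hadm : Adm (skewList lam mu) (t ++ (B ++ x' :: x :: A) ++ r) := by
    have h3 : Adm (x' :: (s ++ [x])) (B ++ x' :: x :: A) :=
      Std.adm (l := r ++ l) (Std.of_append (s := t) (by simpa using hstd)) (by simpa using h1) h2
    have h4 : ∀ t : List (ℕ × ℕ), Adm (t ++ (x' :: (s ++ [x]))) (t ++ (B ++ x' :: x :: A)) := by
      intro t
      induction t with
      | nil => exact h3
      | cons b t ih => exact ih.cons b
    have := (h4 t).append_right r
    rw [hw]
    simpa using this
  have hlen : mu.card + (skewList lam mu).length = lam.card := by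
    have := length_skewList hle
    have := card_le_of_le hle
    omega
  obtain ⟨y, c, hc, hy, e, -⟩ := hadm.exists_levelVec hq (specht_act hq lam) hlen.le
    (levelVec_lift hq hle hu)
  have hlen2 := hadm.perm.length_eq
  simp only [List.length_append, List.length_cons] at hlen2
  have hye := hy.eig
  simp only [List.map_append, List.map_cons, List.append_assoc, List.cons_append] at hye
  rw [← List.append_assoc (t.map content)] at hye
  obtain ⟨h5, h6⟩ := eig_consecutive hye rfl
  simp only [List.length_append, List.length_map] at h5 h6
  have hcard : mu.cells.card = mu.card := rfl
  rw [hcard] at h5 h6 e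
  set i := mu.card + (A.length + r.length) + 1 with hi
  have h7 := act_T_of_content_pred hq (by omega) (by omega) h5 h6
    (by rw [hxx]; simp only [content]; push_cast; ring)
  have hcomm := (isHecke q lam.card).t_mul_insProd (m := lam.card) (k := lam.card - mu.card)
    (i := i) (by omega) (by omega) le_rfl (by omega)
  have h8 := congrArg (y ◃ ·) hcomm
  simp only [act_mul, act_smul] at h8
  rw [h7, ← neg_one_smul K y, smul_act, ← sub_eq_zero, ← sub_smul] at h8
  have h9 := (smul_eq_zero.1 h8).resolve_left (by linarith)
  rw [eigenvec_eq hq]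
  rw [h9] at e
  exact (smul_eq_zero.1 e.symm).resolve_left hc

/-- The spanning set of `mem_span_insProd` can be restricted to lifts: the order of the cells of the
skew shape is irrelevant up to a factor, and only horizontal strips contribute. -/
theorem specht_le_span (hq : 0 < q) (lam : YoungDiagram) {x : Words K lam.card}
    (hx : x ∈ specht q lam) : x ∈ Submodule.span K {y | ∃ mu : YoungDiagram,
      IsHorizontalStrip lam mu ∧ ∃ u ∈ spechtKer q mu, y = eigenvec q lam mu u} := by
  have hfd := finiteDimensional_specht hq lam
  have hM := specht_act hq lam
  refine Submodule.span_le.2 ?_ (mem_span_insProd hq hM lam.card hx)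
  rintro _ ⟨j, hj, x, hx, hxj, rfl⟩
  refine level_induction hq hM hj le_rfl (C := fun x => x ◃ insProd (T q lam.card) lam.card
    (lam.card - j) ∈ Submodule.span K _) (by simp) (fun v u h1 h2 => by
      rw [add_act]; exact Submodule.add_mem _ h1 h2) ?_ hx hxj
  intro μ t x hμ ht hst hx hx0
  subst hμ
  obtain ⟨l, hl, hxl⟩ := exists_act_proj_ne_zero (hx.shape.symm ▸ hx0)
  have hlen := length_of_mem_stdLists hl
  have hstd := hst l hl
  have hcard : (t ++ l).length = lam.card := by simp; omega
  -- a joint eigenvector in the Specht module has the contents of a filling of its shape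
  have hset : (t ++ l).toFinset = lam.cells := by
    by_contra hne
    have h0 := (specht_act_proj hq (hM (proj q lam.card l) _ hx.mem) hstd hcard).2 hne
    have hmem : x ◃ proj q lam.card l ∈ eig q lam.card 0 ((t ++ l).map content) := by
      rw [List.map_append, mem_eig_append, List.length_map, zero_add, hlen]
      refine ⟨act_proj_mem hq (mem_stdLists.1 hl).1 (by omega) x, act_mem_eig hx.eig fun k _ hk => ?_⟩
      rw [List.length_map] at hk
      exact (commute_proj hq.ne' (by omega) (by omega)).symm
    rw [act_proj_of_mem hq hstd hcard.le hmem] at h0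
    exact hxl h0
  obtain ⟨hl1, hl2⟩ := mem_stdLists.1 hl
  have hmemt : ∀ y, y ∈ t ↔ y ∈ lam.cells ∧ y ∉ μ := by
    intro y
    rw [← hset, ← hl2, List.mem_toFinset, List.mem_toFinset, List.mem_append]
    have hnd := (List.nodup_append.1 hstd.nodup).2.2
    constructor
    · exact fun h => ⟨Or.inl h, fun h' => hnd y h y h' rfl⟩
    · rintro ⟨h | h, h'⟩
      · exact h
      · exact absurd h h'
  set mu : YoungDiagram := ⟨μ, fun a b hba ha => by
    rw [Finset.mem_coe, ← hl2, List.mem_toFinset] at ha ⊢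
    exact hl1.2 a ha b hba⟩ with hmu
  have hle : mu ≤ lam := by
    intro y hy
    have : y ∈ μ := hy
    rw [← hl2, List.mem_toFinset] at this
    change y ∈ lam.cells
    rw [← hset, List.mem_toFinset, List.mem_append]
    exact Or.inr this
  have hstd' := (mem_stdLists.1 (skewList_append_mem hle hl)).1
  have hperm : t.Perm (skewList lam mu) := by
    refine (List.perm_ext_iff_of_nodup (List.nodup_append.1 hstd.nodup).1
      (List.nodup_append.1 hstd'.nodup).1).2 fun y => ?_
    rw [hmemt, mem_skewList]
  obtain ⟨y, c, hc, hy, e, -⟩ := (Std.adm hstd hstd' hperm).exists_levelVec hq hM (by omega) hx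
  obtain ⟨u, hu, rfl⟩ := exists_lift_of_levelVec (mu := mu) hq hle hy
  have e' : eigenvec q lam mu u = c • x ◃ insProd (T q lam.card) lam.card (lam.card - μ.card) := by
    rw [eigenvec_eq hq]; exact e
  have : x ◃ insProd (T q lam.card) lam.card (lam.card - μ.card) =
      c⁻¹ • eigenvec q lam mu u := by rw [e', smul_smul, inv_mul_cancel₀ hc, one_smul]
  rw [this]
  refine Submodule.smul_mem _ _ ?_
  by_cases hh : IsHorizontalStrip lam mu
  · exact Submodule.subset_span ⟨mu, hh, u, hu, rfl⟩
  · rw [eigenvec_eq_zero hq hle hh hu]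
    exact Submodule.zero_mem _

end SpechtSpan

/-! ### Independence of the eigenvectors -/

section Symmetrization

set_option linter.unusedSectionVars false

variable {K : Type*} [Field K] {q : K} {n : ℕ}

variable (q n) in
/-- The span of the joint eigenspaces of `J_{j+1}, J_{j+2}, …` for all rearrangements of a list of
contents. -/
noncomputable def permSpace (j : ℕ) (s : List ℤ) : Submodule K (Words K n) :=
  Submodule.span K {v | ∃ s', s'.Perm s ∧ v ∈ eig q n j s'}

lemma eig_le_permSpace {j : ℕ} {s : List ℤ} {v : Words K n} (hv : v ∈ eig q n j s) :
    v ∈ permSpace q n j s := Submodule.subset_span ⟨s, List.Perm.refl s, hv⟩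

lemma act_insSum_mem {S : Submodule K (Words K n)} {j m : ℕ}
    (hS : ∀ v ∈ S, ∀ i, j < i → i < m → v ◃ T q n i ∈ S) :
    ∀ v ∈ S, v ◃ insSum (T q n) j m ∈ S := by
  induction m with
  | zero => intro v _; simp [insSum]
  | succ m ih =>
    intro v hv
    have ih := ih fun v hv i h1 h2 => hS v hv i h1 (by omega)
    rcases lt_trichotomy j m with h | h | h
    · rw [insSum_succ h.le, act_add, act_one, act_mul]
      exact S.add_mem hv (ih _ (hS v hv m h (by omega)))
    · subst h
      rw [insSum_succ le_rfl, insSum_of_le le_rfl, mul_zero, add_zero, act_one]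
      exact hv
    · rw [insSum_of_le (by omega)]
      simp

lemma act_symm_mem {S : Submodule K (Words K n)} {j m : ℕ}
    (hS : ∀ v ∈ S, ∀ i, j < i → i < m → v ◃ T q n i ∈ S) :
    ∀ v ∈ S, v ◃ symm (T q n) j m ∈ S := by
  induction m with
  | zero => intro v hv; simpa [symm] using hv
  | succ m ih =>
    intro v hv
    rcases le_or_gt j m with h | h
    · rw [symm_succ h, act_mul]
      exact act_insSum_mem hS _ (ih (fun v hv i h1 h2 => hS v hv i h1 (by omega)) v hv)
    · rw [symm_of_le (by omega), act_one]
      exact hv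

/-- The scalar by which the product of the shifted Jucys--Murphy elements acts; it depends only on
the multiset of the contents. -/
lemma act_jmProd (hq : q ≠ 0) {j : ℕ} {s : List ℤ} {v : Words K n} (hv : v ∈ eig q n j s) :
    v ◃ jmProd q (T q n) (j + s.length) s.length =
      (qFactorial q s.length * (s.map fun c => qInt q ((j : ℤ) + 1 + c)).prod) • v := by
  induction s with
  | nil => simp [jmProd_zero, qFactorial]
  | cons c s ih =>
    rw [mem_eig_cons] at hv
    rw [List.length_cons, ← add_assoc, jmProd, act_smul, act_mul, act_sub, xm, act_add, act_smul,
      act_one, act_smul, hv.2, act_smul, act_one, smul_smul, ← add_smul, ← sub_smul, smul_act,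
      ih hv.1, smul_smul, smul_smul, List.map_cons, List.prod_cons, qFactorial_succ]
    congr 1
    have e1 : qInt q ((j + s.length + 1 : ℕ) : ℤ) + q ^ (j + s.length + 1) * qInt q c =
        qInt q (s.length + ((j : ℤ) + 1 + c)) := by
      rw [← zpow_natCast, ← qInt_add hq]
      congr 1
      push_cast
      ring
    rw [e1, qInt_add hq (s.length : ℤ) ((j : ℤ) + 1 + c), zpow_natCast, add_sub_cancel_left]
    have : q ^ s.length ≠ 0 := pow_ne_zero _ hq
    field_simp

variable [LinearOrder K] [IsStrictOrderedRing K]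

lemma permSpace_act_T (hq : 0 < q) {j i : ℕ} {s : List ℤ} (hs : s.Nodup) (hn : j + s.length ≤ n)
    {v : Words K n} (hv : v ∈ permSpace q n j s) (hj : j < i) (hi : i < j + s.length) :
    v ◃ T q n i ∈ permSpace q n j s := by
  rw [permSpace] at hv
  induction hv using Submodule.span_induction with
  | mem v hv =>
    obtain ⟨s', hp, hv⟩ := hv
    have hlen := hp.length_eq
    obtain ⟨p, b, a, r, rfl, hr⟩ := exists_split_two (l := s') (i := i - 1 - j) (by omega)
    have hab : a ≠ b := by
      rintro rfl
      have := (List.nodup_append.1 ((hp.nodup_iff).2 hs)).2.1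
      simp at this
    rw [List.length_append, List.length_cons, List.length_cons] at hlen
    have h1 := swapVec_mem_eig hq hv hab (by omega) (i := i) (by omega)
    have : v ◃ T q n i = swapVec q i a b v + diagCoef q a b • v := by rw [swapVec]; abel
    rw [this]
    refine Submodule.add_mem _ (Submodule.subset_span ⟨_, ?_, h1⟩)
      (Submodule.smul_mem _ _ (Submodule.subset_span ⟨_, hp, hv⟩))
    exact ((List.Perm.swap _ _ _).append_left p).trans hp
  | zero => simp
  | add v u _ _ h1 h2 => rw [add_act]; exact Submodule.add_mem _ h1 h2
  | smul c v _ h => rw [smul_act]; exact Submodule.smul_mem _ _ h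

lemma permSpace_act_jmProd (hq : q ≠ 0) {j : ℕ} {s : List ℤ} {v : Words K n}
    (hv : v ∈ permSpace q n j s) : v ◃ jmProd q (T q n) (j + s.length) s.length =
      (qFactorial q s.length * (s.map fun c => qInt q ((j : ℤ) + 1 + c)).prod) • v := by
  rw [permSpace] at hv
  induction hv using Submodule.span_induction with
  | mem v hv =>
    obtain ⟨s', hp, hv⟩ := hv
    have := act_jmProd hq hv
    rwa [hp.length_eq, (hp.map _).prod_eq] at this
  | zero => simp
  | add v u _ _ h1 h2 => rw [add_act, h1, h2, smul_add]
  | smul c v _ h => rw [smul_act, h, smul_comm]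

/-- If the generators act on `z` by `q`, then the adjoint of `insSum` acts on `z` by `[m - j]_q`. -/
lemma form_act_insSum (hq : q ≠ 0) {j m : ℕ} {z : Words K n}
    (hz : ∀ i, j < i → i < m → z ◃ T q n i = q • z) (hj : j ≤ m) (y : Words K n) :
    form q (y ◃ insSum (T q n) j m) z = qInt q ((m : ℤ) - j) * form q y z := by
  induction m, hj using Nat.le_induction generalizing y with
  | base => simp [insSum_of_le, qInt_zero]
  | succ m hj ih =>
    rw [insSum_succ hj, act_add, act_one, act_mul, map_add, LinearMap.add_apply,
      ih (fun i h1 h2 => hz i h1 (by omega))]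
    rcases eq_or_lt_of_le hj with rfl | h
    · simp [qInt_zero, qInt_one]
    · rw [IsAdj.T, hz m h (by omega), map_smul, smul_eq_mul,
        show ((m + 1 : ℕ) : ℤ) - j = (m - j) + 1 by push_cast; ring, qInt_succ hq]
      ring

/-- If the content of the step `m + 1` exceeds the contents of all preceding steps, then `T_m` has a
nonnegative diagonal coefficient. -/
lemma form_act_T_nonneg (hq : 0 < q) {j : ℕ} {c₀ : ℤ} {s : List ℤ} {b : ℤ}
    (hn : j + s.length + 1 < n) (hb : ∀ c ∈ c₀ :: s, c < b ∧ |c| < n) {z : Words K n}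
    (hz : z ∈ permSpace q n j (c₀ :: s))
    (hJ : z ◃ Jm q n (j + s.length + 1 + 1) = qInt q b • z) :
    0 ≤ form q (z ◃ T q n (j + s.length + 1)) z := by
  set m := j + s.length + 1 with hm
  have hgen : ∀ v : Words K n, (∃ s', s'.Perm (c₀ :: s) ∧ v ∈ eig q n j s') →
      ∃ c ∈ c₀ :: s, v ◃ Jm q n m = qInt q c • v := by
    rintro v ⟨s', hp, hv⟩
    obtain ⟨c, s', rfl⟩ := List.exists_cons_of_length_eq_add_one (hp.length_eq)
    have hlen := hp.length_eq
    rw [List.length_cons, List.length_cons] at hlen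
    rw [mem_eig_cons, show j + s'.length + 1 = m by omega] at hv
    exact ⟨c, hp.subset List.mem_cons_self, hv.2⟩
  have hzero : ∀ z ∈ permSpace q n j (c₀ :: s), ∀ c : ℤ, |c| < n → c ∉ c₀ :: s →
      z ◃ Polynomial.aeval (Jm q n m) (lagr q n c) = 0 := by
    intro z hz c hcn hc
    rw [permSpace] at hz
    induction hz using Submodule.span_induction with
    | mem v hv =>
      obtain ⟨c', hc', hv⟩ := hgen v hv
      rw [act_aeval_of_eigen hv, eval_lagr hq hcn (hb c' hc').2, if_neg, zero_smul]
      rintro rfl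
      exact hc hc'
    | zero => simp
    | add v u _ _ h1 h2 => rw [add_act, h1, h2, add_zero]
    | smul c v _ h => rw [smul_act, h, smul_zero]
  have horth : ∀ z ∈ permSpace q n j (c₀ :: s), ∀ w : Words K n,
      w ◃ Jm q n m = qInt q b • w → form q w z = 0 := by
    intro z hz w hw
    rw [permSpace] at hz
    induction hz using Submodule.span_induction with
    | mem v hv =>
      obtain ⟨c, hc, hv⟩ := hgen v hv
      exact form_eq_zero_of_ne (IsAdj.jm m)
        ((qInt_strictMono hq).injective.ne (hb c hc).1.ne') hw hv
    | zero => simp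
    | add v u _ _ h1 h2 => rw [map_add, h1, h2, add_zero]
    | smul c v _ h => rw [map_smul, h, smul_zero]
  have hsum := sum_act_lagr hq (h := Jm q n m) (m := n) (by omega) z
  have e : form q (z ◃ T q n m) z = ∑ c ∈ Finset.Ioo (-(n : ℤ)) n,
      form q (z ◃ Polynomial.aeval (Jm q n m) (lagr q n c) ◃ T q n m) z := by
    rw [← LinearMap.sum_apply, ← map_sum, ← sum_act, hsum]
  rw [e]
  refine Finset.sum_nonneg fun c hc => ?_
  have hc' : |c| < n := by rw [abs_lt]; exact Finset.mem_Ioo.1 hc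
  by_cases hcs : c ∈ c₀ :: s
  swap
  · rw [hzero z hz c hc' hcs]; simp
  have hv1 := act_lagr_act (act_specPoly_self hq (m := m) (by omega) (by omega) z) hc'
  have hv2 : z ◃ Polynomial.aeval (Jm q n m) (lagr q n c) ◃ Jm q n (m + 1) =
      qInt q b • z ◃ Polynomial.aeval (Jm q n m) (lagr q n c) := by
    rw [act_comm z (commute_aeval ((isHecke q n).jm_commute_jm hq.ne' (by omega) (by omega))
      _).symm, hJ, smul_act]
  have hv3 : form q (z ◃ Polynomial.aeval (Jm q n m) (lagr q n c)) z =
      form q (z ◃ Polynomial.aeval (Jm q n m) (lagr q n c))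
        (z ◃ Polynomial.aeval (Jm q n m) (lagr q n c)) := by
    rw [← ((IsAdj.jm m).aeval (lagr q n c)), act_aeval_of_eigen hv1, eval_lagr hq hc' hc',
      if_pos rfl, one_smul]
  set v := z ◃ Polynomial.aeval (Jm q n m) (lagr q n c)
  have hcb := (hb c hcs).1
  have h1 : v ◃ T q n m = swapVec q m c b v + diagCoef q c b • v := by rw [swapVec]; abel
  rw [h1, map_add, LinearMap.add_apply, map_smul, LinearMap.smul_apply,
    horth z hz _ (swapVec_act_Jm hq (by omega) (by omega) hv1 hv2 hcb.ne), zero_add, hv3, smul_eq_mul]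
  exact mul_nonneg (diagCoef_pos hq hcb).le (form_self_nonneg hq v)

/-- Symmetrizing a joint eigenvector with increasing contents does not annihilate it. -/
theorem act_symm_ne_zero (hq : 0 < q) {j : ℕ} {s : List ℤ} (hn : j + s.length ≤ n)
    (hs : s.Pairwise (· > ·)) (hb : ∀ c ∈ s, |c| < n) {x : Words K n} (hx : x ∈ eig q n j s)
    (hx0 : x ≠ 0) : x ◃ symm (T q n) j (j + s.length) ≠ 0 := by
  induction s with
  | nil => rw [List.length_nil, symm_of_le (by omega), act_one]; exact hx0
  | cons b s ih =>
    have H := isHecke q n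
    rw [List.length_cons] at hn ⊢
    rw [mem_eig_cons] at hx
    rw [List.pairwise_cons] at hs
    have ih := ih (by omega) hs.2 (fun c hc => hb c (List.mem_cons_of_mem _ hc)) hx.1
    rw [← add_assoc, symm_succ (by omega), act_mul]
    set m := j + s.length with hm
    set z := x ◃ symm (T q n) j m with hz
    have hzT : ∀ i, j < i → i < m → z ◃ T q n i = q • z := fun i h1 h2 => by
      rw [hz, ← act_mul, H.symm_mul_t h1 h2 (by omega), act_smul]
    have hzJ : z ◃ Jm q n (m + 1) = qInt q b • z := by
      have hc : Commute (Jm q n (m + 1)) (symm (T q n) j m) :=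
        commute_symm fun i h1 h2 => (H.t_commute_jm_of_gt hq.ne' (by omega) (by omega) (by omega)).symm
      rw [hz, ← act_comm x hc, hx.2, smul_act]
    intro h0
    have e1 : form q (z ◃ insSum (T q n) j (m + 1)) z =
        form q z z + qInt q ((m : ℤ) - j) * form q (z ◃ T q n m) z := by
      rw [insSum_succ (by omega), act_add, act_one, act_mul, map_add, LinearMap.add_apply,
        form_act_insSum hq.ne' hzT (by omega)]
    rw [h0, map_zero, LinearMap.zero_apply] at e1
    have e2 := form_self_pos hq ih
    have e3 : 0 ≤ qInt q ((m : ℤ) - j) * form q (z ◃ T q n m) z := by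
      cases s with
      | nil => simp [hm, qInt_zero]
      | cons c s =>
        rw [List.length_cons, ← add_assoc] at hm
        have hnd : (c :: s).Nodup := hs.2.imp fun h => ne_of_gt h
        refine mul_nonneg (qInt_pos hq (by omega)).le ?_
        have hmem : z ∈ permSpace q n j (c :: s) :=
          act_symm_mem (fun v hv i h1 h2 => permSpace_act_T hq hnd (by simp; omega) hv h1
            (by simp; omega)) _ (eig_le_permSpace hx.1)
        rw [hm]
        exact form_act_T_nonneg hq (by omega) (b := b)
          (fun c' hc' => ⟨hs.1 c' hc', hb c' (List.mem_cons_of_mem _ hc')⟩) hmem (by rw [← hm]; exact hzJ)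
    linarith

/-- Removing after inserting acts by a scalar on symmetrized vectors that are annihilated by
`B*_j`. -/
lemma symm_act_insProd_act_remProd (hq : 0 < q) {j : ℕ} {s : List ℤ} (hn : j + s.length = n)
    (hs : s.Nodup) {x : Words K n} (hx : x ∈ eig q n j s) (hxj : x ◃ remSum (T q n) j = 0) :
    x ◃ symm (T q n) j n ◃ (insProd (T q n) n (n - j) * remProd (T q n) n (n - j)) =
      (qFactorial q s.length * (s.map fun c => qInt q ((j : ℤ) + 1 + c)).prod) •
        x ◃ symm (T q n) j n := by
  have H := isHecke q n
  obtain ⟨r, hr⟩ := H.mul_insProd_mul_remProd hq.ne' (j := j) (k := n - j) (m := n) (by omega) le_rfl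
    (z := symm (T q n) j n)
    (commute_symm (fun i h1 h2 => (T_commute_remSum h1 h2).symm)).symm
    (fun i h1 h2 => H.symm_mul_t h1 h2 le_rfl)
  rw [← act_mul, hr, act_add, act_mul, act_mul _ (remSum _ _), hxj, zero_act, add_zero]
  have hmem : x ◃ symm (T q n) j n ∈ permSpace q n j s :=
    act_symm_mem (fun v hv i h1 h2 => permSpace_act_T hq hs hn.le hv h1 (by omega)) _
      (eig_le_permSpace hx)
  have := permSpace_act_jmProd hq.ne' hmem
  have hk : n - j = s.length := by omega
  rw [hn] at this
  rw [hk]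
  exact this

end Symmetrization

section Independence

set_option linter.unusedSectionVars false

variable {K : Type*} [Field K] {q : K} [LinearOrder K] [IsStrictOrderedRing K]
  {lam mu : YoungDiagram}

/-- The cells of a horizontal strip, listed from left to right. -/
lemma IsHorizontalStrip.exists_sorted (h : IsHorizontalStrip lam mu) {l : List (ℕ × ℕ)}
    (hl : l ∈ stdLists mu.cells) : ∃ t, (skewList lam mu).Perm t ∧ Std (t ++ l) ∧
      (t.map content).Pairwise (· > ·) := by
  obtain ⟨hle, hh⟩ := h
  set t := (skewList lam mu).insertionSort (fun x y => y.2 ≤ x.2) with ht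
  have hp : (skewList lam mu).Perm t := (List.perm_insertionSort _ _).symm
  have hsort : t.Pairwise (fun x y => y.2 ≤ x.2) := by
    have : Std.Total (fun x y : ℕ × ℕ => y.2 ≤ x.2) := ⟨fun x y => Nat.le_total _ _⟩
    have : IsTrans (ℕ × ℕ) (fun x y : ℕ × ℕ => y.2 ≤ x.2) := ⟨fun x y z h1 h2 => h2.trans h1⟩
    exact List.pairwise_insertionSort _ _
  have hstd := (mem_stdLists.1 (skewList_append_mem hle hl)).1
  have hnd : t.Nodup := (hp.nodup_iff).1 (List.nodup_append.1 hstd.nodup).1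
  have hmem : ∀ x, x ∈ t → x ∈ lam.cells ∧ x ∉ mu.cells := fun x hx =>
    mem_skewList.1 (hp.mem_iff.2 hx)
  have key : ∀ x ∈ t, ∀ y ∈ t, y.2 ≤ x.2 → x ≠ y → y.2 < x.2 ∧ x.1 ≤ y.1 := by
    intro x hx y hy h1 hne
    have hx' := hmem x hx
    have hy' := hmem y hy
    have h2 : y.2 ≠ x.2 := fun e => hne
      (hh y (Finset.mem_sdiff.2 hy') x (Finset.mem_sdiff.2 hx') e).symm
    refine ⟨lt_of_le_of_ne h1 h2, ?_⟩
    by_contra hcon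
    push Not at hcon
    -- otherwise the strip contains a second cell in the column of `y`
    have h3 : (x.1, y.2) ∈ lam.cells \ mu.cells := by
      rw [Finset.mem_sdiff]
      refine ⟨lam.isLowerSet (Prod.le_def.2 ⟨le_rfl, h1⟩ : (x.1, y.2) ≤ x) hx'.1, fun h => hy'.2 ?_⟩
      exact mu.isLowerSet (Prod.le_def.2 ⟨hcon.le, le_rfl⟩ : y ≤ (x.1, y.2)) h
    have h4 := hh y (Finset.mem_sdiff.2 hy') _ h3 rfl
    rw [h4] at hcon
    exact lt_irrefl _ hcon
  have hall : t.Pairwise (fun x y => y.2 < x.2 ∧ x.1 ≤ y.1) := by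
    have h1 := hsort.and hnd
    exact h1.imp_of_mem fun {x y} hx hy h => key x hx y hy h.1 h.2
  refine ⟨t, hp, ⟨?_, ?_⟩, ?_⟩
  · have h1 := hstd.1
    rw [List.pairwise_append] at h1 ⊢
    refine ⟨hall.imp fun {x y} h hxy => ?_, h1.2.1, fun x hx y hy => h1.2.2 x (hp.mem_iff.2 hx) y hy⟩
    exact absurd h.1 hxy.2.not_gt
  · have hp' := hp.append_right l
    exact fun x hx y hy => hp'.mem_iff.1 (hstd.2 x (hp'.mem_iff.2 hx) y hy)
  · rw [List.pairwise_map]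
    refine hall.imp fun {x y} h => ?_
    simp only [content]
    omega

lemma remProd_add {A : Type*} [Ring A] (t : ℕ → A) {m k : ℕ} (l : ℕ) (hk : k ≤ m) :
    remProd t m (k + l) = remProd t m k * remProd t (m - k) l := by
  induction k generalizing m with
  | zero => simp [remProd_zero]
  | succ k ih =>
    obtain ⟨m, rfl⟩ : ∃ a, m = a + 1 := ⟨m - 1, by omega⟩
    rw [show k + 1 + l = (k + l) + 1 by omega, remProd_succ, remProd_succ, ih (by omega), mul_assoc,
      Nat.add_sub_add_right]

/-- Removing all cells of a horizontal strip from an eigenvector gives a vector of the isotypic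
component of the smaller shape, annihilated by the next removal and nonzero unless `u = 0`. -/
lemma eigenvec_act_remProd (hq : 0 < q) (hh : IsHorizontalStrip lam mu) {u : Words K mu.card}
    (hu : u ∈ spechtKer q mu) :
    eigenvec q lam mu u ◃ remProd (T q lam.card) lam.card (lam.card - mu.card) ◃
        shapeProj q lam.card mu.cells =
      eigenvec q lam mu u ◃ remProd (T q lam.card) lam.card (lam.card - mu.card) ∧
    eigenvec q lam mu u ◃ remProd (T q lam.card) lam.card (lam.card - mu.card) ◃
        remSum (T q lam.card) mu.card = 0 ∧
    (eigenvec q lam mu u ◃ remProd (T q lam.card) lam.card (lam.card - mu.card) = 0 → u = 0) := by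
  have H := isHecke q lam.card
  have hle := hh.1
  have hc := card_le_of_le hle
  have hcard : mu.cells.card = mu.card := rfl
  obtain ⟨l, hl⟩ := stdLists_nonempty mu
  have hlen : l.length = mu.card := length_of_mem_stdLists hl
  obtain ⟨t, hp, hstd, hsort⟩ := hh.exists_sorted hl
  have htl : t.length = lam.card - mu.card := by rw [← hp.length_eq, length_skewList hle]
  have hadm := Std.adm (mem_stdLists.1 (skewList_append_mem hle hl)).1 hstd hp
  obtain ⟨x, c, hc0, hx, e, hx0⟩ := hadm.exists_levelVec hq (specht_act hq lam)
    (by rw [hcard, length_skewList hle]; omega) (levelVec_lift hq hle hu)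
  obtain ⟨-, h2, h3, h4⟩ := hx
  rw [hcard] at h2 h4 e
  have hsl : (t.map content).length = lam.card - mu.card := by rw [List.length_map, htl]
  have hsn : mu.card + (t.map content).length = lam.card := by omega
  have hnd : (t.map content).Nodup := hsort.imp fun h => ne_of_gt h
  set z := x ◃ symm (T q lam.card) mu.card lam.card with hz
  -- Up to nonzero scalars, `z` gives the eigenvector by insertion, and removal gives back `z`.
  set κ := qFactorial q (t.map content).length *
    ((t.map content).map fun c => qInt q ((mu.card : ℤ) + 1 + c)).prod with hκ
  have hκ0 : κ ≠ 0 := by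
    refine mul_ne_zero (qFactorial_pos hq _).ne' (List.prod_ne_zero fun h0 => ?_)
    simp only [List.map_map, List.mem_map, Function.comp_apply] at h0
    obtain ⟨y, hy, hy0⟩ := h0
    refine absurd hy0 (qInt_pos hq ?_).ne'
    -- the cells above a cell of the strip belong to the smaller shape
    have hym := mem_skewList.1 (hp.mem_iff.2 hy)
    have hcol : (Finset.range y.1).image (fun i => (i, y.2)) ⊆ mu.cells := by
      intro w hw
      obtain ⟨i, hi, rfl⟩ := Finset.mem_image.1 hw
      rw [Finset.mem_range] at hi
      by_contra hcon
      have h5 := hh.2 (i, y.2) (Finset.mem_sdiff.2 ⟨lam.isLowerSet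
        (Prod.le_def.2 ⟨hi.le, le_rfl⟩ : (i, y.2) ≤ y) hym.1, hcon⟩) y (Finset.mem_sdiff.2 hym) rfl
      rw [← h5] at hi
      exact lt_irrefl _ hi
    have h6 := Finset.card_le_card hcol
    rw [Finset.card_image_of_injective _ (fun a b h => by simpa using h), Finset.card_range,
      hcard] at h6
    simp only [content]
    omega
  have e1 : z ◃ insProd (T q lam.card) lam.card (lam.card - mu.card) ◃
      remProd (T q lam.card) lam.card (lam.card - mu.card) = κ • z := by
    rw [← act_mul, hz, symm_act_insProd_act_remProd hq hsn hnd h4 h2]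
  have e2 : z ◃ insProd (T q lam.card) lam.card (lam.card - mu.card) =
      (qFactorial q (lam.card - mu.card) * c) • eigenvec q lam mu u := by
    rw [hz, ← act_mul, H.symm_mul_insProd hc le_rfl le_rfl, act_smul, e, eigenvec_eq hq, smul_smul]
  have hd : qFactorial q (lam.card - mu.card) * c ≠ 0 := mul_ne_zero (qFactorial_pos hq _).ne' hc0
  set d := qFactorial q (lam.card - mu.card) * c
  have e3 : eigenvec q lam mu u ◃ remProd (T q lam.card) lam.card (lam.card - mu.card) =
      (d⁻¹ * κ) • z := by
    rw [mul_smul, ← e1, e2, smul_act, smul_smul, inv_mul_cancel₀ hd, one_smul]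
  rw [e3]
  refine ⟨?_, ?_, fun h0 => ?_⟩
  · rw [smul_act, hz, ← act_comm x (commute_symm fun i h1 h2 =>
      (T_commute_shapeProj (μ := mu.cells) h1 h2).symm), h3]
  · rw [smul_act, hz, ← act_comm x (commute_symm fun i h1 h2 => (T_commute_remSum h1 h2).symm), h2]
    simp
  · by_contra hu0
    have hz0 : z = 0 :=
      (smul_eq_zero.1 h0).resolve_left (mul_ne_zero (inv_ne_zero hd) hκ0)
    have hb : ∀ c ∈ t.map content, |c| < (lam.card : ℤ) := by
      simp only [List.mem_map]
      rintro _ ⟨y, hy, rfl⟩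
      have := hstd.abs_content_lt (List.mem_append_left l hy)
      rw [List.length_append] at this
      omega
    refine act_symm_ne_zero hq hsn.le hsort hb h4
      (hx0 fun h => hu0 (lift_eq_zero hq hle ((mem_spechtKer hq).1 hu).1 h)) ?_
    rwa [hsn]

/-- Eigenvectors for different shapes are independent: the one with the smallest shape is detected
by removing cells. -/
theorem eigenvec_independent (hq : 0 < q) {I : Type*} {mu : I → YoungDiagram}
    (hmu : Function.Injective mu) (hh : ∀ i, IsHorizontalStrip lam (mu i))
    {u : ∀ i, Words K (mu i).card} (hu : ∀ i, u i ∈ spechtKer q (mu i)) {S : Finset I}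
    (hsum : ∑ i ∈ S, eigenvec q lam (mu i) (u i) = 0) : ∀ i ∈ S, u i = 0 := by
  suffices ∀ j, ∀ i ∈ S, (mu i).card = j → u i = 0 from fun i hi => this _ i hi rfl
  intro j
  induction j using Nat.strong_induction_on with
  | _ j ih =>
  rintro i₀ hi₀ rfl
  refine (eigenvec_act_remProd hq (hh i₀) (hu i₀)).2.2 ?_
  have h1 := congrArg (fun v => v ◃ remProd (T q lam.card) lam.card (lam.card - (mu i₀).card) ◃
    shapeProj q lam.card (mu i₀).cells) hsum
  simp only [sum_act, zero_act] at h1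
  rw [Finset.sum_eq_single i₀, (eigenvec_act_remProd hq (hh i₀) (hu i₀)).1] at h1
  · exact h1
  · intro i hi hne
    obtain ⟨e1, e2, -⟩ := eigenvec_act_remProd hq (hh i) (hu i)
    have hle := card_le_of_le (hh i).1
    -- smaller shapes have been treated, equally large ones are separated by their isotypic
    -- components, and larger ones are annihilated before all letters are removed
    rcases lt_trichotomy (mu i).card (mu i₀).card with h | h | h
    · rw [ih _ h i hi rfl, eigenvec]
      simp
    · rw [← h, ← e1]
      refine act_shapeProj_ne hq hle h.symm (fun e => hne (hmu ?_)) _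
      exact YoungDiagram.ext e
    · have e3 : lam.card - (mu i₀).card =
          (lam.card - (mu i).card) + ((mu i).card - (mu i₀).card) := by omega
      obtain ⟨a, ha⟩ : ∃ a, (mu i).card - (mu i₀).card = a + 1 :=
        ⟨(mu i).card - (mu i₀).card - 1, by omega⟩
      obtain ⟨b, hb⟩ : ∃ b, (mu i).card = b + 1 := ⟨(mu i).card - 1, by omega⟩
      rw [e3, remProd_add _ _ (by omega), act_mul, ha,
        show lam.card - (lam.card - (mu i).card) = b + 1 by omega, remProd_succ, act_mul, ← hb, e2]
      simp
  · exact fun h => absurd hi₀ h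

end Independence

/-! ### The eigenbasis of a Specht module -/

section SpechtBasis

variable {K : Type*} [Field K] [LinearOrder K] [IsStrictOrderedRing K] {q : K}

lemma eigenvec_mem_specht (hq : 0 < q) {lam mu : YoungDiagram} (hle : mu ≤ lam)
    {u : Words K mu.card} (hu : u ∈ spechtKer q mu) : eigenvec q lam mu u ∈ specht q lam := by
  rw [eigenvec_eq hq]
  exact specht_act hq lam _ _ (lift_mem hq hle ((mem_spechtKer hq).1 hu).1).1

lemma eigenvec_sum_smul (hq : 0 < q) {lam mu : YoungDiagram} {α : Type*} (s : Finset α) (c : α → K)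
    (u : α → Words K mu.card) : eigenvec q lam mu (∑ a ∈ s, c a • u a) =
      ∑ a ∈ s, c a • eigenvec q lam mu (u a) := by
  simp only [eigenvec_eq hq, map_sum, map_smul, sum_act, smul_act]

/-- Bases of the kernels of `R_{|mu|,1}` on the Specht modules of all shapes `mu` whose complement
in `lam` is a horizontal strip combine to an eigenbasis of the Specht module of shape `lam`. -/
theorem exists_basis_specht (hq : 0 < q) (lam : YoungDiagram) {I : Type*} (mu : I → YoungDiagram)
    (hmu : Function.Injective mu) (hh : ∀ i, IsHorizontalStrip lam (mu i))
    (hall : ∀ nu, IsHorizontalStrip lam nu → ∃ i, mu i = nu) (ι : I → Type*)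
    (κ : ∀ i, Module.Basis (ι i) K (spechtKer q (mu i))) :
    ∃ b : Module.Basis (Σ i, ι i) K (specht q lam),
      ∀ i a, (b ⟨i, a⟩ : Words K lam.card) = eigenvec q lam (mu i) (κ i a : Words K (mu i).card) := by
  obtain ⟨v, hv⟩ : ∃ v : (Σ i, ι i) → specht q lam, ∀ i a, (v ⟨i, a⟩ : Words K lam.card) =
      eigenvec q lam (mu i) (κ i a : Words K (mu i).card) :=
    ⟨fun p => ⟨_, eigenvec_mem_specht hq (hh p.1).1 (κ p.1 p.2).2⟩, fun _ _ => rfl⟩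
  have hli : LinearIndependent K v := by
    refine LinearIndependent.of_comp (specht q lam).subtype (linearIndependent_iff.2 fun l hl => ?_)
    rw [Finsupp.linearCombination_apply, Finsupp.sigma_sum] at hl
    simp only [Function.comp_apply, Submodule.subtype_apply, hv] at hl
    -- the part of the combination that belongs to the shape `mu i`
    obtain ⟨w, hwd⟩ : ∃ w : ∀ i, spechtKer q (mu i),
        ∀ i, w i = Finsupp.linearCombination K (κ i) (l.split i) := ⟨_, fun _ => rfl⟩
    have hw : ∀ i, ((l.split i).sum fun a c => c • eigenvec q lam (mu i)
        (κ i a : Words K (mu i).card)) = eigenvec q lam (mu i) (w i : Words K (mu i).card) := by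
      intro i
      rw [hwd]
      simp only [Finsupp.linearCombination_apply, Finsupp.sum, Submodule.coe_sum,
        Submodule.coe_smul]
      rw [eigenvec_sum_smul hq]
    have hl' : ∑ i ∈ l.splitSupport, eigenvec q lam (mu i) (w i : Words K (mu i).card) = 0 := by
      rw [← hl]
      exact Finset.sum_congr rfl fun i _ => (hw i).symm
    have h0 := eigenvec_independent hq hmu hh 
      (u := fun i => (w i : Words K (mu i).card)) (fun i => (w i).2) hl'
    ext ⟨i, a⟩
    have hi : l.split i = 0 := by
      by_contra h
      have h1 : w i = 0 := Subtype.ext (h0 i ((Finsupp.mem_splitSupport_iff_nonzero l i).2 h))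
      rw [hwd] at h1
      have h2 := congrArg (κ i).repr h1
      rw [(κ i).repr_linearCombination, map_zero] at h2
      exact h h2
    rw [← Finsupp.split_apply, hi]
    rfl
  have hspan : ⊤ ≤ Submodule.span K (Set.range v) := by
    rintro ⟨x, hx⟩ -
    have key : x ∈ (Submodule.span K (Set.range v)).map (specht q lam).subtype := by
      rw [Submodule.map_span]
      refine Submodule.span_le.2 ?_ (specht_le_span hq lam hx)
      rintro _ ⟨nu, hnu, u, hu, rfl⟩
      obtain ⟨i, rfl⟩ := hall nu hnu
      have hu' := congrArg (Subtype.val) ((κ i).linearCombination_repr ⟨u, hu⟩)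
      rw [Finsupp.linearCombination_apply, Finsupp.sum, Submodule.coe_sum] at hu'
      simp only [Submodule.coe_smul] at hu'
      rw [SetLike.mem_coe, ← hu', eigenvec_sum_smul hq]
      refine Submodule.sum_mem _ fun a _ => Submodule.smul_mem _ _ (Submodule.subset_span ?_)
      exact ⟨v ⟨i, a⟩, ⟨_, rfl⟩, hv i a⟩
    obtain ⟨y, hy, hyx⟩ := key
    have : y = ⟨x, hx⟩ := Subtype.ext hyx
    rwa [← this]
  exact ⟨Module.Basis.mk hli hspan, fun i a => by rw [Module.Basis.mk_apply, hv]⟩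

end SpechtBasis

/-! ### The regular representation -/

section Regular

variable {K : Type*} [Field K] {q : K} {n : ℕ}

open Classical in
variable (q n) in
/-- The elements `T_w` of the Hecke algebra for `w` in the symmetric group on `m` letters, given by
the reduced words `d_1 d_2 ⋯ d_m` with `d_l = T_{l-1} T_{l-2} ⋯ T_k` for some `1 ≤ k ≤ l`. -/
noncomputable def stdBasis : ℕ → Finset (Hecke q n)
  | 0 => {1}
  | m + 1 => Finset.image₂ (fun h d => h * d) (stdBasis m)
      ((Finset.Icc 1 (m + 1)).image fun k => desc (T q n) k (m + 1))

lemma card_stdBasis_le (m : ℕ) : (stdBasis q n m).card ≤ m.factorial := by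
  classical
  induction m with
  | zero => simp [stdBasis]
  | succ m ih =>
    rw [stdBasis, Nat.factorial_succ, mul_comm]
    refine (Finset.card_image₂_le _ _ _).trans (Nat.mul_le_mul ih ?_)
    exact Finset.card_image_le.trans (by simp)

lemma one_mem_stdBasis (m : ℕ) : 1 ∈ stdBasis q n m := by
  classical
  induction m with
  | zero => simp [stdBasis]
  | succ m ih =>
    rw [stdBasis]
    exact Finset.mem_image₂.2 ⟨1, ih, 1, Finset.mem_image.2 ⟨m + 1, by simp, desc_of_le le_rfl⟩,
      mul_one 1⟩

/-- The span of the elements `T_w` is stable under right multiplication by the generators. -/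
lemma span_stdBasis_mul_T {m i : ℕ} (hm : m ≤ n) (hi : 1 ≤ i) (him : i < m) {h : Hecke q n}
    (hh : h ∈ Submodule.span K (stdBasis q n m : Set (Hecke q n))) :
    h * T q n i ∈ Submodule.span K (stdBasis q n m : Set (Hecke q n)) := by
  classical
  have H := isHecke q n
  induction m generalizing i h with
  | zero => omega
  | succ m ih =>
    have hmul : ∀ g ∈ Submodule.span K (stdBasis q n m : Set (Hecke q n)), ∀ k, 1 ≤ k → k ≤ m + 1 →
        g * desc (T q n) k (m + 1) ∈ Submodule.span K (stdBasis q n (m + 1) : Set (Hecke q n)) := by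
      intro g hg k h1 h2
      induction hg using Submodule.span_induction with
      | mem g hg =>
        refine Submodule.subset_span ?_
        rw [Finset.mem_coe, stdBasis]
        exact Finset.mem_image₂.2 ⟨g, hg, _, Finset.mem_image.2 ⟨k, Finset.mem_Icc.2 ⟨h1, h2⟩, rfl⟩,
          rfl⟩
      | zero => simp
      | add x y _ _ h1 h2 => rw [add_mul]; exact Submodule.add_mem _ h1 h2
      | smul c x _ h => rw [smul_mul_assoc]; exact Submodule.smul_mem _ _ h
    induction hh using Submodule.span_induction with
    | mem h hh =>
      rw [Finset.mem_coe, stdBasis] at hh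
      obtain ⟨g, hg, d, hd, rfl⟩ := Finset.mem_image₂.1 hh
      obtain ⟨k, hk, rfl⟩ := Finset.mem_image.1 hd
      rw [Finset.mem_Icc] at hk
      have hg' : g ∈ Submodule.span K (stdBasis q n m : Set (Hecke q n)) := Submodule.subset_span hg
      rw [mul_assoc]
      rcases lt_trichotomy k i with hki | rfl | hki
      · rw [H.desc_mul_t_of_lt hki him hm, ← mul_assoc]
        exact hmul _ (ih (by omega) (by omega) (by omega) hg') k hk.1 hk.2
      · rw [H.desc_mul_t_of_eq hi him hm, mul_add, mul_smul_comm, mul_smul_comm]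
        exact Submodule.add_mem _ (Submodule.smul_mem _ _ (hmul _ hg' _ hk.1 hk.2))
          (Submodule.smul_mem _ _ (hmul _ hg' _ (by omega) (by omega)))
      · rcases eq_or_lt_of_le (Nat.succ_le_of_lt hki) with rfl | h2
        · rw [← desc_mul_last him]
          exact hmul _ hg' _ hi (by omega)
        · rw [H.desc_mul_t_of_gt hm h2, ← mul_assoc]
          exact hmul _ (ih (by omega) hi (by omega) hg') k hk.1 hk.2
    | zero => simp
    | add x y _ _ h1 h2 => rw [add_mul]; exact Submodule.add_mem _ h1 h2
    | smul c x _ h => rw [smul_mul_assoc]; exact Submodule.smul_mem _ _ h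

lemma span_stdBasis : Submodule.span K (stdBasis q n n : Set (Hecke q n)) = ⊤ := by
  refine Submodule.eq_top_iff'.2 fun h => ?_
  have key : ∀ g ∈ Submodule.span K (stdBasis q n n : Set (Hecke q n)),
      g * h ∈ Submodule.span K (stdBasis q n n : Set (Hecke q n)) := by
    induction h using hecke_induction with
    | one => intro g hg; rwa [mul_one]
    | T i h1 h2 => exact fun g hg => span_stdBasis_mul_T le_rfl h1 h2 hg
    | smul c h ih => intro g hg; rw [mul_smul_comm]; exact Submodule.smul_mem _ _ (ih g hg)
    | add x y h1 h2 => intro g hg; rw [mul_add]; exact Submodule.add_mem _ (h1 g hg) (h2 g hg)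
    | mul x y h1 h2 => intro g hg; rw [← mul_assoc]; exact h2 _ (h1 g hg)
  simpa using key 1 (Submodule.subset_span (one_mem_stdBasis n))

lemma finiteDimensional_hecke : FiniteDimensional K (Hecke q n) :=
  Module.finite_def.2 ⟨stdBasis q n n, span_stdBasis⟩

lemma finrank_hecke_le : Module.finrank K (Hecke q n) ≤ n.factorial := by
  rw [← finrank_top, ← span_stdBasis]
  exact (finrank_span_finset_le_card _).trans (card_stdBasis_le n)

variable (q n) in
/-- The orbit map of the word `0 1 ⋯ (n - 1)`, all of whose letters are different. -/
noncomputable def orbitMap : Hecke q n →ₗ[K] Words K n where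
  toFun h := Finsupp.single (fun i : Fin n => (i : ℕ)) 1 ◃ h
  map_add' g h := act_add _ g h
  map_smul' c h := act_smul _ h c

lemma orbitMap_apply (h : Hecke q n) :
    orbitMap q n h = Finsupp.single (fun i : Fin n => (i : ℕ)) 1 ◃ h := rfl

lemma orbitMap_mul (g h : Hecke q n) : orbitMap q n (g * h) = orbitMap q n g ◃ h := by
  simp only [orbitMap_apply, act_mul]

lemma act_mem_range_orbitMap (h : Hecke q n) :
    ∀ v ∈ LinearMap.range (orbitMap q n), v ◃ h ∈ LinearMap.range (orbitMap q n) := by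
  rintro _ ⟨g, rfl⟩
  exact ⟨g * h, orbitMap_mul g h⟩

lemma single_swap_mem (hq : q ≠ 0) {M : Submodule K (Words K n)}
    (hM : ∀ h : Hecke q n, ∀ v ∈ M, v ◃ h ∈ M) {a b : Fin n} (hab : b.1 = a.1 + 1) {w : Fin n → ℕ}
    (hw : Finsupp.single w 1 ∈ M) : Finsupp.single (w ∘ Equiv.swap a b) 1 ∈ M := by
  rcases lt_trichotomy (w a) (w b) with h | h | h
  · rw [← single_act_T_of_lt (q := q) hab h]
    exact hM _ _ hw
  · have e : w ∘ Equiv.swap a b = w := by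
      funext p
      simp only [Function.comp_apply, Equiv.swap_apply_def]
      split_ifs with h1 h2
      · rw [h1, h]
      · rw [h2, h]
      · rfl
    rwa [e]
  · have e := single_act_T_of_gt (q := q) hab h
    have h1 : q • Finsupp.single (w ∘ Equiv.swap a b) (1 : K) ∈ M := by
      rw [← add_sub_cancel_right (q • Finsupp.single (w ∘ Equiv.swap a b) (1 : K))
        ((q - 1) • Finsupp.single w 1), ← e]
      exact M.sub_mem (hM _ _ hw) (M.smul_mem _ hw)
    exact (M.smul_mem_iff hq).1 h1

lemma single_comp_perm_mem (hq : q ≠ 0) {M : Submodule K (Words K n)}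
    (hM : ∀ h : Hecke q n, ∀ v ∈ M, v ◃ h ∈ M) (σ : Equiv.Perm (Fin n)) {w : Fin n → ℕ}
    (hw : Finsupp.single w 1 ∈ M) : Finsupp.single (w ∘ σ) 1 ∈ M := by
  cases n with
  | zero => rwa [Subsingleton.elim (w ∘ σ) w]
  | succ n =>
    have hσ : σ ∈ Submonoid.closure
        (Set.range fun i : Fin n => Equiv.swap i.castSucc i.succ) := by
      rw [Equiv.Perm.mclosure_swap_castSucc_succ]
      trivial
    induction hσ using Submonoid.closure_induction generalizing w with
    | mem σ hσ =>
      obtain ⟨i, rfl⟩ := hσ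
      exact single_swap_mem hq hM (by simp) hw
    | one => exact hw
    | mul σ τ _ _ h1 h2 => exact h2 (h1 hw)

/-- The Hecke algebra acts faithfully on the word with distinct letters: the orbit contains the
`n!` rearrangements of the word, while the algebra has dimension at most `n!`. -/
lemma orbitMap_injective (hq : q ≠ 0) : Function.Injective (orbitMap q n) := by
  have := finiteDimensional_hecke (q := q) (n := n)
  have h0 : Finsupp.single (fun i : Fin n => (i : ℕ)) (1 : K) ∈ LinearMap.range (orbitMap q n) :=
    ⟨1, by rw [orbitMap_apply, act_one]⟩
  let f : Equiv.Perm (Fin n) → LinearMap.range (orbitMap q n) := fun σ =>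
    ⟨_, single_comp_perm_mem hq act_mem_range_orbitMap σ h0⟩
  have hf : LinearIndependent K f := by
    refine LinearIndependent.of_comp (LinearMap.range (orbitMap q n)).subtype ?_
    have h1 := (Finsupp.basisSingleOne (R := K) (ι := Fin n → ℕ)).linearIndependent.comp
      (fun σ : Equiv.Perm (Fin n) => (fun i : Fin n => (i : ℕ)) ∘ σ) (fun σ τ h => by
        ext i
        exact congrFun h i)
    convert h1 using 1
    funext σ
    simp [f]
  have h1 := hf.fintype_card_le_finrank
  rw [Fintype.card_perm, Fintype.card_fin] at h1
  have h2 := LinearMap.finrank_range_add_finrank_ker (orbitMap q n)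
  have h3 := finrank_hecke_le (q := q) (n := n)
  rw [← LinearMap.ker_eq_bot]
  exact Submodule.finrank_eq_zero.1 (by omega)

/-- The Hecke algebra has a basis of eigenvectors for right multiplication by all `R_{n,k}`. -/
theorem exists_basis_hecke [LinearOrder K] [IsStrictOrderedRing K] (hq : 0 < q) :
    ∃ (ι : Set (Hecke q n)) (b : Module.Basis ι K (Hecke q n)),
      ∀ i : ι, ∀ k : ℕ, ∃ c : K, b i * R q n k = c • b i := by
  have := finiteDimensional_hecke (q := q) (n := n)
  have hinj := orbitMap_injective (n := n) hq.ne'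
  have hM := act_mem_range_orbitMap (q := q) (n := n)
  let E : Set (Hecke q n) := {h | ∀ k : ℕ, ∃ c : K, h * R q n k = c • h}
  have hspan : ⊤ ≤ Submodule.span K E := by
    intro h _
    have h1 : orbitMap q n h ∈ (Submodule.span K E).map (orbitMap q n) := by
      refine Submodule.span_le.2 ?_ (mem_span_insProd hq hM n (LinearMap.mem_range_self _ h))
      rintro _ ⟨j, hj, u, hu, huj, rfl⟩
      refine level_induction hq hM hj le_rfl (C := fun x => x ◃ insProd (T q n) n (n - j) ∈
        (Submodule.span K E).map (orbitMap q n)) (by simp) (fun v w h1 h2 => by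
          rw [add_act]; exact Submodule.add_mem _ h1 h2) ?_ hu huj
      intro μ t x hμ ht _ hx _
      obtain ⟨g, hg⟩ := hM (insProd (T q n) n (n - j)) x hx.mem
      rw [← hg]
      refine Submodule.mem_map_of_mem (Submodule.subset_span fun k =>
        ⟨shuffleEigenvalue q (fun l => ((t.map content).getD
        ((t.map content).length - (l - j)) 0)) j n k, hinj ?_⟩)
      rw [orbitMap_mul, map_smul, hg]
      have hr := hx.remSum
      rw [hμ] at hr
      have he := hx.eig
      rw [hμ] at he
      exact act_insProd_act_R hq hj hr (fun l h1 h2 => eig_act_Jm he h1 (by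
        rw [List.length_map, ht]; omega)) k
    obtain ⟨g, hg, hgh⟩ := h1
    rwa [← hinj hgh]
  exact ⟨_, Module.Basis.ofSpan hspan, fun i k =>
    Module.Basis.ofSpan_subset hspan ⟨i, rfl⟩ k⟩

end Regular

end HeckeShuffle


open HeckeShuffle in
theorem mainTheorem4 (K : Subfield ℝ) (q : K) (hq : 0 < (q : ℝ)) :
    (∀ (lam : YoungDiagram)
      (ι : {mu : YoungDiagram // mu ≤ lam} → Type*)
      (κ : ∀ mu : {mu : YoungDiagram // mu ≤ lam}, Module.Basis (ι mu) K (spechtKer q mu.1)),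
      ∃ b : Module.Basis
          (Σ mu : {mu : {mu : YoungDiagram // mu ≤ lam} // IsHorizontalStrip lam mu.1}, ι mu.1)
          K (specht q lam),
        ∀ (mu : {mu : {mu : YoungDiagram // mu ≤ lam} // IsHorizontalStrip lam mu.1})
          (i : ι mu.1),
          (b ⟨mu, i⟩ : Words K lam.card) =
              eigenvec q lam mu.1.1 (κ mu.1 i : Words K mu.1.1.card) ∧
          ∀ k : ℕ, rightAct q (R q lam.card k) (b ⟨mu, i⟩ : Words K lam.card) =
            eigenvalue q lam mu.1.1 k • (b ⟨mu, i⟩ : Words K lam.card)) ∧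
    (∀ n : ℕ, ∃ (ι : Type) (b : Module.Basis ι K (Hecke q n)),
      ∀ i : ι, ∀ k : ℕ, ∃ c : K, b i * R q n k = c • b i) := by
  have hq' : 0 < q := by exact_mod_cast hq
  refine ⟨fun lam ι κ => ?_, fun n => ?_⟩
  · obtain ⟨b, hb⟩ := exists_basis_specht hq' lam
      (fun mu : {mu : {mu : YoungDiagram // mu ≤ lam} // IsHorizontalStrip lam mu.1} => mu.1.1)
      (fun _ _ h => Subtype.ext (Subtype.ext h)) (fun mu => mu.2)
      (fun nu h => ⟨⟨⟨nu, h.1⟩, h⟩, rfl⟩) (fun mu => ι mu.1) (fun mu => κ mu.1)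
    refine ⟨b, fun mu i => ⟨hb mu i, fun k => ?_⟩⟩
    rw [hb]
    exact eigenvec_act_R hq' mu.2.1 (κ mu.1 i).2 k
  · obtain ⟨ι, b, hb⟩ := exists_basis_hecke (n := n) hq'
    exact ⟨ι, b, hb⟩
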